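/- Let $\mathbb D^2$ be the open unit bidisc and let $H^\infty_2$ be the algebra of bounded holomorphic functions on $\mathbb D^2$ with the supremum norm. For a pair $M=(M^1,M^2)$ of commuting complex $m\times m$ matrices, the joint spectrum is the set of $\lambda=(\lambda^1,\lambda^2)\in\mathbb C^2$ for which there is $x\in\mathbb C^m\setminus\{0\}$ with $M^ix=\lambda^ix$ for $i=1,2$. If it is contained in $\mathbb D^2$ and $f$ is holomorphic on $\mathbb D^2$, put $$f(M)=\frac1{(2\pi i)^2}\int_{|\xi^1|=r}\int_{|\xi^2|=r} f(\xi^1,\xi^2)(\xi^1 Id-M^1)^{-1}(\xi^2 Id-M^2)^{-1}\,d\xi^2\,d\xi^1 ,$$ which is the same for all $r<1$ sufficiently close to $1$. A reproducing kernel Hilbert space $\mathcal H_k$ (with kernel $k$) of holomorphic functions on $\mathbb D^2$ is a Hilbert space of such functions on which all point evaluations are continuous; its kernel $k$ is called admissible if, for $i=1,2$, multiplication by the coordinate function $z^i$ maps $\mathcal H_k$ into itself and is a contraction. A sequence $(V_n)_{n\in\mathbb N}$ of closed subspaces of a Hilbert space is a Riesz system with Riesz bound $C>0$ if for all $x_n\in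 V_n$ with $\sum_n\|x_n\|^2<\infty$ the series $\sum_n x_n$ converges unconditionally and $$\frac1{C^2}\sum_n\|x_n\|^2\le\Big\|\sum_n x_n\Big\|^2\le C^2\sum_n\|x_n\|^2 .$$ **Theorem.** Let $A=(A_n)_{n\in\mathbb N}$ be a sequence of pairs of commuting complex square matrices, $A_n$ of size $s_n\times s_n$ (the sizes may vary and need not be bounded), with joint spectra contained in $\mathbb D^2$. For an admissible kernel $k$ on $\mathbb D^2$ let $H_n^k=\mathcal H_k\ominus\{f\in\mathcal H_k: f(A_n)=0\}$. The following are equivalent: (i) $A$ is interpolating for $H^\infty_2$: for every bounded sequence $(\phi_n)_{n\in\mathbb N}$ in $H^\infty_2$ there is $\phi\in H^\infty_2$ with $\phi(A_n)=\phi_n(A_n)$ for all $n$; (ii) for every bounded sequence $(w_n)_{n\in\mathbb N}$ in $\mathbb C$ there is $\phi\in H^\infty_2$ with $\phi(A_n)=w_n\,Id$ for all $n$; (iii) there is $C>0$ such that, for every admissible kernel $k$ on $\mathbb D^2$, the sequence $(H_n^k)_{n\in\mathbb N}$ is a Riesz system in $\mathcal H_k$ with Riesz bound $C$; (iv) there is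 a sequence $(f_n)_{n\in\mathbb N}$ in $H^\infty_2$ such that $f_n(A_n)=Id$ for all $n$, $f_n(A_j)=0$ for all $j\ne n$, and $\sup_{z\in\mathbb D^2}\sum_n|f_n(z)|<\infty$. -/

import Mathlib

open Filter Topology

noncomputable section

/-- The open unit bidisc. -/
def bidisc : Set (Fin 2 → ℂ) := {z | ∀ i, ‖z i‖ < 1}

/-- Extension by zero of a function on the bidisc to the whole of `ℂ²`. It only serves to apply
Mathlib's derivative and integral; the values outside the bidisc are never used. -/
def zeroExt (f : bidisc → ℂ) : (Fin 2 → ℂ) → ℂ := Function.extend Subtype.val f 0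

/-- `f` is holomorphic on the bidisc. -/
def IsHolo (f : bidisc → ℂ) : Prop := DifferentiableOn ℂ (zeroExt f) bidisc

/-- The algebra `H^∞` of bounded holomorphic functions on the bidisc, as a set of functions. -/
def HInfty : Set (bidisc → ℂ) := {f | IsHolo f ∧ ∃ B : ℝ, ∀ z, ‖f z‖ ≤ B}

/-- The sequence `φ` lies in `H^∞` and is bounded for the supremum norm. -/
def IsBoundedSeqHInfty (φ : ℕ → bidisc → ℂ) : Prop :=
  (∀ n, IsHolo (φ n)) ∧ ∃ B : ℝ, ∀ n z, ‖φ n z‖ ≤ B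

/-- The joint spectrum of a pair of commuting matrices: the set of its joint eigenvalues. -/
def jointSpectrum {m : ℕ} (M : Fin 2 → Matrix (Fin m) (Fin m) ℂ) : Set (Fin 2 → ℂ) :=
  {l | ∃ x : Fin m → ℂ, x ≠ 0 ∧ ∀ i, (M i).mulVec x = l i • x}

/-- The matrix Cauchy integral (entry by entry)
`(2πi)⁻² ∫∫ f(ξ₀, ξ₁) (ξ₀ Id - M₀)⁻¹ (ξ₁ Id - M₁)⁻¹ dξ₀ dξ₁` over the torus `|ξ₀| = |ξ₁| = r`. -/
def cauchyIntegralMat {m : ℕ} (f : bidisc → ℂ) (M : Fin 2 → Matrix (Fin m) (Fin m) ℂ) (r : ℝ) :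
    Matrix (Fin m) (Fin m) ℂ :=
  Matrix.of fun i j =>
    ((2 * Real.pi * Complex.I : ℂ) ^ 2)⁻¹ *
      torusIntegral
        (fun ξ : Fin 2 → ℂ => zeroExt f ξ *
          ((ξ 0 • (1 : Matrix (Fin m) (Fin m) ℂ) - M 0)⁻¹ *
            (ξ 1 • (1 : Matrix (Fin m) (Fin m) ℂ) - M 1)⁻¹) i j)
        (fun _ => 0) (fun _ => r)

/-- The value `f(M)` of a holomorphic function on the bidisc at a pair of commuting matrices with
joint spectrum in the bidisc. For such data the Cauchy integral over the torus of radius `r < 1`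
does not depend on `r` once the torus encloses the spectra of both matrices, so that
the limit for `r → 1` exists and is this common value; it makes sense without boundary values. -/
def evalMat {m : ℕ} (f : bidisc → ℂ) (M : Fin 2 → Matrix (Fin m) (Fin m) ℂ) :
    Matrix (Fin m) (Fin m) ℂ :=
  limUnder (𝓝[<] (1 : ℝ)) (cauchyIntegralMat f M)

/-- `A` is interpolating for `H^∞` of the bidisc. -/
def IsInterpolating {s : ℕ → ℕ} (A : (n : ℕ) → Fin 2 → Matrix (Fin (s n)) (Fin (s n)) ℂ) : Prop :=
  ∀ φ : ℕ → bidisc → ℂ, IsBoundedSeqHInfty φ →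
    ∃ ψ ∈ HInfty, ∀ n, evalMat ψ (A n) = evalMat (φ n) (A n)

/-- The kernel of the reproducing kernel Hilbert space `H` on the bidisc is admissible: the elements
of `H` are holomorphic functions and the multiplications by the two coordinate functions
are contractions of `H` into itself (they commute automatically). -/
def IsAdmissible (H : Type) [NormedAddCommGroup H] [InnerProductSpace ℂ H] [RKHS ℂ H bidisc ℂ] :
    Prop :=
  (∀ f : H, IsHolo ⇑f) ∧
    ∀ (i : Fin 2) (f : H), ∃ g : H, (∀ z : bidisc, g z = z.1 i * f z) ∧ ‖g‖ ≤ ‖f‖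

/-- `H ⊖ {f ∈ H | f(M) = 0}`. The set `{f ∈ H | f(M) = 0}` is a subspace; taking its span just
spares a proof inside the definition and does not change its orthogonal complement. -/
def modelSpace (H : Type) [NormedAddCommGroup H] [InnerProductSpace ℂ H] [RKHS ℂ H bidisc ℂ]
    {m : ℕ} (M : Fin 2 → Matrix (Fin m) (Fin m) ℂ) : Submodule ℂ H :=
  (Submodule.span ℂ {f : H | evalMat (⇑f) M = 0})ᗮ

/-- The sequence `V` of subspaces is a Riesz system with Riesz bound `C`: for unit vectors
`h n ∈ V n` and a square summable sequence `a`, the series `∑ a n • h n` converges and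
`C⁻² ∑ |a n|² ≤ ‖∑ a n • h n‖² ≤ C² ∑ |a n|²`. This is written in terms of `x n = a n • h n`,
an arbitrary square summable sequence with `x n ∈ V n`, so that it keeps its
meaning when some of the `V n`, which then has no unit vector, is zero. -/
def IsRieszSystem {H : Type} [NormedAddCommGroup H] [InnerProductSpace ℂ H]
    (V : ℕ → Submodule ℂ H) (C : ℝ) : Prop :=
  ∀ x : ℕ → H, (∀ n, x n ∈ V n) → Summable (fun n => ‖x n‖ ^ 2) →
    Summable x ∧
      1 / C ^ 2 * ∑' n, ‖x n‖ ^ 2 ≤ ‖∑' n, x n‖ ^ 2 ∧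
      ‖∑' n, x n‖ ^ 2 ≤ C ^ 2 * ∑' n, ‖x n‖ ^ 2

end

/-! The proof runs through the cycle (i) → (ii) → (iii) → (iv) → (i). The first implication takes
constant functions, and the last one sums `∑ φ n * f n` (`isInterpolating_of_peak`). Beneath
everything lies the functional calculus `evalMat`: it is a homomorphism, continuous under bounded
pointwise convergence, because near the boundary the Cauchy integral no longer depends on the radius
and is determined by polynomials.

(ii) → (iii). A Baire category argument on the space of sign sequences gives one bound `B` for
functions interpolating arbitrary signs (`exists_uniform_sign_interpolation`). If `φ(A n) = w n • 1`
for all `n`, then the adjoint of multiplication by `φ` acts on the `n`-th model space as the scalar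
`w n`. So the passage from `∑ x n` to `∑ w n • x n` costs at most the norm of a multiplication
operator, and Andô's inequality (`norm_polyEval_le_of_contractions`) bounds it by `B` in all
admissible spaces at once (`norm_sum_boolSign_le`). Uniformly bounded sign changes give a Riesz
system by the parallelogram law (`isRieszSystem_of_signs`). Andô's inequality itself comes from an
explicit dilation to commuting isometries, for which Fourier analysis on finite groups suffices.

(iii) → (iv). Fix `N`, and consider families of matrices indexed by `j < N`. Let `L i` be left
multiplication by the `A j i`, let `e` be the family of identities, and let `p n` be the identity at
place `n` and zero elsewhere. Functions `φ n` with `φ n (A j) = δ` and `∑ |φ n|² ≤ c` arise from an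
Agler decomposition `c • e eᴴ - ∑ p n (p n)ᴴ = ∑ i, (Γ i - L i Γ i (L i)ᴴ)` with `Γ i ≥ 0`: a
lurking contraction and its transfer function produce them (`exists_finite_interpolation`). By
Hahn–Banach separation the decomposition exists once `∑ |S (p n)|² ≤ c₀ |S e|²`, for some `c₀ < c`,
whenever the seminorm `|S v|` is contracted by both `L i` (`exists_agler_decomposition`).

Such an `S` is tested by an admissible space: the Hardy space with squared norm `‖f‖² + t² |S
f(A)|²` (`graphSpace`). Its Riesz bound yields biorthogonal elements `g n` with `∑ ‖g n‖² ≤ C⁴ ‖1‖²`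
(`exists_separating_of_isRieszSystem`), and for `t → ∞` this becomes the required inequality with
`c₀ = C⁴` (`sum_euclSq_le_of_isRieszSystem`). Montel's theorem lets `N → ∞`, and the squares of the
limit functions are absolutely summable. -/

/-! ### Integrals over the torus. -/

/-- The distinguished boundary of the polydisc of radius `r`. -/
def torusSet (r : ℝ) : Set (Fin 2 → ℂ) := {ξ | ∀ i, ‖ξ i‖ = r}

lemma torusMap_mem_torusSet {r : ℝ} (hr : 0 ≤ r) (θ : Fin 2 → ℝ) :
    torusMap (fun _ : Fin 2 => (0 : ℂ)) (fun _ => r) θ ∈ torusSet r := by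
  intro i
  simp [torusMap, abs_of_nonneg hr]

lemma continuous_torusMap (r : ℝ) :
    Continuous (torusMap (fun _ : Fin 2 => (0 : ℂ)) (fun _ => r)) := by
  unfold torusMap
  fun_prop

lemma torusIntegrable_of_continuousOn {r : ℝ} (hr : 0 ≤ r) {F : (Fin 2 → ℂ) → ℂ}
    (hF : ContinuousOn F (torusSet r)) : TorusIntegrable F (fun _ => 0) (fun _ => r) := by
  unfold TorusIntegrable
  have : Continuous fun θ => F (torusMap (fun _ : Fin 2 => (0 : ℂ)) (fun _ => r) θ) :=
    hF.comp_continuous (continuous_torusMap r) (torusMap_mem_torusSet hr)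
  exact this.continuousOn.integrableOn_compact isCompact_Icc

/-- Bounded convergence for torus integrals. -/
lemma tendsto_torusIntegral {ι : Type*} {l : Filter ι} [l.IsCountablyGenerated] {r : ℝ}
    (hr : 0 ≤ r) {F : ι → (Fin 2 → ℂ) → ℂ} {G : (Fin 2 → ℂ) → ℂ} (B : ℝ)
    (hF : ∀ n, ContinuousOn (F n) (torusSet r))
    (hB : ∀ n, ∀ ξ ∈ torusSet r, ‖F n ξ‖ ≤ B)
    (hlim : ∀ ξ ∈ torusSet r, Tendsto (fun n => F n ξ) l (𝓝 (G ξ))) :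
    Tendsto (fun n => torusIntegral (F n) (fun _ => 0) (fun _ => r)) l
      (𝓝 (torusIntegral G (fun _ => 0) (fun _ => r))) := by
  unfold torusIntegral
  have hc : Continuous fun θ : Fin 2 → ℝ =>
      (∏ i : Fin 2, ((r : ℂ) * Complex.exp (θ i * Complex.I) * Complex.I)) := by fun_prop
  refine MeasureTheory.tendsto_integral_filter_of_dominated_convergence
    (fun _ => r ^ 2 * B) ?_ ?_ ?_ ?_
  · refine Eventually.of_forall fun n => ?_
    have : Continuous fun θ => F n (torusMap (fun _ : Fin 2 => (0 : ℂ)) (fun _ => r) θ) :=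
      (hF n).comp_continuous (continuous_torusMap r) (torusMap_mem_torusSet hr)
    exact (hc.smul this).aestronglyMeasurable
  · refine Eventually.of_forall fun n => Eventually.of_forall fun θ => ?_
    rw [norm_smul]
    have h1 : ‖∏ i : Fin 2, ((r : ℂ) * Complex.exp (θ i * Complex.I) * Complex.I)‖ = r ^ 2 := by
      simp [Fin.prod_univ_two, abs_of_nonneg hr, sq]
    rw [h1]
    exact mul_le_mul_of_nonneg_left (hB n _ (torusMap_mem_torusSet hr θ)) (by positivity)
  · exact continuous_const.integrableOn_Icc
  · refine Eventually.of_forall fun θ => ?_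
    exact (hlim _ (torusMap_mem_torusSet hr θ)).const_smul _

lemma torusIntegral_congr {r : ℝ} (hr : 0 ≤ r) {F G : (Fin 2 → ℂ) → ℂ}
    (h : ∀ ξ ∈ torusSet r, F ξ = G ξ) :
    torusIntegral F (fun _ => 0) (fun _ => r) = torusIntegral G (fun _ => 0) (fun _ => r) := by
  unfold torusIntegral
  simp only [h _ (torusMap_mem_torusSet hr _)]

lemma torusIntegral_finset_sum {ι : Type*} (s : Finset ι) {r : ℝ} (hr : 0 ≤ r)
    {F : ι → (Fin 2 → ℂ) → ℂ} (hF : ∀ n ∈ s, ContinuousOn (F n) (torusSet r)) :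
    torusIntegral (fun ξ => ∑ n ∈ s, F n ξ) (fun _ => 0) (fun _ => r) =
      ∑ n ∈ s, torusIntegral (F n) (fun _ => 0) (fun _ => r) := by
  unfold torusIntegral
  simp only [Finset.smul_sum]
  exact MeasureTheory.integral_finsetSum _ fun n hn =>
    (torusIntegrable_of_continuousOn hr (hF n hn)).function_integrable

lemma torusIntegral_two {r : ℝ} (hr : 0 ≤ r) {F : (Fin 2 → ℂ) → ℂ}
    (hF : ContinuousOn F (torusSet r)) :
    torusIntegral F (fun _ => 0) (fun _ => r) =
      ∮ x in C(0, r), ∮ y in C(0, r), F ![x, y] := by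
  rw [torusIntegral_succ (torusIntegrable_of_continuousOn hr hF)]
  congr 1
  ext x
  rw [torusIntegral_dim1]
  congr 1
  ext y
  congr 1
  ext i
  fin_cases i <;> rfl

lemma torusIntegral_two_mul {r : ℝ} (hr : 0 ≤ r) {f g : ℂ → ℂ}
    (hf : ContinuousOn f (Metric.sphere 0 r)) (hg : ContinuousOn g (Metric.sphere 0 r)) :
    torusIntegral (fun ξ : Fin 2 → ℂ => f (ξ 0) * g (ξ 1)) (fun _ => 0) (fun _ => r) =
      (∮ x in C(0, r), f x) * ∮ y in C(0, r), g y := by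
  rw [torusIntegral_two hr]
  · simp only [Matrix.cons_val_zero, Matrix.cons_val_one]
    have : ∀ x, (∮ y in C(0, r), f x * g y) = f x * ∮ y in C(0, r), g y := fun x => by
      simp
    simp only [this]
    have := circleIntegral.integral_smul (∮ y in C(0, r), g y) f 0 r
    simp only [smul_eq_mul] at this
    rw [mul_comm, ← this]
    simp only [mul_comm]
  · refine ContinuousOn.mul (hf.comp (by fun_prop) ?_) (hg.comp (by fun_prop) ?_)
    · intro ξ hξ; simpa using hξ 0
    · intro ξ hξ; simpa using hξ 1

/-! ### Holomorphic functions on the bidisc. -/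

lemma isOpen_bidisc : IsOpen bidisc := by
  have : bidisc = ⋂ i : Fin 2, {z | ‖z i‖ < 1} := by ext; simp [bidisc]
  rw [this]
  exact isOpen_iInter_of_finite fun i => isOpen_lt (by fun_prop) (by fun_prop)

lemma zeroExt_apply (f : bidisc → ℂ) (z : bidisc) : zeroExt f z.1 = f z :=
  Subtype.val_injective.extend_apply _ _ _

lemma zeroExt_of_mem (f : bidisc → ℂ) {z : Fin 2 → ℂ} (hz : z ∈ bidisc) :
    zeroExt f z = f ⟨z, hz⟩ := zeroExt_apply f ⟨z, hz⟩

lemma torusSet_subset_bidisc {r : ℝ} (hr : r < 1) : torusSet r ⊆ bidisc := fun _ h i => by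
  rw [h i]; exact hr

lemma IsHolo.continuousOn_torus {f : bidisc → ℂ} (hf : IsHolo f) {r : ℝ} (hr : r < 1) :
    ContinuousOn (zeroExt f) (torusSet r) :=
  (DifferentiableOn.continuousOn hf).mono (torusSet_subset_bidisc hr)

lemma isHolo_of_differentiableOn {F : (Fin 2 → ℂ) → ℂ} (hF : DifferentiableOn ℂ F bidisc)
    {f : bidisc → ℂ} (h : ∀ z, f z = F z.1) : IsHolo f :=
  hF.congr fun z hz => by rw [zeroExt_of_mem f hz, h]

lemma isHolo_const (c : ℂ) : IsHolo fun _ => c :=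
  isHolo_of_differentiableOn (differentiableOn_const c) fun _ => rfl

lemma isHolo_coord (i : Fin 2) : IsHolo fun z => z.1 i :=
  isHolo_of_differentiableOn (F := fun z => z i) (by fun_prop) fun _ => rfl

lemma IsHolo.add {f g : bidisc → ℂ} (hf : IsHolo f) (hg : IsHolo g) : IsHolo fun z => f z + g z :=
  isHolo_of_differentiableOn (DifferentiableOn.add hf hg) fun z => by simp [zeroExt_apply]

lemma IsHolo.mul {f g : bidisc → ℂ} (hf : IsHolo f) (hg : IsHolo g) : IsHolo fun z => f z * g z :=
  isHolo_of_differentiableOn (DifferentiableOn.mul hf hg) fun z => by simp [zeroExt_apply]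

lemma IsHolo.sum {ι : Type*} {s : Finset ι} {f : ι → bidisc → ℂ} (hf : ∀ i ∈ s, IsHolo (f i)) :
    IsHolo fun z => ∑ i ∈ s, f i z :=
  isHolo_of_differentiableOn (DifferentiableOn.fun_sum hf) fun z => by simp [zeroExt_apply]

lemma IsHolo.inv {f : bidisc → ℂ} (hf : IsHolo f) (h0 : ∀ z, f z ≠ 0) :
    IsHolo fun z => (f z)⁻¹ :=
  isHolo_of_differentiableOn (DifferentiableOn.inv hf fun z hz => by
    rw [zeroExt_of_mem f hz]; exact h0 _) fun z => by simp [zeroExt_apply]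

lemma IsHolo.prod {ι : Type*} {s : Finset ι} {f : ι → bidisc → ℂ} (hf : ∀ i ∈ s, IsHolo (f i)) :
    IsHolo fun z => ∏ i ∈ s, f i z := by
  classical
  induction s using Finset.induction_on with
  | empty => simpa using isHolo_const 1
  | insert a s ha ih =>
    simp only [Finset.prod_insert ha]
    exact (hf a (by simp)).mul (ih fun i hi => hf i (by simp [hi]))

lemma IsHolo.det {n : Type*} [Fintype n] [DecidableEq n] {M : bidisc → Matrix n n ℂ}
    (hM : ∀ i j, IsHolo fun z => M z i j) : IsHolo fun z => (M z).det := by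
  simp only [Matrix.det_apply']
  exact IsHolo.sum fun σ _ => (isHolo_const _).mul (IsHolo.prod fun i _ => hM _ _)

lemma IsHolo.matrix_inv {n : Type*} [Fintype n] [DecidableEq n] {M : bidisc → Matrix n n ℂ}
    (hM : ∀ i j, IsHolo fun z => M z i j) (h0 : ∀ z, (M z).det ≠ 0) (i j : n) :
    IsHolo fun z => (M z)⁻¹ i j := by
  simp only [Matrix.inv_def, Matrix.smul_apply, Ring.inverse_eq_inv', smul_eq_mul,
    Matrix.adjugate_apply]
  refine ((IsHolo.det hM).inv h0).mul (IsHolo.det fun k l => ?_)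
  by_cases h : k = j
  · subst h; simpa using isHolo_const _
  · simpa [Matrix.updateRow_ne h] using hM k l

/-! ### Cauchy's formula, Taylor coefficients and polynomial approximation. -/

/-- The monomial `z₀ ^ p * z₁ ^ q`. -/
noncomputable def mono2 (m : ℕ × ℕ) (z : Fin 2 → ℂ) : ℂ := z 0 ^ m.1 * z 1 ^ m.2

/-- The Cauchy kernel `ξ₀ ^ (-p-1) * ξ₁ ^ (-q-1)` extracting a Taylor coefficient. -/
noncomputable def cauchyMono (m : ℕ × ℕ) (ξ : Fin 2 → ℂ) : ℂ :=
  (ξ 0)⁻¹ ^ (m.1 + 1) * (ξ 1)⁻¹ ^ (m.2 + 1)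

/-- The Taylor coefficient at `0`, as an integral over the torus of radius `r`. -/
noncomputable def torusCoeff (f : (Fin 2 → ℂ) → ℂ) (r : ℝ) (m : ℕ × ℕ) : ℂ :=
  ((2 * Real.pi * Complex.I : ℂ) ^ 2)⁻¹ *
    torusIntegral (fun ξ => f ξ * cauchyMono m ξ) (fun _ => 0) (fun _ => r)

lemma two_pi_I_sq_ne_zero : ((2 * Real.pi * Complex.I : ℂ) ^ 2) ≠ 0 :=
  pow_ne_zero _ Complex.two_pi_I_ne_zero

lemma continuous_mono2 (m : ℕ × ℕ) : Continuous (mono2 m) := by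
  unfold mono2; fun_prop

lemma norm_mono2_le {z : Fin 2 → ℂ} {r : ℝ} (hz : ∀ i, ‖z i‖ ≤ r) (m : ℕ × ℕ) :
    ‖mono2 m z‖ ≤ r ^ m.1 * r ^ m.2 := by
  simp only [mono2, norm_mul, norm_pow]
  have := hz 0; have := hz 1
  have : 0 ≤ r := (norm_nonneg _).trans (hz 0)
  gcongr

lemma torusSet_ne_zero {r : ℝ} (hr : 0 < r) {ξ : Fin 2 → ℂ} (hξ : ξ ∈ torusSet r) (i : Fin 2) :
    ξ i ≠ 0 := by
  intro h
  have := hξ i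
  rw [h, norm_zero] at this
  exact hr.ne this

lemma continuousOn_cauchyMono {r : ℝ} (hr : 0 < r) (m : ℕ × ℕ) :
    ContinuousOn (cauchyMono m) (torusSet r) := by
  unfold cauchyMono
  refine ContinuousOn.mul (ContinuousOn.pow (ContinuousOn.inv₀ (by fun_prop) ?_) _)
    (ContinuousOn.pow (ContinuousOn.inv₀ (by fun_prop) ?_) _)
  · exact fun ξ hξ => torusSet_ne_zero hr hξ 0
  · exact fun ξ hξ => torusSet_ne_zero hr hξ 1

lemma norm_cauchyMono {r : ℝ} {ξ : Fin 2 → ℂ} (hξ : ξ ∈ torusSet r) (m : ℕ × ℕ) :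
    ‖cauchyMono m ξ‖ = (r⁻¹) ^ (m.1 + 1) * (r⁻¹) ^ (m.2 + 1) := by
  simp [cauchyMono, hξ 0, hξ 1]

lemma summable_pow_mul_pow {a : ℝ} (h0 : 0 ≤ a) (h1 : a < 1) :
    Summable fun m : ℕ × ℕ => a ^ m.1 * a ^ m.2 :=
  (summable_geometric_of_lt_one h0 h1).mul_of_nonneg (summable_geometric_of_lt_one h0 h1)
    (fun _ => pow_nonneg h0 _) (fun _ => pow_nonneg h0 _)

lemma isCompact_torusSet (r : ℝ) : IsCompact (torusSet r) := by
  have : torusSet r = Set.univ.pi fun _ => Metric.sphere (0 : ℂ) r := by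
    ext; simp [torusSet]
  rw [this]
  exact isCompact_univ_pi fun _ => isCompact_sphere _ _

/-- Termwise integration against a kernel with an expansion in negative powers. -/
lemma hasSum_torusCoeff {r : ℝ} (hr : 0 < r) {f : (Fin 2 → ℂ) → ℂ}
    (hf : ContinuousOn f (torusSet r)) {κ : ℕ × ℕ → ℂ} {C a : ℝ} (ha : 0 ≤ a) (har : a < r)
    (hκ : ∀ m, ‖κ m‖ ≤ C * (a ^ m.1 * a ^ m.2)) {K : (Fin 2 → ℂ) → ℂ}
    (hK : ∀ ξ ∈ torusSet r, HasSum (fun m => κ m * cauchyMono m ξ) (K ξ)) :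
    HasSum (fun m => κ m * torusCoeff f r m)
      (((2 * Real.pi * Complex.I : ℂ) ^ 2)⁻¹ *
        torusIntegral (fun ξ => f ξ * K ξ) (fun _ => 0) (fun _ => r)) := by
  obtain ⟨B, hB⟩ := (isCompact_torusSet r).exists_bound_of_continuousOn hf
  have hC : 0 ≤ C := by have := (norm_nonneg _).trans (hκ (0, 0)); simpa using this
  have hs := summable_pow_mul_pow (div_nonneg ha hr.le) ((div_lt_one hr).2 har)
  -- On the torus the Cauchy kernels grow like powers of `1 / r`; against powers of `a` they leave a
  -- geometric majorant of ratio `a / r < 1`.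
  have hu : Summable fun m : ℕ × ℕ => C * r⁻¹ ^ 2 * ((a / r) ^ m.1 * (a / r) ^ m.2) :=
    hs.mul_left _
  have hterm : ∀ ξ ∈ torusSet r, ∀ m, ‖κ m * cauchyMono m ξ‖ ≤
      C * r⁻¹ ^ 2 * ((a / r) ^ m.1 * (a / r) ^ m.2) := by
    intro ξ hξ m
    rw [norm_mul, norm_cauchyMono hξ]
    calc _ ≤ C * (a ^ m.1 * a ^ m.2) * (r⁻¹ ^ (m.1 + 1) * r⁻¹ ^ (m.2 + 1)) := by
          gcongr; exact hκ m
      _ = _ := by simp only [div_eq_mul_inv, mul_pow, pow_succ]; ring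
  have key : Tendsto (fun s : Finset (ℕ × ℕ) => torusIntegral
      (fun ξ => f ξ * ∑ m ∈ s, κ m * cauchyMono m ξ) (fun _ => 0) (fun _ => r)) atTop
      (𝓝 (torusIntegral (fun ξ => f ξ * K ξ) (fun _ => 0) (fun _ => r))) := by
    refine tendsto_torusIntegral hr.le (B * ∑' m : ℕ × ℕ, C * r⁻¹ ^ 2 *
      ((a / r) ^ m.1 * (a / r) ^ m.2)) ?_ ?_ ?_
    · exact fun s => hf.mul (continuousOn_finsetSum _ fun m _ =>
        continuousOn_const.mul (continuousOn_cauchyMono hr m))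
    · intro s ξ hξ
      rw [norm_mul]
      refine mul_le_mul (hB ξ hξ) ?_ (norm_nonneg _) ((norm_nonneg _).trans (hB ξ hξ))
      refine (norm_sum_le _ _).trans ((Finset.sum_le_sum fun m _ => hterm ξ hξ m).trans ?_)
      exact hu.sum_le_tsum s fun m _ => by positivity
    · exact fun ξ hξ => (hK ξ hξ).const_mul (f ξ)
  have key2 := key.const_mul (((2 * Real.pi * Complex.I : ℂ) ^ 2)⁻¹)
  refine key2.congr fun s => ?_
  simp only [torusCoeff, Finset.mul_sum]
  rw [torusIntegral_finset_sum s hr.le, Finset.mul_sum]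
  · refine Finset.sum_congr rfl fun m _ => ?_
    rw [mul_left_comm (κ m), ← torusIntegral_const_mul (κ m)]
    congr 1
    exact torusIntegral_congr hr.le fun ξ _ => by ring
  · exact fun m _ => hf.mul (continuousOn_const.mul (continuousOn_cauchyMono hr m))

lemma hasSum_geometric_inv_sub {z ξ : ℂ} (h : ‖z‖ < ‖ξ‖) :
    HasSum (fun n : ℕ => z ^ n * ξ⁻¹ ^ (n + 1)) (ξ - z)⁻¹ := by
  have hξ : ξ ≠ 0 := by rintro rfl; simp at h; exact absurd h (not_lt.2 (norm_nonneg _))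
  have h1 : ‖z * ξ⁻¹‖ < 1 := by
    rw [norm_mul, norm_inv, ← div_eq_mul_inv, div_lt_one (norm_pos_iff.2 hξ)]; exact h
  have h2 := (hasSum_geometric_of_norm_lt_one h1).mul_right ξ⁻¹
  have h3 : (1 - z * ξ⁻¹)⁻¹ * ξ⁻¹ = (ξ - z)⁻¹ := by
    rw [← mul_inv]; congr 1; field_simp
  rw [h3] at h2
  exact h2.congr_fun fun n => by rw [mul_pow, pow_succ]; ring

lemma HasSum.mul_of_le {f g : ℕ → ℂ} {x y : ℂ} (hf : HasSum f x) (hg : HasSum g y) :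
    HasSum (fun m : ℕ × ℕ => f m.1 * g m.2) (x * y) :=
  hf.mul hg (summable_mul_of_summable_norm hf.summable.norm hg.summable.norm)

/-- Cauchy's integral formula on the torus. -/
lemma cauchy_torus {f : bidisc → ℂ} (hf : IsHolo f) {r : ℝ} (hr1 : r < 1)
    {z : Fin 2 → ℂ} (hz : ∀ i, ‖z i‖ < r) :
    ((2 * Real.pi * Complex.I : ℂ) ^ 2)⁻¹ *
      torusIntegral (fun ξ => zeroExt f ξ * ((ξ 0 - z 0)⁻¹ * (ξ 1 - z 1)⁻¹))
        (fun _ => 0) (fun _ => r) = zeroExt f z := by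
  have hr : 0 < r := (norm_nonneg _).trans_lt (hz 0)
  have hne : ∀ i, ∀ ξ ∈ torusSet r, ξ i - z i ≠ 0 := by
    intro i ξ hξ h
    have h1 := hξ i
    rw [sub_eq_zero.1 h] at h1
    exact (hz i).ne h1
  rw [torusIntegral_two hr.le]
  · have hd : ∀ x y : ℂ, ‖x‖ ≤ r → ‖y‖ ≤ r → DifferentiableAt ℂ (zeroExt f) ![x, y] := by
      intro x y hx hy
      refine DifferentiableOn.differentiableAt hf (isOpen_bidisc.mem_nhds ?_)
      intro i
      fin_cases i
      · exact hx.trans_lt hr1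
      · exact hy.trans_lt hr1
    have hin : ∀ x ∈ Metric.sphere (0 : ℂ) r,
        (∮ y in C(0, r), zeroExt f ![x, y] * ((![x, y] 0 - z 0)⁻¹ * (![x, y] 1 - z 1)⁻¹)) =
        (x - z 0)⁻¹ • ((2 * Real.pi * Complex.I : ℂ) * zeroExt f ![x, z 1]) := by
      intro x hx
      have h1 : DifferentiableOn ℂ (fun y => zeroExt f ![x, y]) (Metric.closedBall 0 r) := by
        intro y hy
        refine DifferentiableAt.differentiableWithinAt ?_
        refine DifferentiableAt.comp y (hd x y (by simpa using hx.le) (by simpa using hy)) ?_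
        rw [differentiableAt_pi]
        intro i; fin_cases i <;> simp
      have h2 := h1.circleIntegral_sub_inv_smul (w := z 1) (by simpa using hz 1)
      have h3 := circleIntegral.integral_smul ((x - z 0)⁻¹)
        (fun y => (y - z 1)⁻¹ • zeroExt f ![x, y]) 0 r
      rw [h2] at h3
      rw [← smul_eq_mul (2 * Real.pi * Complex.I : ℂ), ← h3]
      congr 1
      ext y
      simp; ring
    rw [circleIntegral.integral_congr hr.le hin]
    have h1 : DifferentiableOn ℂ (fun x => (2 * Real.pi * Complex.I : ℂ) * zeroExt f ![x, z 1])
        (Metric.closedBall 0 r) := by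
      intro x hx
      refine DifferentiableAt.differentiableWithinAt (DifferentiableAt.const_mul ?_ _)
      refine DifferentiableAt.comp x (hd x (z 1) (by simpa using hx) (hz 1).le) ?_
      rw [differentiableAt_pi]
      intro i; fin_cases i <;> simp
    rw [h1.circleIntegral_sub_inv_smul (w := z 0) (by simpa using hz 0)]
    have : ![z 0, z 1] = z := by ext i; fin_cases i <;> rfl
    rw [this, smul_eq_mul, ← mul_assoc (2 * Real.pi * Complex.I : ℂ), ← sq,
      inv_mul_cancel_left₀ two_pi_I_sq_ne_zero]
  · refine (hf.continuousOn_torus hr1).mul (ContinuousOn.mul ?_ ?_)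
    · exact ContinuousOn.inv₀ (by fun_prop) (hne 0)
    · exact ContinuousOn.inv₀ (by fun_prop) (hne 1)

/-- Both factors of the kernel in Cauchy's formula are geometric series in `z i / ξ i`, and
integration may be done term by term. -/
lemma IsHolo.hasSum_torusCoeff {f : bidisc → ℂ} (hf : IsHolo f) {r : ℝ} (hr1 : r < 1)
    {z : Fin 2 → ℂ} (hz : ∀ i, ‖z i‖ < r) :
    HasSum (fun m => torusCoeff (zeroExt f) r m * mono2 m z) (zeroExt f z) := by
  have hr : 0 < r := (norm_nonneg _).trans_lt (hz 0)
  rw [← cauchy_torus hf hr1 hz]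
  simp only [mul_comm _ (mono2 _ _)]
  refine _root_.hasSum_torusCoeff hr (hf.continuousOn_torus hr1) (C := 1)
    (a := max ‖z 0‖ ‖z 1‖) (by simp) (max_lt (hz 0) (hz 1)) ?_ ?_
  · intro m
    rw [one_mul]
    refine norm_mono2_le ?_ m
    intro i; fin_cases i
    · exact le_max_left _ _
    · exact le_max_right _ _
  · intro ξ hξ
    have h0 := hasSum_geometric_inv_sub (z := z 0) (ξ := ξ 0) (by rw [hξ 0]; exact hz 0)
    have h1 := hasSum_geometric_inv_sub (z := z 1) (ξ := ξ 1) (by rw [hξ 1]; exact hz 1)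
    refine (h0.mul_of_le h1).congr_fun ?_
    intro m
    simp only [mono2, cauchyMono]; ring

lemma norm_torusCoeff_le {f : (Fin 2 → ℂ) → ℂ} {r B : ℝ} (hr : 0 < r)
    (hB : ∀ ξ ∈ torusSet r, ‖f ξ‖ ≤ B) (m : ℕ × ℕ) :
    ‖torusCoeff f r m‖ ≤ B * (r⁻¹ ^ m.1 * r⁻¹ ^ m.2) := by
  have h := norm_torusIntegral_le_of_norm_le_const (f := fun ξ => f ξ * cauchyMono m ξ)
    (c := fun _ => 0) (R := fun _ : Fin 2 => r)
    (C := B * (r⁻¹ ^ (m.1 + 1) * r⁻¹ ^ (m.2 + 1))) (fun θ => by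
      have hm := torusMap_mem_torusSet hr.le θ
      rw [norm_mul, norm_cauchyMono hm]
      exact mul_le_mul_of_nonneg_right (hB _ hm) (by positivity))
  rw [torusCoeff, norm_mul, norm_inv]
  have h2 : ‖((2 * Real.pi * Complex.I : ℂ) ^ 2)‖ = (2 * Real.pi) ^ 2 := by
    simp [abs_of_pos Real.pi_pos]
  rw [h2, inv_mul_le_iff₀ (by positivity)]
  refine h.trans (le_of_eq ?_)
  simp only [Fin.prod_univ_two, abs_of_pos hr, pow_succ]
  field_simp

/-- Holomorphic functions are uniform limits of polynomials on smaller closed polydiscs. -/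
lemma IsHolo.exists_polynomial {f : bidisc → ℂ} (hf : IsHolo f) {r : ℝ} (hr1 : r < 1)
    {ε : ℝ} (hε : 0 < ε) : ∃ (s : Finset (ℕ × ℕ)) (a : ℕ × ℕ → ℂ),
      ∀ z : Fin 2 → ℂ, (∀ i, ‖z i‖ ≤ r) → ‖zeroExt f z - ∑ m ∈ s, a m * mono2 m z‖ < ε := by
  rcases lt_or_ge r 0 with hr | hr
  · exact ⟨∅, 0, fun z hz => absurd ((norm_nonneg _).trans (hz 0)) (not_le.2 hr)⟩
  -- Coefficients taken on a larger torus make the Taylor series converge geometrically, with ratio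
  -- `r / R`, on the polydisc of radius `r`.
  obtain ⟨R, hrR, hR1⟩ := exists_between hr1
  have hR : 0 < R := hr.trans_lt hrR
  obtain ⟨B, hB⟩ := (isCompact_torusSet R).exists_bound_of_continuousOn
    (hf.continuousOn_torus hR1)
  have hB0 : 0 ≤ B := (norm_nonneg _).trans (hB (fun _ => (R : ℂ)) fun _ => by simp [hR.le])
  have hu : Summable fun m : ℕ × ℕ => B * ((r / R) ^ m.1 * (r / R) ^ m.2) :=
    (summable_pow_mul_pow (by positivity) ((div_lt_one hR).2 hrR)).mul_left _
  have hun := tendstoUniformlyOn_tsum (s := {z : Fin 2 → ℂ | ∀ i, ‖z i‖ ≤ r})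
    (f := fun m z => torusCoeff (zeroExt f) R m * mono2 m z) hu (by
      intro m z hz
      rw [norm_mul]
      calc _ ≤ B * (R⁻¹ ^ m.1 * R⁻¹ ^ m.2) * (r ^ m.1 * r ^ m.2) :=
            mul_le_mul (norm_torusCoeff_le hR hB m) (norm_mono2_le hz m) (norm_nonneg _)
              (by positivity)
        _ = _ := by simp only [div_eq_mul_inv, mul_pow]; ring)
  rw [Metric.tendstoUniformlyOn_iff] at hun
  obtain ⟨s, hs⟩ := (hun ε hε).exists
  refine ⟨s, torusCoeff (zeroExt f) R, fun z hz => ?_⟩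
  have := hs z hz
  rwa [(hf.hasSum_torusCoeff hR1 fun i => (hz i).trans_lt hrR).tsum_eq, dist_eq_norm] at this

lemma circleIntegral_pow_mul_inv_pow {r : ℝ} (hr : 0 < r) (p j : ℕ) :
    (∮ x in C(0, r), x ^ p * x⁻¹ ^ (j + 1)) =
      if p = j then (2 * Real.pi * Complex.I : ℂ) else 0 := by
  have h : ∀ x ∈ Metric.sphere (0 : ℂ) r,
      x ^ p * x⁻¹ ^ (j + 1) = (x - 0) ^ ((p : ℤ) - j - 1) := by
    intro x hx
    have hx0 : x ≠ 0 := by rintro rfl; simp at hx; exact hr.ne hx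
    rw [sub_zero, sub_sub, zpow_sub₀ hx0, zpow_natCast, inv_pow, div_eq_mul_inv]
    norm_cast
  rw [circleIntegral.integral_congr hr.le h]
  split_ifs with hp
  · subst hp
    have := circleIntegral.integral_sub_inv_of_mem_ball (c := 0) (w := 0) (R := r) (by simpa)
    simpa using this
  · exact circleIntegral.integral_sub_zpow_of_ne (by omega) _ _ _

lemma torusCoeff_mono2 {r : ℝ} (hr : 0 < r) (n m : ℕ × ℕ) :
    torusCoeff (mono2 n) r m = if n = m then 1 else 0 := by
  have hc : ∀ p j : ℕ, ContinuousOn (fun x : ℂ => x ^ p * x⁻¹ ^ (j + 1)) (Metric.sphere 0 r) := by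
    intro p j
    refine ContinuousOn.mul (by fun_prop) (ContinuousOn.pow (continuousOn_inv₀.mono ?_) _)
    intro x hx h
    simp only [Set.mem_singleton_iff] at h
    subst h; simp at hx; exact hr.ne hx
  have h := torusIntegral_two_mul hr.le (hc n.1 m.1) (hc n.2 m.2)
  have h2 : (fun ξ => mono2 n ξ * cauchyMono m ξ) = fun ξ : Fin 2 → ℂ =>
      (ξ 0 ^ n.1 * (ξ 0)⁻¹ ^ (m.1 + 1)) * (ξ 1 ^ n.2 * (ξ 1)⁻¹ ^ (m.2 + 1)) := by
    ext ξ; simp only [mono2, cauchyMono]; ring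
  rw [torusCoeff, h2, h, circleIntegral_pow_mul_inv_pow hr, circleIntegral_pow_mul_inv_pow hr]
  simp only [Prod.ext_iff]
  by_cases h3 : n.1 = m.1 <;> by_cases h4 : n.2 = m.2 <;> simp only [h3, h4, if_true, if_false,
    and_self, and_true, and_false, mul_zero, zero_mul]
  rw [← sq, inv_mul_cancel₀ two_pi_I_sq_ne_zero]

/-! ### Powers and resolvents of matrices with spectrum in the disc. -/

section GelfandBound

attribute [local instance] Matrix.linftyOpNormedRing Matrix.linftyOpNormedAlgebra

lemma Matrix.norm_apply_le_linfty_opNorm {m : ℕ} (M : Matrix (Fin m) (Fin m) ℂ) (i j : Fin m) :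
    ‖M i j‖ ≤ ‖M‖ := by
  rw [Matrix.linfty_opNorm_def]
  have h1 : ‖M i j‖₊ ≤ ∑ k, ‖M i k‖₊ :=
    Finset.single_le_sum (f := fun k => ‖M i k‖₊) (fun _ _ => zero_le) (Finset.mem_univ j)
  have h2 : ∑ k, ‖M i k‖₊ ≤ Finset.univ.sup fun i => ∑ k, ‖M i k‖₊ :=
    Finset.le_sup (f := fun i => ∑ k, ‖M i k‖₊) (Finset.mem_univ i)
  exact_mod_cast h1.trans h2

/-- Gelfand's formula gives `‖M ^ n‖ ≤ a ^ n` for large `n` and any `a` above the spectral radius;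
the constant absorbs the finitely many small exponents. -/
lemma Matrix.exists_norm_pow_apply_le {m : ℕ} {M : Matrix (Fin m) (Fin m) ℂ}
    (h : ∀ ξ ∈ spectrum ℂ M, ‖ξ‖ < 1) :
    ∃ a C : ℝ, 0 < a ∧ a < 1 ∧ ∀ n i j, ‖(M ^ n) i j‖ ≤ C * a ^ n := by
  rcases Nat.eq_zero_or_pos m with rfl | hm
  · exact ⟨1 / 2, 0, by norm_num, by norm_num, fun n i => i.elim0⟩
  have : Nonempty (Fin m) := ⟨⟨0, hm⟩⟩
  have hlt : spectralRadius ℂ M < (1 : NNReal) :=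
    spectrum.spectralRadius_lt_of_forall_lt M fun k hk => by exact_mod_cast h k hk
  obtain ⟨a, ha1, ha2⟩ := ENNReal.lt_iff_exists_nnreal_btwn.1 hlt
  have ha0 : 0 < a := by
    rcases eq_or_ne a 0 with rfl | h0
    · simp at ha1
    · exact pos_iff_ne_zero.2 h0
  have hev := (spectrum.pow_nnnorm_pow_one_div_tendsto_nhds_spectralRadius M).eventually_lt_const
    ha1
  have hev2 : ∀ᶠ n : ℕ in atTop, ‖M ^ n‖ ≤ (a : ℝ) ^ n := by
    filter_upwards [hev, eventually_gt_atTop 0] with n hn hn0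
    have h1 : (‖M ^ n‖₊ : ENNReal) ≤ (a : ENNReal) ^ n := by
      have h2 := ENNReal.rpow_le_rpow hn.le (Nat.cast_nonneg n)
      rw [← ENNReal.rpow_mul, one_div, inv_mul_cancel₀ (by positivity), ENNReal.rpow_one,
        ENNReal.rpow_natCast] at h2
      exact h2
    exact_mod_cast h1
  obtain ⟨N, hN⟩ := eventually_atTop.1 hev2
  refine ⟨a, 1 + ∑ k ∈ Finset.range N, ‖M ^ k‖ / (a : ℝ) ^ k, by exact_mod_cast ha0,
    by exact_mod_cast ha2, fun n i j => ?_⟩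
  have ha0' : (0 : ℝ) < a := by exact_mod_cast ha0
  refine (Matrix.norm_apply_le_linfty_opNorm _ i j).trans ?_
  have hsum0 : 0 ≤ ∑ k ∈ Finset.range N, ‖M ^ k‖ / (a : ℝ) ^ k :=
    Finset.sum_nonneg fun k _ => by positivity
  rcases le_or_gt N n with hn | hn
  · refine (hN n hn).trans ?_
    nlinarith [pow_pos ha0' n]
  · have h3 : ‖M ^ n‖ / (a : ℝ) ^ n ≤ ∑ k ∈ Finset.range N, ‖M ^ k‖ / (a : ℝ) ^ k :=
      Finset.single_le_sum (f := fun k => ‖M ^ k‖ / (a : ℝ) ^ k) (fun k _ => by positivity)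
        (Finset.mem_range.2 hn)
    rw [div_le_iff₀ (pow_pos ha0' n)] at h3
    nlinarith [pow_pos ha0' n]

end GelfandBound

/-- A pair of commuting matrices with joint spectrum in the bidisc. -/
structure IsBidiscPair {m : ℕ} (M : Fin 2 → Matrix (Fin m) (Fin m) ℂ) : Prop where
  comm : M 0 * M 1 = M 1 * M 0
  spec : jointSpectrum M ⊆ bidisc

/-- The eigenspaces of `S` are invariant under the commuting map `T`, which therefore has an
eigenvector inside each of them. -/
lemma exists_joint_eigenvector {V : Type*} [AddCommGroup V] [Module ℂ V] [FiniteDimensional ℂ V]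
    {S T : Module.End ℂ V} (h : Commute S T) {ξ : ℂ} (hξ : S.HasEigenvalue ξ) :
    ∃ (η : ℂ) (v : V), v ≠ 0 ∧ S v = ξ • v ∧ T v = η • v := by
  have hm : ∀ v ∈ S.eigenspace ξ, T v ∈ S.eigenspace ξ := fun v hv => by
    rw [Module.End.mem_eigenspace_iff] at hv ⊢
    have h2 : S (T v) = T (S v) := congrArg (fun f => f v) h.eq
    rw [h2, hv, map_smul]
  have : Nontrivial (S.eigenspace ξ) := Submodule.nontrivial_iff_ne_bot.2 hξ
  obtain ⟨η, hη⟩ := Module.End.exists_eigenvalue (T.restrict hm)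
  obtain ⟨v, hv⟩ := hη.exists_hasEigenvector
  refine ⟨η, v.1, fun h0 => hv.2 (Subtype.ext h0), Module.End.mem_eigenspace_iff.1 v.2, ?_⟩
  exact congrArg Subtype.val hv.apply_eq_smul

namespace IsBidiscPair

variable {m : ℕ} {M : Fin 2 → Matrix (Fin m) (Fin m) ℂ}

/-- Each eigenvalue of one matrix is a coordinate of a joint eigenvalue, so the joint spectrum
controls both single spectra. -/
lemma norm_lt_one_of_mem_spectrum (hM : IsBidiscPair M) (i : Fin 2) {ξ : ℂ}
    (hξ : ξ ∈ spectrum ℂ (M i)) : ‖ξ‖ < 1 := by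
  rw [← Matrix.spectrum_toLin', ← Module.End.hasEigenvalue_iff_mem_spectrum] at hξ
  have hc : Commute (Matrix.toLin' (M 0)) (Matrix.toLin' (M 1)) := by
    rw [commute_iff_eq, Module.End.mul_eq_comp, Module.End.mul_eq_comp,
      ← Matrix.toLin'_mul, ← Matrix.toLin'_mul, hM.comm]
  fin_cases i
  · obtain ⟨η, v, hv, h1, h2⟩ := exists_joint_eigenvector hc hξ
    exact hM.spec (a := ![ξ, η]) ⟨v, hv, fun i => by fin_cases i; exacts [h1, h2]⟩ 0
  · obtain ⟨η, v, hv, h1, h2⟩ := exists_joint_eigenvector hc.symm hξ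
    exact hM.spec (a := ![η, ξ]) ⟨v, hv, fun i => by fin_cases i; exacts [h2, h1]⟩ 1

lemma exists_norm_pow_apply_le (hM : IsBidiscPair M) :
    ∃ a C : ℝ, 0 < a ∧ a < 1 ∧ 0 ≤ C ∧ ∀ k n i j, ‖(M k ^ n) i j‖ ≤ C * a ^ n := by
  choose a C h0 h1 h using fun k => Matrix.exists_norm_pow_apply_le fun ξ hξ =>
    hM.norm_lt_one_of_mem_spectrum k (ξ := ξ) hξ
  refine ⟨max (a 0) (a 1), max (max (C 0) (C 1)) 0, lt_max_of_lt_left (h0 0),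
    max_lt (h1 0) (h1 1), le_max_right _ _, fun k n i j => ?_⟩
  have hC : C k ≤ max (max (C 0) (C 1)) 0 := by fin_cases k <;> simp
  have ha : a k ≤ max (a 0) (a 1) := by fin_cases k <;> simp
  have := h0 k
  refine (h k n i j).trans ?_
  gcongr

end IsBidiscPair

namespace Matrix

variable {m : ℕ} {M : Matrix (Fin m) (Fin m) ℂ} {a C : ℝ}

lemma summable_inv_smul_pow (ha : 0 ≤ a) (h : ∀ n i j, ‖(M ^ n) i j‖ ≤ C * a ^ n) {ξ : ℂ}
    (hξ : a < ‖ξ‖) : Summable fun n : ℕ => (ξ⁻¹ • M) ^ n := by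
  have hξ0 : ξ ≠ 0 := by rintro rfl; simp at hξ; exact absurd hξ (not_lt.2 ha)
  refine Pi.summable.2 fun i => Pi.summable.2 fun j => ?_
  have hg : Summable fun n : ℕ => C * (a / ‖ξ‖) ^ n :=
    (summable_geometric_of_lt_one (by positivity)
      ((div_lt_one (norm_pos_iff.2 hξ0)).2 hξ)).mul_left C
  refine Summable.of_norm_bounded hg fun n => ?_
  rw [smul_pow, Matrix.smul_apply, norm_smul, norm_pow, norm_inv, div_pow, div_eq_mul_inv,
    inv_pow]
  calc _ ≤ (‖ξ‖ ^ n)⁻¹ * (C * a ^ n) := by gcongr; exact h n i j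
    _ = _ := by ring

lemma resolvent_mul_tsum (ha : 0 ≤ a) (h : ∀ n i j, ‖(M ^ n) i j‖ ≤ C * a ^ n) {ξ : ℂ}
    (hξ : a < ‖ξ‖) :
    (ξ • (1 : Matrix (Fin m) (Fin m) ℂ) - M) * (ξ⁻¹ • ∑' n : ℕ, (ξ⁻¹ • M) ^ n) = 1 := by
  have hξ0 : ξ ≠ 0 := by rintro rfl; simp at hξ; exact absurd hξ (not_lt.2 ha)
  rw [Matrix.mul_smul, ← Matrix.smul_mul, smul_sub, smul_smul, inv_mul_cancel₀ hξ0, one_smul,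
    (summable_inv_smul_pow ha h hξ).one_sub_mul_tsum_pow]

lemma hasSum_resolvent (ha : 0 ≤ a) (h : ∀ n i j, ‖(M ^ n) i j‖ ≤ C * a ^ n) {ξ : ℂ}
    (hξ : a < ‖ξ‖) (i j : Fin m) :
    HasSum (fun n : ℕ => (M ^ n) i j * ξ⁻¹ ^ (n + 1))
      ((ξ • (1 : Matrix (Fin m) (Fin m) ℂ) - M)⁻¹ i j) := by
  rw [Matrix.inv_eq_right_inv (resolvent_mul_tsum ha h hξ)]
  have h3 := (Pi.hasSum.1 (Pi.hasSum.1 (summable_inv_smul_pow ha h hξ).hasSum i) j).mul_left ξ⁻¹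
  refine h3.congr_fun fun n => ?_
  rw [smul_pow, Matrix.smul_apply, smul_eq_mul, pow_succ]; ring

lemma continuousOn_resolvent (ha : 0 ≤ a) (h : ∀ n i j, ‖(M ^ n) i j‖ ≤ C * a ^ n) (i j : Fin m) :
    ContinuousOn (fun ξ : ℂ => (ξ • (1 : Matrix (Fin m) (Fin m) ℂ) - M)⁻¹ i j) {ξ | a < ‖ξ‖} := by
  have hM : Continuous fun ξ : ℂ => ξ • (1 : Matrix (Fin m) (Fin m) ℂ) - M := by fun_prop
  simp only [Matrix.inv_def, Matrix.smul_apply, Ring.inverse_eq_inv', smul_eq_mul]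
  refine ContinuousOn.mul (ContinuousOn.inv₀ hM.matrix_det.continuousOn fun ξ hξ => ?_)
    (hM.matrix_adjugate.matrix_elem i j).continuousOn
  exact (Matrix.isUnit_det_of_right_inverse (resolvent_mul_tsum ha h hξ)).ne_zero

end Matrix

/-! ### The functional calculus `evalMat`. -/

/-- The entries of the matrix Cauchy kernel. -/
noncomputable def resolventKernel {m : ℕ} (M : Fin 2 → Matrix (Fin m) (Fin m) ℂ) (i j : Fin m)
    (ξ : Fin 2 → ℂ) : ℂ :=
  ((ξ 0 • (1 : Matrix (Fin m) (Fin m) ℂ) - M 0)⁻¹ *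
    (ξ 1 • (1 : Matrix (Fin m) (Fin m) ℂ) - M 1)⁻¹) i j

/-- The matrix Cauchy integral of a function defined near the torus of radius `r`. -/
noncomputable def evalTorus {m : ℕ} (M : Fin 2 → Matrix (Fin m) (Fin m) ℂ) (r : ℝ)
    (F : (Fin 2 → ℂ) → ℂ) : Matrix (Fin m) (Fin m) ℂ :=
  Matrix.of fun i j => ((2 * Real.pi * Complex.I : ℂ) ^ 2)⁻¹ *
    torusIntegral (fun ξ => F ξ * resolventKernel M i j ξ) (fun _ => 0) (fun _ => r)

lemma cauchyIntegralMat_eq {m : ℕ} (f : bidisc → ℂ) (M : Fin 2 → Matrix (Fin m) (Fin m) ℂ)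
    (r : ℝ) : cauchyIntegralMat f M r = evalTorus M r (zeroExt f) := rfl

section EvalTorus

variable {m : ℕ} {M : Fin 2 → Matrix (Fin m) (Fin m) ℂ} {a C r : ℝ}

lemma continuousOn_resolventKernel (ha : 0 ≤ a)
    (h : ∀ k n i j, ‖(M k ^ n) i j‖ ≤ C * a ^ n) (har : a < r) (i j : Fin m) :
    ContinuousOn (resolventKernel M i j) (torusSet r) := by
  unfold resolventKernel
  simp only [Matrix.mul_apply]
  refine continuousOn_finsetSum _ fun l _ => ContinuousOn.mul ?_ ?_
  · exact (Matrix.continuousOn_resolvent ha (h 0) i l).comp (f := fun ξ : Fin 2 → ℂ => ξ 0)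
      (by fun_prop) fun ξ hξ => by simpa [hξ 0] using har
  · exact (Matrix.continuousOn_resolvent ha (h 1) l j).comp (f := fun ξ : Fin 2 → ℂ => ξ 1)
      (by fun_prop) fun ξ hξ => by simpa [hξ 1] using har

lemma hasSum_resolventKernel (ha : 0 ≤ a)
    (h : ∀ k n i j, ‖(M k ^ n) i j‖ ≤ C * a ^ n) (har : a < r) (i j : Fin m)
    {ξ : Fin 2 → ℂ} (hξ : ξ ∈ torusSet r) :
    HasSum (fun p : ℕ × ℕ => (M 0 ^ p.1 * M 1 ^ p.2) i j * cauchyMono p ξ)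
      (resolventKernel M i j ξ) := by
  unfold resolventKernel
  simp only [Matrix.mul_apply, Finset.sum_mul]
  refine hasSum_sum fun l _ => ?_
  refine ((Matrix.hasSum_resolvent ha (h 0) (ξ := ξ 0) (by rwa [hξ 0]) i l).mul_of_le
    (Matrix.hasSum_resolvent ha (h 1) (ξ := ξ 1) (by rwa [hξ 1]) l j)).congr_fun fun p => ?_
  simp only [cauchyMono]; ring

lemma hasSum_evalTorus (ha : 0 ≤ a) (hC : 0 ≤ C)
    (h : ∀ k n i j, ‖(M k ^ n) i j‖ ≤ C * a ^ n) (har : a < r) {F : (Fin 2 → ℂ) → ℂ}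
    (hF : ContinuousOn F (torusSet r)) (i j : Fin m) :
    HasSum (fun p : ℕ × ℕ => (M 0 ^ p.1 * M 1 ^ p.2) i j * torusCoeff F r p)
      (evalTorus M r F i j) := by
  refine hasSum_torusCoeff (ha.trans_lt har) hF (C := m * C ^ 2) ha har ?_
    fun ξ hξ => hasSum_resolventKernel ha h har i j hξ
  intro p
  rw [Matrix.mul_apply]
  refine (norm_sum_le _ _).trans ?_
  refine (Finset.sum_le_card_nsmul _ _ (C * a ^ p.1 * (C * a ^ p.2)) fun l _ => ?_).trans
    (le_of_eq ?_)
  · rw [norm_mul]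
    exact mul_le_mul (h _ _ _ _) (h _ _ _ _) (norm_nonneg _) (by positivity)
  · simp; ring

lemma tendsto_evalTorus (ha : 0 ≤ a)
    (h : ∀ k n i j, ‖(M k ^ n) i j‖ ≤ C * a ^ n) (har : a < r)
    {ι : Type*} {l : Filter ι} [l.IsCountablyGenerated]
    {F : ι → (Fin 2 → ℂ) → ℂ} {G : (Fin 2 → ℂ) → ℂ} (B : ℝ)
    (hF : ∀ n, ContinuousOn (F n) (torusSet r))
    (hB : ∀ n, ∀ ξ ∈ torusSet r, ‖F n ξ‖ ≤ B)
    (hlim : ∀ ξ ∈ torusSet r, Tendsto (fun n => F n ξ) l (𝓝 (G ξ))) :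
    Tendsto (fun n => evalTorus M r (F n)) l (𝓝 (evalTorus M r G)) := by
  refine tendsto_pi_nhds.2 fun i => tendsto_pi_nhds.2 fun j => ?_
  have hK := continuousOn_resolventKernel ha h har i j
  obtain ⟨B', hB'⟩ := (isCompact_torusSet r).exists_bound_of_continuousOn hK
  refine Tendsto.const_mul _ (tendsto_torusIntegral (ha.trans har.le) (B * B') ?_ ?_ ?_)
  · exact fun n => (hF n).mul hK
  · intro n ξ hξ
    rw [norm_mul]
    exact mul_le_mul (hB n ξ hξ) (hB' ξ hξ) (norm_nonneg _) ((norm_nonneg _).trans (hB n ξ hξ))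
  · exact fun ξ hξ => (hlim ξ hξ).mul_const _

lemma evalTorus_sum (ha : 0 ≤ a)
    (h : ∀ k n i j, ‖(M k ^ n) i j‖ ≤ C * a ^ n) (har : a < r) {ι : Type*} (s : Finset ι)
    {F : ι → (Fin 2 → ℂ) → ℂ} (hF : ∀ n ∈ s, ContinuousOn (F n) (torusSet r)) (c : ι → ℂ) :
    evalTorus M r (fun ξ => ∑ n ∈ s, c n * F n ξ) = ∑ n ∈ s, c n • evalTorus M r (F n) := by
  ext i j
  simp only [evalTorus, Matrix.of_apply, Matrix.sum_apply, Matrix.smul_apply, smul_eq_mul]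
  have hK := continuousOn_resolventKernel ha h har i j
  simp only [Finset.sum_mul]
  rw [torusIntegral_finset_sum s (ha.trans har.le), Finset.mul_sum]
  · refine Finset.sum_congr rfl fun n _ => ?_
    rw [mul_left_comm (c n), ← torusIntegral_const_mul (c n)]
    congr 1
    exact torusIntegral_congr (ha.trans har.le) fun ξ _ => by ring
  · exact fun n hn => (continuousOn_const.mul (hF n hn)).mul hK

lemma evalTorus_mono2 (ha : 0 ≤ a) (hC : 0 ≤ C)
    (h : ∀ k n i j, ‖(M k ^ n) i j‖ ≤ C * a ^ n) (har : a < r) (p : ℕ × ℕ) :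
    evalTorus M r (mono2 p) = M 0 ^ p.1 * M 1 ^ p.2 := by
  ext i j
  refine (hasSum_evalTorus ha hC h har (continuous_mono2 p).continuousOn i j).unique ?_
  simp only [torusCoeff_mono2 (ha.trans_lt har)]
  convert hasSum_single p ?_ using 1
  · simp
  · intro q hq; simp [hq.symm]

lemma evalTorus_polynomial (ha : 0 ≤ a) (hC : 0 ≤ C)
    (h : ∀ k n i j, ‖(M k ^ n) i j‖ ≤ C * a ^ n) (har : a < r) (s : Finset (ℕ × ℕ))
    (c : ℕ × ℕ → ℂ) :
    evalTorus M r (fun ξ => ∑ p ∈ s, c p * mono2 p ξ) =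
      ∑ p ∈ s, c p • (M 0 ^ p.1 * M 1 ^ p.2) := by
  rw [evalTorus_sum ha h har s fun n _ => (continuous_mono2 n).continuousOn]
  simp only [evalTorus_mono2 ha hC h har]

end EvalTorus

/-- Polynomial approximation on a closed polydisc, as a sequence. -/
lemma IsHolo.exists_polynomial_seq {f : bidisc → ℂ} (hf : IsHolo f) {r : ℝ} (hr1 : r < 1) :
    ∃ (s : ℕ → Finset (ℕ × ℕ)) (c : ℕ → ℕ × ℕ → ℂ), ∀ n (z : Fin 2 → ℂ), (∀ i, ‖z i‖ ≤ r) →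
      ‖zeroExt f z - ∑ m ∈ s n, c n m * mono2 m z‖ ≤ 1 / ((n : ℝ) + 1) := by
  choose s c h using fun n : ℕ => hf.exists_polynomial hr1
    (ε := 1 / ((n : ℝ) + 1)) (by positivity)
  exact ⟨s, c, fun n z hz => (h n z hz).le⟩

lemma tendsto_of_norm_sub_le_one_div {u : ℕ → ℂ} {x : ℂ}
    (h : ∀ n : ℕ, ‖x - u n‖ ≤ 1 / ((n : ℝ) + 1)) : Tendsto u atTop (𝓝 x) := by
  rw [tendsto_iff_norm_sub_tendsto_zero]
  refine squeeze_zero (fun n => norm_nonneg _) (fun n => ?_) tendsto_one_div_add_atTop_nhds_zero_nat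
  rw [norm_sub_rev]; exact h n

lemma continuous_polynomial (s : Finset (ℕ × ℕ)) (c : ℕ × ℕ → ℂ) :
    Continuous fun z => ∑ m ∈ s, c m * mono2 m z :=
  continuous_finsetSum _ fun m _ => continuous_const.mul (continuous_mono2 m)

/-- Evaluation of the polynomial with coefficients `c` supported in `s` at a pair in an algebra. -/
noncomputable def polyEval {A : Type*} [Ring A] [Algebra ℂ A] (M : Fin 2 → A)
    (s : Finset (ℕ × ℕ)) (c : ℕ × ℕ → ℂ) : A :=
  ∑ p ∈ s, c p • (M 0 ^ p.1 * M 1 ^ p.2)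

lemma polyEval_complex (z : Fin 2 → ℂ) (s : Finset (ℕ × ℕ)) (c : ℕ × ℕ → ℂ) :
    polyEval z s c = ∑ p ∈ s, c p * mono2 p z := rfl

lemma continuous_polyEval (s : Finset (ℕ × ℕ)) (c : ℕ × ℕ → ℂ) :
    Continuous fun z : Fin 2 → ℂ => polyEval z s c := continuous_polynomial s c

/-- A polynomial as a function on the bidisc. -/
noncomputable def polyFun (s : Finset (ℕ × ℕ)) (c : ℕ × ℕ → ℂ) : bidisc → ℂ :=
  fun z => polyEval z.1 s c

lemma isHolo_mono2 (p : ℕ × ℕ) : IsHolo fun z => mono2 p z.1 :=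
  isHolo_of_differentiableOn (F := mono2 p) (by unfold mono2; fun_prop) fun _ => rfl

lemma isHolo_polyFun (s : Finset (ℕ × ℕ)) (c : ℕ × ℕ → ℂ) : IsHolo (polyFun s c) :=
  IsHolo.sum fun p _ => (isHolo_const (c p)).mul (isHolo_mono2 p)

section Approximation

variable {m : ℕ} {M : Fin 2 → Matrix (Fin m) (Fin m) ℂ} {a C r R : ℝ}

lemma norm_polyEval_le_of_approx {f : bidisc → ℂ} {s : ℕ → Finset (ℕ × ℕ)}
    {c : ℕ → ℕ × ℕ → ℂ} {z : Fin 2 → ℂ} {B : ℝ} (hB : ‖zeroExt f z‖ ≤ B)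
    (h : ∀ n : ℕ, ‖zeroExt f z - polyEval z (s n) (c n)‖ ≤ 1 / ((n : ℝ) + 1)) (n : ℕ) :
    ‖polyEval z (s n) (c n)‖ ≤ B + 1 := by
  have h1 : (1 : ℝ) / ((n : ℝ) + 1) ≤ 1 := by
    rw [div_le_one (by positivity)]; linarith [Nat.cast_nonneg (α := ℝ) n]
  have h2 := norm_sub_norm_le (polyEval z (s n) (c n)) (zeroExt f z)
  rw [norm_sub_rev] at h2
  linarith [h n]

lemma IsHolo.tendsto_evalTorus_polyEval {f : bidisc → ℂ} (hf : IsHolo f) (ha : 0 ≤ a)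
    (h : ∀ k n i j, ‖(M k ^ n) i j‖ ≤ C * a ^ n) (har : a < r) (hrR : r ≤ R)
    (hR1 : R < 1) {s : ℕ → Finset (ℕ × ℕ)} {c : ℕ → ℕ × ℕ → ℂ}
    (hs : ∀ n (z : Fin 2 → ℂ), (∀ i, ‖z i‖ ≤ R) →
      ‖zeroExt f z - polyEval z (s n) (c n)‖ ≤ 1 / ((n : ℝ) + 1)) :
    Tendsto (fun n => evalTorus M r fun ξ => polyEval ξ (s n) (c n)) atTop
      (𝓝 (evalTorus M r (zeroExt f))) := by
  obtain ⟨B, hB⟩ := (isCompact_torusSet r).exists_bound_of_continuousOn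
    (hf.continuousOn_torus (hrR.trans_lt hR1))
  have hle : ∀ ξ ∈ torusSet r, ∀ i, ‖ξ i‖ ≤ R := fun ξ hξ i => (hξ i).le.trans hrR
  exact tendsto_evalTorus ha h har (B + 1) (fun n => (continuous_polyEval _ _).continuousOn)
    (fun n ξ hξ => norm_polyEval_le_of_approx (hB ξ hξ) (fun n => hs n ξ (hle ξ hξ)) n)
    (fun ξ hξ => tendsto_of_norm_sub_le_one_div fun n => hs n ξ (hle ξ hξ))

/-- For a polynomial both integrals give its algebraic value at `M`. Polynomials approximating `f`
uniformly on the larger polydisc converge on both tori. -/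
lemma IsHolo.evalTorus_eq {f : bidisc → ℂ} (hf : IsHolo f) (ha : 0 ≤ a) (hC : 0 ≤ C)
    (h : ∀ k n i j, ‖(M k ^ n) i j‖ ≤ C * a ^ n) (har : a < r) (hrR : r ≤ R)
    (hR1 : R < 1) : evalTorus M r (zeroExt f) = evalTorus M R (zeroExt f) := by
  obtain ⟨s, c, hs⟩ := hf.exists_polynomial_seq hR1
  have h1 := hf.tendsto_evalTorus_polyEval (M := M) ha h har hrR hR1 hs
  have h2 := hf.tendsto_evalTorus_polyEval (M := M) ha h (har.trans_le hrR) le_rfl hR1 hs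
  refine tendsto_nhds_unique h1 (h2.congr fun n => ?_)
  simp only [polyEval_complex]
  rw [evalTorus_polynomial ha hC h har, evalTorus_polynomial ha hC h (har.trans_le hrR)]

end Approximation

namespace IsBidiscPair

variable {m : ℕ} {M : Fin 2 → Matrix (Fin m) (Fin m) ℂ}

/-- The value `f(M)` is the Cauchy integral over a fixed torus. -/
lemma exists_radius (hM : IsBidiscPair M) : ∃ a C r : ℝ, 0 ≤ a ∧ 0 ≤ C ∧ a < r ∧ r < 1 ∧
    (∀ k n i j, ‖(M k ^ n) i j‖ ≤ C * a ^ n) ∧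
    ∀ f, IsHolo f → evalMat f M = evalTorus M r (zeroExt f) := by
  obtain ⟨a, C, ha0, ha1, hC, h⟩ := hM.exists_norm_pow_apply_le
  obtain ⟨r, har, hr1⟩ := exists_between ha1
  refine ⟨a, C, r, ha0.le, hC, har, hr1, h, fun f hf => ?_⟩
  -- The limit in `evalMat` is that of an eventually constant function of the radius.
  refine Tendsto.limUnder_eq (tendsto_const_nhds.congr' ?_)
  filter_upwards [Ioo_mem_nhdsLT hr1] with R hR
  rw [cauchyIntegralMat_eq]
  exact hf.evalTorus_eq ha0.le hC h har hR.1.le hR.2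

lemma evalMat_polyFun (hM : IsBidiscPair M) (s : Finset (ℕ × ℕ)) (c : ℕ × ℕ → ℂ) :
    evalMat (polyFun s c) M = polyEval M s c := by
  obtain ⟨a, C, r, ha, hC, har, hr1, h, he⟩ := hM.exists_radius
  rw [he _ (isHolo_polyFun s c), polyEval, ← evalTorus_polynomial ha hC h har]
  ext i j
  simp only [evalTorus, Matrix.of_apply]
  congr 1
  refine torusIntegral_congr (ha.trans har.le) fun ξ hξ => ?_
  rw [zeroExt_of_mem _ (torusSet_subset_bidisc hr1 hξ)]
  rfl

/-- Continuity of `f ↦ f(M)` for bounded pointwise convergence. -/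
lemma tendsto_evalMat (hM : IsBidiscPair M) {ι : Type*} {l : Filter ι} [l.IsCountablyGenerated]
    {F : ι → bidisc → ℂ} {G : bidisc → ℂ} (B : ℝ) (hF : ∀ n, IsHolo (F n)) (hG : IsHolo G)
    (hB : ∀ n z, ‖F n z‖ ≤ B) (hlim : ∀ z, Tendsto (fun n => F n z) l (𝓝 (G z))) :
    Tendsto (fun n => evalMat (F n) M) l (𝓝 (evalMat G M)) := by
  obtain ⟨a, C, r, ha, hC, har, hr1, h, he⟩ := hM.exists_radius
  simp only [he _ (hF _), he _ hG]
  refine tendsto_evalTorus ha h har B (fun n => (hF n).continuousOn_torus hr1) ?_ ?_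
  · intro n ξ hξ
    rw [zeroExt_of_mem _ (torusSet_subset_bidisc hr1 hξ)]
    exact hB _ _
  · intro ξ hξ
    simp only [zeroExt_of_mem _ (torusSet_subset_bidisc hr1 hξ)]
    exact hlim _

/-- There are polynomials converging to `f` such that their values at `M` converge to `f(M)`. -/
lemma exists_polyFun_tendsto (hM : IsBidiscPair M) : ∃ r : ℝ, 0 ≤ r ∧ r < 1 ∧
    ∀ {f : bidisc → ℂ} {F : ℕ → bidisc → ℂ} (B : ℝ), IsHolo f → (∀ n, IsHolo (F n)) →
      (∀ n (z : bidisc), z.1 ∈ torusSet r → ‖F n z‖ ≤ B) →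
      (∀ z : bidisc, z.1 ∈ torusSet r → Tendsto (fun n => F n z) atTop (𝓝 (f z))) →
      Tendsto (fun n => evalMat (F n) M) atTop (𝓝 (evalMat f M)) := by
  obtain ⟨a, C, r, ha, hC, har, hr1, h, he⟩ := hM.exists_radius
  refine ⟨r, ha.trans har.le, hr1, fun {f F} B hf hF hB hlim => ?_⟩
  simp only [he _ (hF _), he _ hf]
  refine tendsto_evalTorus ha h har B (fun n => (hF n).continuousOn_torus hr1) ?_ ?_
  · intro n ξ hξ
    rw [zeroExt_of_mem _ (torusSet_subset_bidisc hr1 hξ)]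
    exact hB _ _ hξ
  · intro ξ hξ
    simp only [zeroExt_of_mem _ (torusSet_subset_bidisc hr1 hξ)]
    exact hlim _ hξ

end IsBidiscPair

lemma IsHolo.exists_polyFun_seq {f : bidisc → ℂ} (hf : IsHolo f) {r : ℝ} (hr1 : r < 1) :
    ∃ (B : ℝ) (s : ℕ → Finset (ℕ × ℕ)) (c : ℕ → ℕ × ℕ → ℂ),
      (∀ n (z : bidisc), z.1 ∈ torusSet r → ‖polyFun (s n) (c n) z‖ ≤ B) ∧
      ∀ z : bidisc, z.1 ∈ torusSet r →
        Tendsto (fun n => polyFun (s n) (c n) z) atTop (𝓝 (f z)) := by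
  obtain ⟨s, c, hs⟩ := hf.exists_polynomial_seq hr1
  obtain ⟨B, hB⟩ := (isCompact_torusSet r).exists_bound_of_continuousOn (hf.continuousOn_torus hr1)
  refine ⟨B + 1, s, c, fun n z hz => ?_, fun z hz => ?_⟩
  · exact norm_polyEval_le_of_approx (hB _ hz) (fun n => hs n _ fun i => (hz i).le) n
  · rw [← zeroExt_apply f]
    exact tendsto_of_norm_sub_le_one_div fun n => hs n _ fun i => (hz i).le

lemma polyEval_mul {A : Type*} [Ring A] [Algebra ℂ A] {M : Fin 2 → A} (hM : M 0 * M 1 = M 1 * M 0)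
    (s t : Finset (ℕ × ℕ)) (c d : ℕ × ℕ → ℂ) :
    polyEval M s c * polyEval M t d =
      ∑ p ∈ s ×ˢ t, (c p.1 * d p.2) • (M 0 ^ (p.1.1 + p.2.1) * M 1 ^ (p.1.2 + p.2.2)) := by
  rw [polyEval, polyEval, Finset.sum_mul_sum, Finset.sum_product]
  refine Finset.sum_congr rfl fun p _ => Finset.sum_congr rfl fun q _ => ?_
  have hc : Commute (M 1 ^ p.2) (M 0 ^ q.1) := (Commute.pow_pow (a := M 1) (b := M 0) hM.symm _ _)
  rw [smul_mul_smul_comm, pow_add, pow_add]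
  congr 1
  rw [mul_assoc, ← mul_assoc (M 1 ^ p.2), hc.eq]
  simp only [mul_assoc]

namespace IsBidiscPair

variable {m : ℕ} {M : Fin 2 → Matrix (Fin m) (Fin m) ℂ}

lemma evalMat_sum (hM : IsBidiscPair M) {ι : Type*} (s : Finset ι) {F : ι → bidisc → ℂ}
    (hF : ∀ n ∈ s, IsHolo (F n)) (c : ι → ℂ) :
    evalMat (fun z => ∑ n ∈ s, c n * F n z) M = ∑ n ∈ s, c n • evalMat (F n) M := by
  obtain ⟨a, C, r, ha, hC, har, hr1, h, he⟩ := hM.exists_radius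
  rw [he _ (IsHolo.sum fun n hn => (isHolo_const (c n)).mul (hF n hn)),
    Finset.sum_congr rfl fun n hn => by rw [he _ (hF n hn)],
    ← evalTorus_sum ha h har s fun n hn => (hF n hn).continuousOn_torus hr1]
  ext i j
  simp only [evalTorus, Matrix.of_apply]
  congr 1
  refine torusIntegral_congr (ha.trans har.le) fun ξ hξ => ?_
  simp only [zeroExt_of_mem _ (torusSet_subset_bidisc hr1 hξ)]

lemma evalMat_const_mul (hM : IsBidiscPair M) {f : bidisc → ℂ} (hf : IsHolo f) (c : ℂ) :
    evalMat (fun z => c * f z) M = c • evalMat f M := by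
  simpa using hM.evalMat_sum {()} (F := fun _ => f) (fun _ _ => hf) fun _ => c

lemma evalMat_add (hM : IsBidiscPair M) {f g : bidisc → ℂ} (hf : IsHolo f) (hg : IsHolo g) :
    evalMat (fun z => f z + g z) M = evalMat f M + evalMat g M := by
  have := hM.evalMat_sum Finset.univ (F := ![f, g])
    (fun i _ => by fin_cases i; exacts [hf, hg]) fun _ => 1
  simpa [Fin.sum_univ_two] using this

lemma evalMat_mono2 (hM : IsBidiscPair M) (p : ℕ × ℕ) :
    evalMat (fun z => mono2 p z.1) M = M 0 ^ p.1 * M 1 ^ p.2 := by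
  have h := hM.evalMat_polyFun {p} fun _ => 1
  have e : polyFun {p} (fun _ => 1) = fun z => mono2 p z.1 := by
    ext z; simp [polyFun, polyEval, mono2]
  rw [e] at h
  simpa [polyEval] using h

lemma evalMat_one (hM : IsBidiscPair M) : evalMat (fun _ => 1) M = 1 := by
  simpa [mono2] using hM.evalMat_mono2 0

lemma evalMat_const (hM : IsBidiscPair M) (c : ℂ) : evalMat (fun _ => c) M = c • 1 := by
  have := hM.evalMat_const_mul (isHolo_const 1) c
  simpa [hM.evalMat_one] using this

lemma evalMat_coord (hM : IsBidiscPair M) (i : Fin 2) : evalMat (fun z => z.1 i) M = M i := by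
  fin_cases i
  · simpa [mono2] using hM.evalMat_mono2 (1, 0)
  · simpa [mono2] using hM.evalMat_mono2 (0, 1)

/-- Multiplicativity is algebra for polynomials in commuting matrices; it passes to the limit
because only bounded convergence on one fixed torus is needed. -/
lemma evalMat_mul (hM : IsBidiscPair M) {f g : bidisc → ℂ} (hf : IsHolo f) (hg : IsHolo g) :
    evalMat (fun z => f z * g z) M = evalMat f M * evalMat g M := by
  obtain ⟨r, hr0, hr1, hr⟩ := hM.exists_polyFun_tendsto
  obtain ⟨B, s, c, hB, hlim⟩ := hf.exists_polyFun_seq hr1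
  obtain ⟨B', t, d, hB', hlim'⟩ := hg.exists_polyFun_seq hr1
  have h1 := hr B hf (fun n => isHolo_polyFun (s n) (c n)) hB hlim
  have h2 := hr B' hg (fun n => isHolo_polyFun (t n) (d n)) hB' hlim'
  have h3 := hr (F := fun n z => polyFun (s n) (c n) z * polyFun (t n) (d n) z) (B * B')
    (hf.mul hg) (fun n => (isHolo_polyFun _ _).mul (isHolo_polyFun _ _))
    (fun n z hz => by
      rw [norm_mul]
      exact mul_le_mul (hB n z hz) (hB' n z hz) (norm_nonneg _)
        ((norm_nonneg _).trans (hB n z hz)))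
    (fun z hz => (hlim z hz).mul (hlim' z hz))
  refine tendsto_nhds_unique h3 ((h1.mul h2).congr fun n => ?_)
  rw [hM.evalMat_polyFun, hM.evalMat_polyFun, polyEval_mul hM.comm]
  have : (fun z => polyFun (s n) (c n) z * polyFun (t n) (d n) z) =
      fun z => ∑ p ∈ s n ×ˢ t n, (c n p.1 * d n p.2) * mono2 (p.1 + p.2) z.1 := by
    ext z
    simp only [polyFun]
    rw [polyEval_mul (mul_comm _ _)]
    rfl
  rw [this, hM.evalMat_sum _ fun p _ => isHolo_mono2 _]
  simp only [hM.evalMat_mono2, Prod.fst_add, Prod.snd_add]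

/-- On functions bounded by `B` the value at `M` is bounded by a fixed multiple of `B`. -/
lemma exists_evalMat_bound (hM : IsBidiscPair M) : ∃ K r : ℝ, 0 ≤ K ∧ 0 < r ∧ r < 1 ∧
    ∀ (f : bidisc → ℂ) (B : ℝ), IsHolo f →
      (∀ z : bidisc, z.1 ∈ torusSet r → ‖f z‖ ≤ B) → ∀ i j, ‖evalMat f M i j‖ ≤ K * B := by
  obtain ⟨a, C, r, ha, hC, har, hr1, h, he⟩ := hM.exists_radius
  have hr0 := ha.trans_lt har
  choose D hD using fun i j => (isCompact_torusSet r).exists_bound_of_continuousOn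
    (continuousOn_resolventKernel ha h har i j)
  have hD0 : ∀ i j, 0 ≤ D i j := fun i j => (norm_nonneg _).trans
    (hD i j (fun _ => (r : ℂ)) fun _ => by simp [hr0.le])
  refine ⟨r ^ 2 * ∑ i, ∑ j, D i j, r, mul_nonneg (by positivity) (Finset.sum_nonneg fun i _ =>
    Finset.sum_nonneg fun j _ => hD0 i j), hr0, hr1, fun f B hf hB i j => ?_⟩
  have hB0 : 0 ≤ B := (norm_nonneg _).trans
    (hB ⟨fun _ => (r : ℂ), torusSet_subset_bidisc hr1 fun _ => by simp [hr0.le]⟩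
      fun _ => by simp [hr0.le])
  rw [he f hf]
  have h1 := norm_torusIntegral_le_of_norm_le_const
    (f := fun ξ => zeroExt f ξ * resolventKernel M i j ξ)
    (c := fun _ => 0) (R := fun _ : Fin 2 => r) (C := B * D i j) (fun θ => by
      have hm := torusMap_mem_torusSet hr0.le θ
      rw [norm_mul]
      refine mul_le_mul ?_ (hD i j _ hm) (norm_nonneg _) hB0
      rw [zeroExt_of_mem _ (torusSet_subset_bidisc hr1 hm)]
      exact hB _ hm)
  have h2 : ‖((2 * Real.pi * Complex.I : ℂ) ^ 2)‖ = (2 * Real.pi) ^ 2 := by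
    simp [abs_of_pos Real.pi_pos]
  have h3 : D i j ≤ ∑ i, ∑ j, D i j :=
    (Finset.single_le_sum (f := fun j => D i j) (fun j _ => hD0 i j) (Finset.mem_univ j)).trans
      (Finset.single_le_sum (f := fun i => ∑ j, D i j)
        (fun i _ => Finset.sum_nonneg fun j _ => hD0 i j) (Finset.mem_univ i))
  rw [evalTorus, Matrix.of_apply, norm_mul, norm_inv, h2, inv_mul_le_iff₀ (by positivity)]
  refine h1.trans ?_
  simp only [Fin.prod_univ_two, abs_of_pos hr0]
  calc (2 * Real.pi) ^ 2 * (r * r) * (B * D i j)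
      = (2 * Real.pi) ^ 2 * (r ^ 2 * D i j * B) := by ring
    _ ≤ _ := by gcongr

end IsBidiscPair

/-! ### Double power series and Montel's theorem. -/

lemma summable_mono2_bound {x : ℝ} (h0 : 0 ≤ x) (h1 : x < 1) :
    Summable fun m : ℕ × ℕ => (m.1 : ℝ) * x ^ m.1 * x ^ m.2 + x ^ m.1 * (m.2 * x ^ m.2) := by
  have hg := summable_geometric_of_lt_one h0 h1
  have hn : Summable fun n : ℕ => (n : ℝ) * x ^ n := by
    simpa using summable_pow_mul_geometric_of_norm_lt_one 1 (r := x)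
      (by rwa [Real.norm_of_nonneg h0])
  exact (hn.mul_of_nonneg hg (fun _ => by positivity) (fun _ => by positivity)).add
    (hg.mul_of_nonneg hn (fun _ => by positivity) (fun _ => by positivity))

lemma norm_coeff_mul_mono2_le {a : ℕ × ℕ → ℂ} {B R r : ℝ} (hR : 0 < R)
    (ha : ∀ m, ‖a m‖ ≤ B * (R⁻¹ ^ m.1 * R⁻¹ ^ m.2)) {z : Fin 2 → ℂ} (hz : ∀ i, ‖z i‖ ≤ r)
    (m : ℕ × ℕ) : ‖a m * mono2 m z‖ ≤ B * ((r / R) ^ m.1 * (r / R) ^ m.2) := by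
  have hB : 0 ≤ B := by have := (norm_nonneg _).trans (ha (0, 0)); simpa using this
  rw [norm_mul]
  calc _ ≤ B * (R⁻¹ ^ m.1 * R⁻¹ ^ m.2) * (r ^ m.1 * r ^ m.2) :=
        mul_le_mul (ha m) (norm_mono2_le hz m) (norm_nonneg _) (by positivity)
    _ = _ := by simp only [div_eq_mul_inv, mul_pow]; ring

lemma summable_coeff_mul_mono2 {a : ℕ × ℕ → ℂ} {B R : ℝ} (hR : 0 < R)
    (ha : ∀ m, ‖a m‖ ≤ B * (R⁻¹ ^ m.1 * R⁻¹ ^ m.2)) {z : Fin 2 → ℂ} (hz : ∀ i, ‖z i‖ < R) :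
    Summable fun m => a m * mono2 m z := by
  have hz' : ∀ i, ‖z i‖ ≤ max ‖z 0‖ ‖z 1‖ := fun i => by
    fin_cases i; exacts [le_max_left _ _, le_max_right _ _]
  have h0 : 0 ≤ max ‖z 0‖ ‖z 1‖ := (norm_nonneg _).trans (le_max_left _ _)
  exact Summable.of_norm_bounded ((summable_pow_mul_pow (by positivity)
    ((div_lt_one hR).2 (max_lt (hz 0) (hz 1)))).mul_left B)
    (norm_coeff_mul_mono2_le hR ha hz')

/-- A double power series is holomorphic in its polydisc of convergence. -/
lemma differentiableAt_tsum_mono2 {a : ℕ × ℕ → ℂ} {B R : ℝ}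
    (ha : ∀ m, ‖a m‖ ≤ B * (R⁻¹ ^ m.1 * R⁻¹ ^ m.2)) {z : Fin 2 → ℂ} (hz : ∀ i, ‖z i‖ < R) :
    DifferentiableAt ℂ (fun w : Fin 2 → ℂ => ∑' m, a m * mono2 m w) z := by
  have hR : 0 < R := (norm_nonneg _).trans_lt (hz 0)
  have hB : 0 ≤ B := by have := (norm_nonneg _).trans (ha (0, 0)); simpa using this
  obtain ⟨r, hr1, hrR⟩ := exists_between (max_lt (hz 0) (hz 1))
  have hr : 0 < r := (norm_nonneg _).trans_lt ((le_max_left _ _).trans_lt hr1)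
  have hzr : z ∈ Metric.ball (0 : Fin 2 → ℂ) r := by
    rw [mem_ball_zero_iff, pi_norm_lt_iff hr]
    intro i; fin_cases i
    exacts [(le_max_left _ _).trans_lt hr1, (le_max_right _ _).trans_lt hr1]
  have hx : r / R < 1 := (div_lt_one hR).2 hrR
  have hu := (summable_mono2_bound (by positivity) hx).mul_left (B * r⁻¹)
  let P : Fin 2 → (Fin 2 → ℂ) →L[ℂ] ℂ := fun i => ContinuousLinearMap.proj i
  have hP : ∀ i, ‖P i‖ ≤ 1 := fun i => ContinuousLinearMap.opNorm_le_bound _ zero_le_one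
    fun w => by rw [one_mul]; exact norm_le_pi_norm w i
  have hle : ∀ w ∈ Metric.ball (0 : Fin 2 → ℂ) r, ∀ i, ‖w i‖ ≤ r := fun w hw i =>
    (norm_le_pi_norm w i).trans (mem_ball_zero_iff.1 hw).le
  refine (hasFDerivAt_tsum_of_isPreconnected (𝕜 := ℂ) hu Metric.isOpen_ball
    (convex_ball (0 : Fin 2 → ℂ) r).isPreconnected
    (f := fun m w => a m * mono2 m w)
    (f' := fun m w => a m • (w 0 ^ m.1 • ((m.2 * w 1 ^ (m.2 - 1)) • P 1) +
      w 1 ^ m.2 • ((m.1 * w 0 ^ (m.1 - 1)) • P 0))) ?_ ?_ hzr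
      (summable_coeff_mul_mono2 hR ha hz) hzr).differentiableAt
  · intro m w _
    have h0 : HasFDerivAt (fun w : Fin 2 → ℂ => w 0 ^ m.1) ((m.1 * w 0 ^ (m.1 - 1)) • P 0) w := by
      exact (hasDerivAt_pow m.1 (w 0)).comp_hasFDerivAt w (P 0).hasFDerivAt
    have h1 : HasFDerivAt (fun w : Fin 2 → ℂ => w 1 ^ m.2) ((m.2 * w 1 ^ (m.2 - 1)) • P 1) w := by
      exact (hasDerivAt_pow m.2 (w 1)).comp_hasFDerivAt w (P 1).hasFDerivAt
    exact (h0.mul h1).const_mul (a m)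
  · intro m w hw
    have key : ∀ (n : ℕ) (i : Fin 2), ‖(n * w i ^ (n - 1)) • P i‖ ≤ r⁻¹ * (n * r ^ n) := by
      intro n i
      rw [norm_smul]
      rcases Nat.eq_zero_or_pos n with rfl | hn
      · simp
      · have h1 : r ^ n = r ^ (n - 1) * r := by rw [← pow_succ, Nat.sub_add_cancel hn]
        calc _ ≤ (n * r ^ (n - 1)) * 1 := by
              refine mul_le_mul ?_ (hP i) (norm_nonneg _) (by positivity)
              rw [norm_mul, norm_pow]
              have := hle w hw i
              simp only [Complex.norm_natCast]
              gcongr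
          _ = _ := by rw [h1]; field_simp
    have h0 : ‖w 0 ^ m.1‖ ≤ r ^ m.1 := by rw [norm_pow]; have := hle w hw 0; gcongr
    have h1 : ‖w 1 ^ m.2‖ ≤ r ^ m.2 := by rw [norm_pow]; have := hle w hw 1; gcongr
    rw [norm_smul]
    calc _ ≤ B * (R⁻¹ ^ m.1 * R⁻¹ ^ m.2) *
          (r ^ m.1 * (r⁻¹ * (m.2 * r ^ m.2)) + r ^ m.2 * (r⁻¹ * (m.1 * r ^ m.1))) := by
          refine mul_le_mul (ha m) ((norm_add_le _ _).trans (add_le_add ?_ ?_)) (norm_nonneg _)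
            (by positivity)
          · rw [norm_smul]; exact mul_le_mul h0 (key _ _) (norm_nonneg _) (by positivity)
          · rw [norm_smul]; exact mul_le_mul h1 (key _ _) (norm_nonneg _) (by positivity)
      _ = _ := by simp only [div_eq_mul_inv, mul_pow]; ring

/-- The function on the bidisc defined by a double power series. -/
noncomputable def seriesFun (a : ℕ × ℕ → ℂ) : bidisc → ℂ := fun z => ∑' m, a m * mono2 m z.1

lemma isHolo_seriesFun {a : ℕ × ℕ → ℂ} {B : ℝ} (ha : ∀ m, ‖a m‖ ≤ B) : IsHolo (seriesFun a) :=
  isHolo_of_differentiableOn (F := fun w => ∑' m, a m * mono2 m w)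
    (fun _ hz => (differentiableAt_tsum_mono2 (R := 1) (B := B) (by simpa using ha)
      hz).differentiableWithinAt) fun _ => rfl

/-- Montel's theorem for countable families of functions on the bidisc. -/
theorem montel {ι : Type*} [Countable ι] (F : ℕ → ι → bidisc → ℂ) (hF : ∀ n i, IsHolo (F n i))
    (B : ℝ) (hB : ∀ n i z, ‖F n i z‖ ≤ B) :
    ∃ σ : ℕ → ℕ, StrictMono σ ∧ ∃ G : ι → bidisc → ℂ, (∀ i, IsHolo (G i)) ∧
      ∀ i z, Tendsto (fun n => F (σ n) i z) atTop (𝓝 (G i z)) := by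
  -- Radii exhausting the bidisc; the shift by two keeps `R 0` positive.
  let R : ℕ → ℝ := fun l => 1 - 1 / ((l : ℝ) + 2)
  have hR1 : ∀ l, R l < 1 := fun l => by
    have : (0 : ℝ) < 1 / ((l : ℝ) + 2) := by positivity
    simp only [R]; linarith
  have hR0 : ∀ l, 0 < R l := fun l => by
    have : (1 : ℝ) / ((l : ℝ) + 2) < 1 := by
      rw [div_lt_one (by positivity)]; linarith [Nat.cast_nonneg (α := ℝ) l]
    simp only [R]; linarith
  have hRex : ∀ x : ℝ, x < 1 → ∃ l, x < R l := fun x hx => by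
    obtain ⟨l, hl⟩ := exists_nat_one_div_lt (sub_pos.2 hx)
    refine ⟨l, ?_⟩
    have : (1 : ℝ) / ((l : ℝ) + 2) ≤ 1 / ((l : ℝ) + 1) := by
      apply one_div_le_one_div_of_le <;> [positivity; linarith]
    simp only [R]; linarith
  let c : ℕ → ι × ℕ × (ℕ × ℕ) → ℂ := fun n k => torusCoeff (zeroExt (F n k.1)) (R k.2.1) k.2.2
  let D : ι × ℕ × (ℕ × ℕ) → ℝ := fun k => B * ((R k.2.1)⁻¹ ^ k.2.2.1 * (R k.2.1)⁻¹ ^ k.2.2.2)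
  have hc : ∀ n k, ‖c n k‖ ≤ D k := fun n k => norm_torusCoeff_le (hR0 _) (fun ξ hξ => by
    rw [zeroExt_of_mem _ (torusSet_subset_bidisc (hR1 _) hξ)]; exact hB _ _ _) _
  -- By Cauchy's estimates all coefficients, for all members of the family and all radii, form a
  -- point of a countable product of discs. Its compactness replaces a diagonal argument.
  obtain ⟨α, hα, σ, hσ, hlim⟩ := (isCompact_univ_pi fun k =>
    isCompact_closedBall (0 : ℂ) (D k)).tendsto_subseq (x := c) fun n k _ => by
      simpa using hc n k
  have hlim' : ∀ k, Tendsto (fun n => c (σ n) k) atTop (𝓝 (α k)) := tendsto_pi_nhds.1 hlim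
  have hαD : ∀ k, ‖α k‖ ≤ D k := fun k => by simpa using hα k (Set.mem_univ _)
  let S : ι → ℕ → (Fin 2 → ℂ) → ℂ := fun i l z => ∑' m, α (i, l, m) * mono2 m z
  have hS : ∀ i l (z : bidisc), (∀ j, ‖z.1 j‖ < R l) →
      Tendsto (fun n => F (σ n) i z) atTop (𝓝 (S i l z.1)) := by
    intro i l z hz
    have hz' : ∀ i, ‖z.1 i‖ ≤ max ‖z.1 0‖ ‖z.1 1‖ := fun i => by
      fin_cases i; exacts [le_max_left _ _, le_max_right _ _]
    have h0 : 0 ≤ max ‖z.1 0‖ ‖z.1 1‖ := (norm_nonneg _).trans (le_max_left _ _)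
    have hsum := (summable_pow_mul_pow (div_nonneg h0 (hR0 l).le)
      ((div_lt_one (hR0 l)).2 (max_lt (hz 0) (hz 1)))).mul_left B
    have := tendsto_tsum_of_dominated_convergence (𝓕 := atTop)
      (f := fun n m => c (σ n) (i, l, m) * mono2 m z.1)
      (g := fun m => α (i, l, m) * mono2 m z.1) hsum
      (fun m => (hlim' (i, l, m)).mul_const _)
      (Eventually.of_forall fun n m => norm_coeff_mul_mono2_le (hR0 l)
        (fun m => hc (σ n) (i, l, m)) hz' m)
    refine this.congr fun n => ?_
    rw [← zeroExt_apply (F (σ n) i)]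
    exact ((hF (σ n) i).hasSum_torusCoeff (hR1 l) hz).tsum_eq
  have hcov : ∀ z : bidisc, ∃ l, ∀ j, ‖z.1 j‖ < R l := fun z => by
    obtain ⟨l, hl⟩ := hRex _ (max_lt (z.2 0) (z.2 1))
    refine ⟨l, fun j => ?_⟩
    fin_cases j
    exacts [(le_max_left _ _).trans_lt hl, (le_max_right _ _).trans_lt hl]
  choose L hL using hcov
  refine ⟨σ, hσ, fun i z => S i (L z) z.1, fun i => ?_, fun i z => hS i _ z (hL z)⟩
  intro z hz
  -- The radius used to define the limit varies with the point. Near `z` the series for the radius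
  -- chosen at `z` may be used throughout, since both series are limits of the same sequence.
  have hd : DifferentiableAt ℂ (S i (L ⟨z, hz⟩)) z :=
    differentiableAt_tsum_mono2 (fun m => hαD (i, _, m)) (hL ⟨z, hz⟩)
  refine (hd.congr_of_eventuallyEq ?_).differentiableWithinAt
  have hopen : ∀ᶠ w in 𝓝 z, ∀ j, ‖w j‖ < R (L ⟨z, hz⟩) := by
    rw [eventually_all]
    exact fun j => (continuous_apply j).norm.continuousAt.eventually_lt_const (hL ⟨z, hz⟩ j)
  filter_upwards [hopen, isOpen_bidisc.mem_nhds hz] with w hw hwb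
  rw [zeroExt_of_mem _ hwb]
  exact tendsto_nhds_unique (hS i _ ⟨w, hwb⟩ (hL ⟨w, hwb⟩)) (hS i _ ⟨w, hwb⟩ hw)

/-- Bounded pointwise limits of holomorphic functions are holomorphic. -/
lemma isHolo_of_tendsto {F : ℕ → bidisc → ℂ} (hF : ∀ n, IsHolo (F n)) (B : ℝ)
    (hB : ∀ n z, ‖F n z‖ ≤ B) {G : bidisc → ℂ}
    (h : ∀ z, Tendsto (fun n => F n z) atTop (𝓝 (G z))) : IsHolo G := by
  obtain ⟨σ, hσ, G', hG', hlim⟩ := montel (fun n (_ : Unit) => F n) (fun n _ => hF n) B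
    fun n _ => hB n
  have : G = G' () := funext fun z =>
    tendsto_nhds_unique ((h z).comp hσ.tendsto_atTop) (hlim () z)
  rw [this]; exact hG' ()

/-- Coefficients of a double power series are determined by its sum. -/
lemma torusCoeff_seriesFun {a : ℕ × ℕ → ℂ} {B : ℝ} (ha : ∀ m, ‖a m‖ ≤ B) {r : ℝ} (hr0 : 0 < r)
    (hr1 : r < 1) (m : ℕ × ℕ) : torusCoeff (zeroExt (seriesFun a)) r m = a m := by
  have hs : Summable fun m : ℕ × ℕ => B * (r ^ m.1 * r ^ m.2) :=
    (summable_pow_mul_pow hr0.le hr1).mul_left B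
  have hterm : ∀ ξ ∈ torusSet r, ∀ p, ‖a p * mono2 p ξ‖ ≤ B * (r ^ p.1 * r ^ p.2) := by
    intro ξ hξ p
    simpa using norm_coeff_mul_mono2_le (R := 1) one_pos (by simpa using ha)
      (fun i => (hξ i).le) p
  have key : Tendsto (fun s : Finset (ℕ × ℕ) => torusIntegral
      (fun ξ => (∑ p ∈ s, a p * mono2 p ξ) * cauchyMono m ξ) (fun _ => 0) (fun _ => r)) atTop
      (𝓝 (torusIntegral (fun ξ => zeroExt (seriesFun a) ξ * cauchyMono m ξ)
        (fun _ => 0) (fun _ => r))) := by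
    refine tendsto_torusIntegral hr0.le
      ((∑' p : ℕ × ℕ, B * (r ^ p.1 * r ^ p.2)) * (r⁻¹ ^ (m.1 + 1) * r⁻¹ ^ (m.2 + 1))) ?_ ?_ ?_
    · exact fun s => (continuous_polynomial s a).continuousOn.mul (continuousOn_cauchyMono hr0 m)
    · intro s ξ hξ
      rw [norm_mul, norm_cauchyMono hξ]
      refine mul_le_mul_of_nonneg_right ?_ (by positivity)
      refine (norm_sum_le _ _).trans ((Finset.sum_le_sum fun p _ => hterm ξ hξ p).trans ?_)
      exact hs.sum_le_tsum s fun p _ => (norm_nonneg _).trans (hterm ξ hξ p)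
    · intro ξ hξ
      rw [zeroExt_of_mem _ (torusSet_subset_bidisc hr1 hξ)]
      exact (Summable.of_norm_bounded hs (hterm ξ hξ)).hasSum.mul_const _
  have h2 := key.const_mul (((2 * Real.pi * Complex.I : ℂ) ^ 2)⁻¹)
  refine tendsto_nhds_unique h2 (tendsto_const_nhds.congr' ?_)
  filter_upwards [eventually_ge_atTop {m}] with s hs'
  have hm : m ∈ s := by simpa using hs'
  simp only [Finset.sum_mul]
  rw [torusIntegral_finset_sum s hr0.le, Finset.mul_sum]
  · rw [Finset.sum_eq_single m]
    · have h4 := torusCoeff_mono2 hr0 m m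
      rw [if_pos rfl, torusCoeff] at h4
      simp only [mul_assoc]
      rw [torusIntegral_const_mul]
      simp only [mul_assoc] at h4
      rw [mul_left_comm, h4, mul_one]
    · intro p _ hpm
      have h4 := torusCoeff_mono2 hr0 p m
      rw [if_neg hpm, torusCoeff] at h4
      simp only [mul_assoc]
      rw [torusIntegral_const_mul]
      simp only [mul_assoc] at h4
      rw [mul_left_comm, h4, mul_zero]
    · exact fun h => absurd hm h
  · exact fun p _ => (continuousOn_const.mul (continuous_mono2 p).continuousOn).mul
      (continuousOn_cauchyMono hr0 m)

/-! ### Partial isometries and defect operators. -/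

/-- Operators of equal size are related by a partial isometry. -/
lemma exists_partialIsometry {H K L : Type*} [NormedAddCommGroup H] [InnerProductSpace ℂ H]
    [NormedAddCommGroup K] [InnerProductSpace ℂ K] [CompleteSpace K]
    [NormedAddCommGroup L] [InnerProductSpace ℂ L] [CompleteSpace L]
    (α : H →ₗ[ℂ] K) (β : H →ₗ[ℂ] L) (h : ∀ x, ‖α x‖ = ‖β x‖) :
    ∃ u : K →L[ℂ] L, (∀ x, u (α x) = β x) ∧ (∀ x, ‖u x‖ ≤ ‖x‖) ∧
      (∀ x, ContinuousLinearMap.adjoint u (u (α x)) = α x) ∧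
      ∀ y, u (ContinuousLinearMap.adjoint u (u y)) = u y := by
  let E : Submodule ℂ K := (LinearMap.range α).topologicalClosure
  have hker : LinearMap.ker α ≤ LinearMap.ker β := fun x hx => by
    rw [LinearMap.mem_ker] at hx ⊢
    rw [← norm_eq_zero, ← h, hx, norm_zero]
  have hE : CompleteSpace E := (Submodule.isClosed_topologicalClosure _).completeSpace_coe
  obtain ⟨v, hv⟩ : ∃ v : LinearMap.range α →ₗ[ℂ] L, ∀ x, v ⟨α x, x, rfl⟩ = β x := by
    refine ⟨(Submodule.liftQ _ β hker).comp (α.quotKerEquivRange.symm : _ →ₗ[ℂ] _), fun x => ?_⟩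
    have : α.quotKerEquivRange.symm ⟨α x, x, rfl⟩ = Submodule.Quotient.mk x := by
      rw [LinearEquiv.symm_apply_eq]; rfl
    simp [this]
  have hvn : ∀ y, ‖v y‖ = ‖y‖ := by
    rintro ⟨_, x, rfl⟩
    rw [hv, ← h]; rfl
  let vi : LinearMap.range α →ₗᵢ[ℂ] L := ⟨v, hvn⟩
  let inc : LinearMap.range α →ₗᵢ[ℂ] E :=
    ⟨Submodule.inclusion (Submodule.le_topologicalClosure _), fun _ => rfl⟩
  have hdense : DenseRange inc := by
    intro y
    have hy : (y : K) ∈ closure (LinearMap.range α : Set K) := y.2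
    rw [Metric.mem_closure_iff] at hy
    rw [Metric.mem_closure_range_iff]
    intro ε hε
    obtain ⟨b, hb, hd⟩ := hy ε hε
    exact ⟨⟨b, hb⟩, hd⟩
  -- The isometry `α x ↦ β x` is extended to the closure `E` of the range of `α`; composing it with
  -- the projection onto `E` makes it vanish on the complement.
  let w : E →L[ℂ] L := vi.toContinuousLinearMap.extend inc.toContinuousLinearMap
  have hw : ∀ y, w (inc y) = v y := fun y =>
    ContinuousLinearMap.extend_eq _ hdense inc.isometry.isUniformInducing y
  have hwn : ∀ y, ‖w y‖ = ‖y‖ := fun y => by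
    refine hdense.induction_on y (isClosed_eq (by fun_prop) (by fun_prop)) fun z => ?_
    rw [hw, hvn]; exact (inc.norm_map z).symm
  let P : K →L[ℂ] E := E.orthogonalProjectionOnto
  have hPα : ∀ x, P (α x) = inc ⟨α x, x, rfl⟩ := fun x =>
    E.orthogonalProjectionOnto_mem_subspace_eq_self (inc ⟨α x, x, rfl⟩)
  let wi : E →ₗᵢ[ℂ] L := ⟨w.toLinearMap, hwn⟩
  have hadj : ∀ y : E, ContinuousLinearMap.adjoint (w.comp P) (w y) = (y : K) := fun y => by
    refine ext_inner_right ℂ fun z => ?_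
    rw [ContinuousLinearMap.adjoint_inner_left, ContinuousLinearMap.comp_apply]
    have h1 : inner ℂ (w y) (w (P z)) = inner ℂ y (P z) := wi.inner_map_map y (P z)
    rw [h1]
    exact (E.inner_orthogonalProjectionOnto_eq_of_mem_left y z)
  refine ⟨w.comp P, fun x => ?_, fun x => ?_, fun x => ?_, fun y => ?_⟩
  · rw [ContinuousLinearMap.comp_apply, hPα, hw, hv]
  · rw [ContinuousLinearMap.comp_apply, hwn]
    exact E.norm_orthogonalProjectionOnto_apply_le x
  · rw [ContinuousLinearMap.comp_apply, hadj, hPα]; rfl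
  · rw [ContinuousLinearMap.comp_apply (f := P) (g := w) (x := y), hadj,
      ContinuousLinearMap.comp_apply]
    congr 1
    exact E.orthogonalProjectionOnto_mem_subspace_eq_self (P y)

/-- The defect operator of a contraction. -/
lemma exists_defect {H : Type*} [NormedAddCommGroup H] [InnerProductSpace ℂ H] [CompleteSpace H]
    (T : H →L[ℂ] H) (hT : ∀ x, ‖T x‖ ≤ ‖x‖) :
    ∃ D : H →L[ℂ] H, ∀ x, ‖D x‖ ^ 2 + ‖T x‖ ^ 2 = ‖x‖ ^ 2 := by
  let A : H →L[ℂ] H := 1 - (ContinuousLinearMap.adjoint T) * T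
  have hre : ∀ x, A.reApplyInnerSelf x = ‖x‖ ^ 2 - ‖T x‖ ^ 2 := fun x => by
    simp only [A, ContinuousLinearMap.reApplyInnerSelf_apply, sub_apply,
      one_apply_eq_self, mul_apply_eq_comp, inner_sub_left,
      ContinuousLinearMap.adjoint_inner_left, map_sub, inner_self_eq_norm_sq]
  have hA : 0 ≤ A := by
    rw [ContinuousLinearMap.nonneg_iff_isPositive, ContinuousLinearMap.isPositive_def']
    refine ⟨?_, fun x => ?_⟩
    · exact (IsSelfAdjoint.one _).sub (IsSelfAdjoint.star_mul_self T)
    · rw [hre]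
      have := hT x
      have := norm_nonneg (T x)
      nlinarith
  refine ⟨CFC.sqrt A, fun x => ?_⟩
  have hs : IsSelfAdjoint (CFC.sqrt A) := (CFC.sqrt_nonneg A).isSelfAdjoint
  have h1 : ‖CFC.sqrt A x‖ ^ 2 = A.reApplyInnerSelf x := by
    rw [ContinuousLinearMap.reApplyInnerSelf_apply, ← inner_self_eq_norm_sq (𝕜 := ℂ)]
    have h2 : A x = CFC.sqrt A (CFC.sqrt A x) := by
      conv_lhs => rw [← CFC.sqrt_mul_sqrt_self A hA]
      rfl
    rw [h2]
    conv_rhs => rw [← ContinuousLinearMap.adjoint_inner_right]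
    rw [← ContinuousLinearMap.star_eq_adjoint, hs.star_eq]
  rw [h1, hre]; ring

/-! ### Von Neumann's inequality for commuting isometries, by finite Fourier analysis. -/

/-- Parseval's identity on a finite abelian group, for vector-valued functions. -/
lemma sum_norm_sq_fourier {G E : Type*} [AddCommGroup G] [Fintype G] [DecidableEq G]
    [NormedAddCommGroup E] [InnerProductSpace ℂ E] (F : G → E) :
    ∑ χ : AddChar G ℂ, ‖∑ n, χ n • F n‖ ^ 2 = Fintype.card G * ∑ n, ‖F n‖ ^ 2 := by
  have h : ∀ χ : AddChar G ℂ, ((‖∑ n, χ n • F n‖ ^ 2 : ℝ) : ℂ) =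
      ∑ n, ∑ m, χ (m - n) * inner ℂ (F n) (F m) := fun χ => by
    have := inner_self_eq_norm_sq_to_K (𝕜 := ℂ) (∑ n, χ n • F n)
    push_cast
    refine this.symm.trans ?_
    simp only [sum_inner, inner_sum, inner_smul_left, inner_smul_right, Finset.mul_sum]
    rw [Finset.sum_comm]
    refine Finset.sum_congr rfl fun n _ => Finset.sum_congr rfl fun m _ => ?_
    rw [← mul_assoc]
    congr 1
    rw [sub_eq_add_neg, AddChar.map_add_eq_mul, AddChar.map_neg_eq_conj]
  have h2 : ((∑ χ : AddChar G ℂ, ‖∑ n, χ n • F n‖ ^ 2 : ℝ) : ℂ) =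
      ((Fintype.card G * ∑ n, ‖F n‖ ^ 2 : ℝ) : ℂ) := by
    rw [Complex.ofReal_sum]
    simp only [h]
    rw [Finset.sum_comm]
    push_cast
    rw [Finset.mul_sum]
    refine Finset.sum_congr rfl fun n _ => ?_
    rw [Finset.sum_comm]
    simp only [← Finset.sum_mul, AddChar.sum_apply_eq_ite, sub_eq_zero]
    rw [Finset.sum_eq_single n]
    · simp only [if_true]
      congr 1
      exact inner_self_eq_norm_sq_to_K (𝕜 := ℂ) (F n)
    · intro m _ hm; simp [hm]
    · simp
  exact_mod_cast h2

/-- Bound for a convolution operator on a finite abelian group. -/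
lemma sum_norm_sq_convolution_le {G E ι : Type*} [AddCommGroup G] [Fintype G] [DecidableEq G]
    [NormedAddCommGroup E] [InnerProductSpace ℂ E] (F : G → E) (s : Finset ι) (c : ι → ℂ)
    (g : ι → G) {B : ℝ} (hB : ∀ χ : AddChar G ℂ, ‖∑ p ∈ s, c p * χ (-(g p))‖ ≤ B) :
    ∑ n, ‖∑ p ∈ s, c p • F (n + g p)‖ ^ 2 ≤ B ^ 2 * ∑ n, ‖F n‖ ^ 2 := by
  have h1 := sum_norm_sq_fourier fun n => ∑ p ∈ s, c p • F (n + g p)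
  have h2 := sum_norm_sq_fourier F
  -- The Fourier transform turns the convolution into multiplication by its symbol, which `hB`
  -- bounds.
  have h3 : ∀ χ : AddChar G ℂ, ∑ n, χ n • ∑ p ∈ s, c p • F (n + g p) =
      (∑ p ∈ s, c p * χ (-(g p))) • ∑ n, χ n • F n := fun χ => by
    rw [Finset.sum_smul]
    simp only [Finset.smul_sum]
    rw [Finset.sum_comm]
    refine Finset.sum_congr rfl fun p _ => ?_
    have hshift := Equiv.sum_comp (Equiv.addRight (g p))
      (fun n : G => (c p * χ (-(g p))) • χ n • F n)
    rw [← hshift]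
    refine Finset.sum_congr rfl fun n _ => ?_
    simp only [Equiv.coe_addRight, smul_smul]
    congr 1
    rw [AddChar.map_add_eq_mul]
    have : χ (g p) * χ (-(g p)) = 1 := by
      rw [← AddChar.map_add_eq_mul, add_neg_cancel, AddChar.map_zero_eq_one]
    linear_combination (-(c p * χ n)) * this
  have hcard : (0 : ℝ) < Fintype.card G := by exact_mod_cast Fintype.card_pos
  have h4 : Fintype.card G * ∑ n, ‖∑ p ∈ s, c p • F (n + g p)‖ ^ 2 ≤
      Fintype.card G * (B ^ 2 * ∑ n, ‖F n‖ ^ 2) := by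
    rw [← h1, mul_left_comm, ← h2, Finset.mul_sum]
    refine Finset.sum_le_sum fun χ _ => ?_
    rw [h3, norm_smul, mul_pow]
    gcongr
    exact hB χ
  exact le_of_mul_le_mul_left h4 hcard

/-- Von Neumann's inequality for commuting isometries, in a form that only uses finite families of
shifts of the two vectors in question. -/
lemma norm_polyEval_le_of_isometric {K : Type*} [AddCommGroup K] [Module ℂ K]
    {V : Fin 2 → Module.End ℂ K} (hV : V 0 * V 1 = V 1 * V 0) (s : Finset (ℕ × ℕ)) (c : ℕ × ℕ → ℂ)
    {B : ℝ} (hB : ∀ z : Fin 2 → ℂ, (∀ i, ‖z i‖ = 1) → ‖polyEval z s c‖ ≤ B)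
    {E : ℕ → Type*} [∀ R, NormedAddCommGroup (E R)] [∀ R, InnerProductSpace ℂ (E R)]
    (J : ∀ R, K →ₗ[ℂ] E R) (x : K) {a b : ℝ} (ha : 0 ≤ a)
    (hx : ∀ R i j, i < R → j < R → ‖J R ((V 0 ^ i * V 1 ^ j) x)‖ = a)
    (hy : ∀ R i j, i < R → j < R → ‖J R ((V 0 ^ i * V 1 ^ j) (polyEval V s c x))‖ = b) :
    b ≤ B * a := by
  obtain ⟨d, hd⟩ : ∃ d : ℕ, ∀ p ∈ s, p.1 ≤ d ∧ p.2 ≤ d := by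
    refine ⟨s.sup fun p => p.1 + p.2, fun p hp => ?_⟩
    have := Finset.le_sup (f := fun p : ℕ × ℕ => p.1 + p.2) hp
    omega
  have hB0 : 0 ≤ B := (norm_nonneg _).trans (hB (fun _ => 1) fun _ => by simp)
  -- The orbit of `x` is wrapped around a discrete torus of side `t + d`, where `d` bounds the
  -- exponents. Only positions in a `t × t` square are sure not to wrap; the loss `t / (t + d)`
  -- disappears for large `t`.
  have key : ∀ t : ℕ, 0 < t → (t : ℝ) * b ≤ B * ((t + d : ℕ) * a) := by
    intro t ht
    have hne : NeZero (t + d) := ⟨by omega⟩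
    let e : ℕ × ℕ → ZMod (t + d) × ZMod (t + d) := fun p => (p.1, p.2)
    let F : ZMod (t + d) × ZMod (t + d) → E (t + d) := fun n => J (t + d) ((V 0 ^ n.1.val * V 1 ^ n.2.val) x)
    have hchar : ∀ χ : AddChar (ZMod (t + d) × ZMod (t + d)) ℂ, ‖∑ p ∈ s, c p * χ (-(e p))‖ ≤ B := by
      intro χ
      -- A character is determined by its values at the two generators, so the symbol is the
      -- polynomial at a point of the unit torus.
      have h := hB ![χ (-(e (1, 0))), χ (-(e (0, 1)))] fun i => by
        fin_cases i <;> exact AddChar.norm_apply χ _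
      convert h using 2
      refine Finset.sum_congr rfl fun p _ => ?_
      rw [smul_eq_mul]
      congr 1
      simp only [Matrix.cons_val_zero, Matrix.cons_val_one, ← AddChar.map_nsmul_eq_pow,
        ← AddChar.map_add_eq_mul]
      congr 1
      refine Prod.ext ?_ ?_ <;> simp [e]
    have h1 := sum_norm_sq_convolution_le F s c e hchar
    have h2 : ∑ n, ‖F n‖ ^ 2 = ((t + d : ℕ) : ℝ) ^ 2 * a ^ 2 := by
      have : ∀ n, ‖F n‖ = a := fun n => hx _ _ _ (ZMod.val_lt _) (ZMod.val_lt _)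
      simp only [this, Finset.sum_const, nsmul_eq_mul, Finset.card_univ]
      congr 1
      simp only [Fintype.card_prod, ZMod.card]
      push_cast; ring
    let I : Finset (ℕ × ℕ) := Finset.range t ×ˢ Finset.range t
    have hval : ∀ k < t + d, ((k : ℕ) : ZMod (t + d)).val = k := fun k hk =>
      ZMod.val_natCast_of_lt hk
    have hF : ∀ q ∈ I, ‖∑ p ∈ s, c p • F (e q + e p)‖ = b := by
      intro q hq
      have hq1 : q.1 < t := Finset.mem_range.1 (Finset.mem_product.1 hq).1
      have hq2 : q.2 < t := Finset.mem_range.1 (Finset.mem_product.1 hq).2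
      rw [← hy (t + d) q.1 q.2 (by omega) (by omega), polyEval]
      simp only [LinearMap.sum_apply, LinearMap.smul_apply, map_sum, map_smul]
      congr 1
      refine Finset.sum_congr rfl fun p hp => ?_
      have hp' := hd p hp
      congr 1
      have h1 : (e q + e p).1.val = q.1 + p.1 := by
        have : (e q + e p).1 = ((q.1 + p.1 : ℕ) : ZMod (t + d)) := by simp [e]
        rw [this]
        exact hval _ (by omega)
      have h2 : (e q + e p).2.val = q.2 + p.2 := by
        have : (e q + e p).2 = ((q.2 + p.2 : ℕ) : ZMod (t + d)) := by simp [e]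
        rw [this]
        exact hval _ (by omega)
      simp only [F, h1, h2, ← Module.End.mul_apply]
      congr 2
      have hc : Commute (V 1 ^ q.2) (V 0 ^ p.1) :=
        Commute.pow_pow (a := V 1) (b := V 0) hV.symm _ _
      rw [pow_add, pow_add, mul_assoc, ← mul_assoc (V 0 ^ p.1), ← hc.eq]
      simp only [mul_assoc]
    have hinj : Set.InjOn e I := by
      intro p hp q hq hpq
      have hp1 := Finset.mem_product.1 (Finset.mem_coe.1 hp)
      have hq1 := Finset.mem_product.1 (Finset.mem_coe.1 hq)
      simp only [Finset.mem_range] at hp1 hq1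
      have e1 : (e p).1.val = (e q).1.val := by rw [hpq]
      have e2 : (e p).2.val = (e q).2.val := by rw [hpq]
      simp only [e] at e1 e2
      rw [hval _ (by omega), hval _ (by omega)] at e1 e2
      exact Prod.ext e1 e2
    have h3 : (t : ℝ) ^ 2 * b ^ 2 ≤ ∑ n, ‖∑ p ∈ s, c p • F (n + e p)‖ ^ 2 := by
      calc (t : ℝ) ^ 2 * b ^ 2 = ∑ q ∈ I, ‖∑ p ∈ s, c p • F (e q + e p)‖ ^ 2 := by
            rw [Finset.sum_congr rfl fun q hq => by rw [hF q hq]]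
            simp [I, sq]
        _ = ∑ n ∈ I.image e, ‖∑ p ∈ s, c p • F (n + e p)‖ ^ 2 := by
            rw [Finset.sum_image hinj]
        _ ≤ _ := Finset.sum_le_sum_of_subset_of_nonneg (Finset.subset_univ _)
              fun _ _ _ => by positivity
    rw [h2] at h1
    refine le_of_sq_le_sq ?_ (by positivity)
    calc ((t : ℝ) * b) ^ 2 = (t : ℝ) ^ 2 * b ^ 2 := by ring
      _ ≤ B ^ 2 * (((t + d : ℕ) : ℝ) ^ 2 * a ^ 2) := h3.trans h1
      _ = _ := by ring
  have hlim : Tendsto (fun n : ℕ => B * a + B * d * a * (1 / ((n : ℝ) + 1))) atTop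
      (𝓝 (B * a + B * d * a * 0)) :=
    tendsto_const_nhds.add (tendsto_one_div_add_atTop_nhds_zero_nat.const_mul _)
  rw [mul_zero, add_zero] at hlim
  refine ge_of_tendsto' hlim fun n => ?_
  have := key (n + 1) (Nat.succ_pos n)
  push_cast at this
  have hn : (0 : ℝ) < (n : ℝ) + 1 := by positivity
  rw [mul_one_div, ← sub_le_iff_le_add', le_div_iff₀ hn]
  nlinarith

/-! ### Andô's dilation of two commuting contractions to commuting isometries. -/

namespace Ando

variable {H : Type*} [NormedAddCommGroup H] [InnerProductSpace ℂ H]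

/-- The direct sum of two copies of a Hilbert space. -/
abbrev Sq (H : Type*) : Type _ := WithLp 2 (H × H)

/-- The (algebraic) space of Andô's commuting isometries. -/
abbrev Space (H : Type*) : Type _ := H × (ℕ → Sq H) × (ℕ → Sq H)

/-- Insert `d` in front of a sequence of pairs read as a sequence of single entries. -/
noncomputable def halfShift : H × (ℕ → Sq H) →ₗ[ℂ] (ℕ → Sq H) where
  toFun x n := Nat.casesOn n (WithLp.toLp 2 (x.1, (x.2 0).fst))
    fun k => WithLp.toLp 2 ((x.2 k).snd, (x.2 (k + 1)).fst)
  map_add' x y := by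
    ext n
    cases n <;> rfl
  map_smul' c x := by
    ext n
    cases n <;> rfl

lemma halfShift_zero (x : H × (ℕ → Sq H)) :
    halfShift x 0 = WithLp.toLp 2 (x.1, (x.2 0).fst) := rfl

lemma halfShift_succ (x : H × (ℕ → Sq H)) (n : ℕ) :
    halfShift x (n + 1) = WithLp.toLp 2 ((x.2 n).snd, (x.2 (n + 1)).fst) := rfl

lemma norm_sq_toLp {H : Type*} [NormedAddCommGroup H] (x y : H) : ‖(WithLp.toLp 2 (x, y) : Sq H)‖ ^ 2 = ‖x‖ ^ 2 + ‖y‖ ^ 2 :=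
  WithLp.prod_norm_sq_eq_of_L2 _

lemma norm_sq_sq {H : Type*} [NormedAddCommGroup H] (a : Sq H) : ‖a‖ ^ 2 = ‖a.fst‖ ^ 2 + ‖a.snd‖ ^ 2 :=
  WithLp.prod_norm_sq_eq_of_L2 a

/-- The first `M + 1` blocks after the shift hold the inserted entry, `M` complete pairs and the
first half of the next pair. -/
lemma sum_norm_sq_halfShift (x : H × (ℕ → Sq H)) (M : ℕ) :
    ∑ n ∈ Finset.range (M + 1), ‖halfShift x n‖ ^ 2 =
      ‖x.1‖ ^ 2 + ∑ n ∈ Finset.range M, ‖x.2 n‖ ^ 2 + ‖(x.2 M).fst‖ ^ 2 := by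
  induction M with
  | zero => simp [halfShift_zero, norm_sq_sq]
  | succ M ih =>
    rw [Finset.sum_range_succ, ih, halfShift_succ, Finset.sum_range_succ _ M, norm_sq_toLp,
      norm_sq_sq (x.2 M)]
    ring

/-- The basic isometry dilating a contraction `T` with defect operator `D`. -/
noncomputable def shiftDilation (T D : H →L[ℂ] H) : Module.End ℂ (Space H) :=
  (T.toLinearMap ∘ₗ LinearMap.fst ℂ _ _).prod
    ((halfShift ∘ₗ ((D.toLinearMap ∘ₗ LinearMap.fst ℂ _ _).prod
        (LinearMap.fst ℂ _ _ ∘ₗ LinearMap.snd ℂ _ _))).prod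
      (halfShift ∘ₗ (0 : Space H →ₗ[ℂ] H).prod (LinearMap.snd ℂ _ _ ∘ₗ LinearMap.snd ℂ _ _)))

lemma shiftDilation_apply (T D : H →L[ℂ] H) (x : Space H) :
    shiftDilation T D x = (T x.1, halfShift (D x.1, x.2.1), halfShift (0, x.2.2)) := rfl

/-- The sequences vanish from index `L` on. -/
def SuppLE {H : Type*} [NormedAddCommGroup H] (L : ℕ) (x : Space H) : Prop := ∀ n, L ≤ n → x.2.1 n = 0 ∧ x.2.2 n = 0

/-- The squared norm of the first `M` entries. -/
noncomputable def normSq {H : Type*} [NormedAddCommGroup H] (M : ℕ) (x : Space H) : ℝ :=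
  ‖x.1‖ ^ 2 + ∑ n ∈ Finset.range M, (‖x.2.1 n‖ ^ 2 + ‖x.2.2 n‖ ^ 2)

lemma SuppLE.mono {H : Type*} [NormedAddCommGroup H] {L M : ℕ} (h : L ≤ M) {x : Space H} (hx : SuppLE L x) : SuppLE M x :=
  fun n hn => hx n (h.trans hn)

lemma SuppLE.normSq_eq {H : Type*} [NormedAddCommGroup H] {L M : ℕ} (h : L ≤ M)
    {x : Space H} (hx : SuppLE L x) :
    normSq M x = normSq L x := by
  unfold normSq
  congr 1
  refine (Finset.sum_subset (Finset.range_mono h) fun n _ hn => ?_).symm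
  have := hx n (by simpa using hn)
  simp [this.1, this.2]

lemma halfShift_eq_zero {x : H × (ℕ → Sq H)} {L n : ℕ} (hx : ∀ n, L ≤ n → x.2 n = 0)
    (hn : L + 1 ≤ n) : halfShift x n = 0 := by
  obtain ⟨k, rfl⟩ : ∃ k, n = k + 1 := ⟨n - 1, by omega⟩
  rw [halfShift_succ, hx k (by omega), hx (k + 1) (by omega)]
  rfl

/-- What `T` loses is stored by `D` in the freed place of the first sequence. With `L < M` the entry
pushed beyond the truncation is zero. -/
lemma shiftDilation_isometric {T D : H →L[ℂ] H} (hD : ∀ x, ‖D x‖ ^ 2 + ‖T x‖ ^ 2 = ‖x‖ ^ 2)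
    {L M : ℕ} (hLM : L < M) {x : Space H} (hx : SuppLE L x) :
    normSq M (shiftDilation T D x) = normSq M x ∧ SuppLE (L + 1) (shiftDilation T D x) := by
  refine ⟨?_, fun n hn => ⟨?_, ?_⟩⟩
  · obtain ⟨k, rfl⟩ : ∃ k, M = k + 1 := ⟨M - 1, by omega⟩
    have hk := hx k (by omega)
    simp only [normSq, shiftDilation_apply, Finset.sum_add_distrib, sum_norm_sq_halfShift]
    rw [Finset.sum_range_succ, Finset.sum_range_succ, hk.1, hk.2, ← hD x.1]
    simp; ring
  · exact halfShift_eq_zero (fun n hn => (hx n hn).1) hn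
  · exact halfShift_eq_zero (fun n hn => (hx n hn).2) hn

/-- Two successive basic dilations. -/
lemma shiftDilation_shiftDilation (T D T' D' : H →L[ℂ] H) (x : Space H) :
    shiftDilation T D (shiftDilation T' D' x) = (T (T' x.1),
      fun n => Nat.casesOn n (WithLp.toLp 2 (D (T' x.1), D' x.1)) x.2.1,
      fun n => Nat.casesOn n 0 x.2.2) := by
  simp only [shiftDilation_apply]
  refine Prod.ext rfl (Prod.ext (funext fun n => ?_) (funext fun n => ?_))
  · rcases n with _ | n
    · rfl
    · rcases n with _ | n <;> rfl
  · rcases n with _ | n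
    · rfl
    · rcases n with _ | n <;> rfl

/-- The embedding of the first `M` entries into a Hilbert space. -/
noncomputable def trunc (M : ℕ) : Space H →ₗ[ℂ] WithLp 2 (H × WithLp 2
    (PiLp 2 (fun _ : Fin M => Sq H) × PiLp 2 (fun _ : Fin M => Sq H))) where
  toFun x := WithLp.toLp 2 (x.1, WithLp.toLp 2 (WithLp.toLp 2 fun k => x.2.1 k,
    WithLp.toLp 2 fun k => x.2.2 k))
  map_add' _ _ := rfl
  map_smul' _ _ := rfl

lemma norm_sq_trunc (M : ℕ) (x : Space H) : ‖trunc M x‖ ^ 2 = normSq M x := by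
  have h1 := WithLp.prod_norm_sq_eq_of_L2 (trunc M x)
  have h2 := WithLp.prod_norm_sq_eq_of_L2 (trunc M x).snd
  have h3 := PiLp.norm_sq_eq_of_L2 _ (trunc M x).snd.fst
  have h4 := PiLp.norm_sq_eq_of_L2 _ (trunc M x).snd.snd
  rw [h1, h2, h3, h4, normSq, Finset.sum_add_distrib, Finset.sum_range, Finset.sum_range]
  rfl

section Halmos

variable {K : Type*} [NormedAddCommGroup K] [InnerProductSpace ℂ K] [CompleteSpace K]
  (u : K →L[ℂ] K)

/-- The first component of the Halmos unitary of a partial isometry. -/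
noncomputable def halmosFst : K × K →ₗ[ℂ] K :=
  u.toLinearMap ∘ₗ LinearMap.fst ℂ K K +
    (1 - u * ContinuousLinearMap.adjoint u).toLinearMap ∘ₗ LinearMap.snd ℂ K K

/-- The second component of the Halmos unitary of a partial isometry. -/
noncomputable def halmosSnd : K × K →ₗ[ℂ] K :=
  (1 - ContinuousLinearMap.adjoint u * u).toLinearMap ∘ₗ LinearMap.fst ℂ K K -
    (ContinuousLinearMap.adjoint u).toLinearMap ∘ₗ LinearMap.snd ℂ K K

lemma halmosFst_apply (x : K × K) :
    halmosFst u x = u x.1 + (x.2 - u (ContinuousLinearMap.adjoint u x.2)) := rfl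

lemma halmosSnd_apply (x : K × K) :
    halmosSnd u x = (x.1 - ContinuousLinearMap.adjoint u (u x.1)) -
      ContinuousLinearMap.adjoint u x.2 := rfl

variable {u}

lemma adjoint_partialIsometry
    (hu : ∀ y, u (ContinuousLinearMap.adjoint u (u y)) = u y) (y : K) :
    ContinuousLinearMap.adjoint u (u (ContinuousLinearMap.adjoint u y)) =
      ContinuousLinearMap.adjoint u y := by
  refine ext_inner_right ℂ fun z => ?_
  rw [ContinuousLinearMap.adjoint_inner_left, ← ContinuousLinearMap.adjoint_inner_right,
    ContinuousLinearMap.adjoint_inner_left, hu, ContinuousLinearMap.adjoint_inner_left]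

lemma norm_sq_add_norm_sq_sub
    (hu : ∀ y, u (ContinuousLinearMap.adjoint u (u y)) = u y) (y : K) :
    ‖u y‖ ^ 2 + ‖y - ContinuousLinearMap.adjoint u (u y)‖ ^ 2 = ‖y‖ ^ 2 := by
  set p := ContinuousLinearMap.adjoint u (u y) with hp
  have h1 : inner ℂ p y = inner ℂ (u y) (u y) := by
    rw [hp, ContinuousLinearMap.adjoint_inner_left]
  have h2 : ‖p‖ ^ 2 = ‖u y‖ ^ 2 := by
    have h3 : inner ℂ p p = inner ℂ (u y) (u y) := by
      nth_rewrite 1 [hp]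
      rw [ContinuousLinearMap.adjoint_inner_left, hp, hu]
    rw [← inner_self_eq_norm_sq (𝕜 := ℂ), h3, inner_self_eq_norm_sq]
  have h4 : RCLike.re (inner ℂ y p) = ‖u y‖ ^ 2 := by
    rw [inner_re_symm, h1, inner_self_eq_norm_sq]
  rw [@norm_sub_sq ℂ, h4, h2]; ring

/-- For the block matrix with rows `(u, 1 - u u*)` and `(1 - u* u, -u*)`, the cross terms vanish
because `u u* u = u`. Doubling the space is what allows a partial isometry to become unitary, and
explains the second sequence in `Space`. -/
lemma norm_sq_halmos (hu : ∀ y, u (ContinuousLinearMap.adjoint u (u y)) = u y) (x : K × K) :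
    ‖halmosFst u x‖ ^ 2 + ‖halmosSnd u x‖ ^ 2 = ‖x.1‖ ^ 2 + ‖x.2‖ ^ 2 := by
  have hu' : ∀ y, ContinuousLinearMap.adjoint u (ContinuousLinearMap.adjoint
      (ContinuousLinearMap.adjoint u) (ContinuousLinearMap.adjoint u y)) =
      ContinuousLinearMap.adjoint u y := by
    intro y; rw [ContinuousLinearMap.adjoint_adjoint, adjoint_partialIsometry hu]
  have h1 := norm_sq_add_norm_sq_sub hu x.1
  have h2 := norm_sq_add_norm_sq_sub hu' x.2
  rw [ContinuousLinearMap.adjoint_adjoint] at h2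
  have h3 : inner ℂ (u x.1) (x.2 - u (ContinuousLinearMap.adjoint u x.2)) = 0 := by
    rw [← ContinuousLinearMap.adjoint_inner_right, map_sub, adjoint_partialIsometry hu, sub_self,
      inner_zero_right]
  have h4 : inner ℂ (x.1 - ContinuousLinearMap.adjoint u (u x.1))
      (ContinuousLinearMap.adjoint u x.2) = 0 := by
    rw [ContinuousLinearMap.adjoint_inner_right, map_sub, hu, sub_self, inner_zero_left]
  rw [halmosFst_apply, halmosSnd_apply, @norm_add_sq ℂ, @norm_sub_sq ℂ _ _ _ _
    (x.1 - ContinuousLinearMap.adjoint u (u x.1)), h3, h4]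
  simp only [map_zero]
  linarith

/-- The Halmos matrix of the adjoint is the adjoint of the Halmos matrix, hence its inverse. -/
lemma halmos_adjoint_halmos (hu : ∀ y, u (ContinuousLinearMap.adjoint u (u y)) = u y)
    (x : K × K) :
    halmosFst u (halmosFst (ContinuousLinearMap.adjoint u) x,
      halmosSnd (ContinuousLinearMap.adjoint u) x) = x.1 ∧
    halmosSnd u (halmosFst (ContinuousLinearMap.adjoint u) x,
      halmosSnd (ContinuousLinearMap.adjoint u) x) = x.2 := by
  have hu' := adjoint_partialIsometry hu
  simp only [halmosFst_apply, halmosSnd_apply, ContinuousLinearMap.adjoint_adjoint, map_sub,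
    map_add, hu, hu']
  constructor <;> abel

end Halmos

section Dilation

variable [CompleteSpace H]

/-- The Halmos unitary acting on each pair of blocks. -/
noncomputable def blockUnitary (u : Sq H →L[ℂ] Sq H) : Module.End ℂ (Space H) :=
  (LinearMap.fst ℂ _ _).prod
    ((LinearMap.pi fun n => halmosFst u ∘ₗ ((LinearMap.proj n ∘ₗ LinearMap.fst ℂ _ _).prod
        (LinearMap.proj n ∘ₗ LinearMap.snd ℂ _ _)) ∘ₗ LinearMap.snd ℂ _ _).prod
      (LinearMap.pi fun n => halmosSnd u ∘ₗ ((LinearMap.proj n ∘ₗ LinearMap.fst ℂ _ _).prod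
        (LinearMap.proj n ∘ₗ LinearMap.snd ℂ _ _)) ∘ₗ LinearMap.snd ℂ _ _))

lemma blockUnitary_apply (u : Sq H →L[ℂ] Sq H) (x : Space H) :
    blockUnitary u x = (x.1, fun n => halmosFst u (x.2.1 n, x.2.2 n),
      fun n => halmosSnd u (x.2.1 n, x.2.2 n)) := rfl

lemma blockUnitary_isometric {u : Sq H →L[ℂ] Sq H}
    (hu : ∀ y, u (ContinuousLinearMap.adjoint u (u y)) = u y) (M : ℕ) (x : Space H) :
    normSq M (blockUnitary u x) = normSq M x := by
  simp only [normSq, blockUnitary_apply, norm_sq_halmos hu]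

lemma SuppLE.blockUnitary {u : Sq H →L[ℂ] Sq H} {L : ℕ} {x : Space H} (hx : SuppLE L x) :
    SuppLE L (blockUnitary u x) := fun n hn => by
  have := hx n hn
  simp [blockUnitary_apply, this.1, this.2, ← Prod.zero_eq_mk]

lemma blockUnitary_mul_adjoint {u : Sq H →L[ℂ] Sq H}
    (hu : ∀ y, u (ContinuousLinearMap.adjoint u (u y)) = u y) :
    blockUnitary u * blockUnitary (ContinuousLinearMap.adjoint u) = 1 := by
  refine LinearMap.ext fun x => ?_
  simp only [Module.End.mul_apply, blockUnitary_apply, Module.End.one_apply]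
  refine Prod.ext rfl (Prod.ext ?_ ?_)
  · exact funext fun n => (halmos_adjoint_halmos hu (x.2.1 n, x.2.2 n)).1
  · exact funext fun n => (halmos_adjoint_halmos hu (x.2.1 n, x.2.2 n)).2

variable {T D : Fin 2 → H →L[ℂ] H}

/-- The two orders of the basic dilations differ only in the inserted block, and the unitary carries
one block to the other. Placing it left of one dilation and its inverse right of the other makes
them commute. -/
lemma dilations_comm (hT : T 0 * T 1 = T 1 * T 0) {u : Sq H →L[ℂ] Sq H}
    (hu : ∀ y, u (ContinuousLinearMap.adjoint u (u y)) = u y)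
    (h1 : ∀ x, u (WithLp.toLp 2 (D 0 (T 1 x), D 1 x)) = WithLp.toLp 2 (D 1 (T 0 x), D 0 x))
    (h2 : ∀ x, ContinuousLinearMap.adjoint u (u (WithLp.toLp 2 (D 0 (T 1 x), D 1 x))) =
      WithLp.toLp 2 (D 0 (T 1 x), D 1 x)) :
    (blockUnitary u * shiftDilation (T 0) (D 0)) *
      (shiftDilation (T 1) (D 1) * blockUnitary (ContinuousLinearMap.adjoint u)) =
    (shiftDilation (T 1) (D 1) * blockUnitary (ContinuousLinearMap.adjoint u)) *
      (blockUnitary u * shiftDilation (T 0) (D 0)) := by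
  have hinv : blockUnitary (ContinuousLinearMap.adjoint u) * blockUnitary u = 1 := by
    have := blockUnitary_mul_adjoint (u := ContinuousLinearMap.adjoint u) fun y => by
      rw [ContinuousLinearMap.adjoint_adjoint, adjoint_partialIsometry hu]
    rwa [ContinuousLinearMap.adjoint_adjoint] at this
  have key : blockUnitary u * shiftDilation (T 0) (D 0) * shiftDilation (T 1) (D 1) =
      shiftDilation (T 1) (D 1) * shiftDilation (T 0) (D 0) * blockUnitary u := by
    refine LinearMap.ext fun x => ?_
    simp only [Module.End.mul_apply, shiftDilation_shiftDilation]
    simp only [blockUnitary_apply]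
    have hTx : T 0 (T 1 x.1) = T 1 (T 0 x.1) := congrArg (fun S => S x.1) hT
    refine Prod.ext hTx (Prod.ext (funext fun n => ?_) (funext fun n => ?_))
    · rcases n with _ | n
      · simp [halmosFst_apply, h1]
      · rfl
    · rcases n with _ | n
      · simp [halmosSnd_apply, h2]
      · rfl
  have e1 := blockUnitary_mul_adjoint hu
  calc _ = (blockUnitary u * shiftDilation (T 0) (D 0) * shiftDilation (T 1) (D 1)) *
        blockUnitary (ContinuousLinearMap.adjoint u) := by simp only [mul_assoc]
    _ = _ := by
      rw [key, mul_assoc, e1, mul_one, mul_assoc (shiftDilation (T 1) (D 1)),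
        ← mul_assoc (blockUnitary (ContinuousLinearMap.adjoint u)), hinv, one_mul]

end Dilation

end Ando

open Ando in
/-- **Andô's inequality**: von Neumann's inequality for two commuting contractions. -/
theorem norm_polyEval_le_of_contractions {H : Type*} [NormedAddCommGroup H]
    [InnerProductSpace ℂ H] [CompleteSpace H] {T : Fin 2 → H →L[ℂ] H}
    (hT : T 0 * T 1 = T 1 * T 0) (hc : ∀ i x, ‖T i x‖ ≤ ‖x‖) (s : Finset (ℕ × ℕ))
    (c : ℕ × ℕ → ℂ) {B : ℝ} (hB : ∀ z : Fin 2 → ℂ, (∀ i, ‖z i‖ = 1) → ‖polyEval z s c‖ ≤ B)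
    (h : H) : ‖polyEval T s c h‖ ≤ B * ‖h‖ := by
  choose D hD using fun i => exists_defect (T i) (hc i)
  -- `α` and `β` are the blocks inserted by the two orders of dilating. Both have squared norm `‖x‖²
  -- - ‖T 0 (T 1 x)‖²`, so a partial isometry relates them.
  let α : H →ₗ[ℂ] Sq H := (WithLp.linearEquiv 2 ℂ (H × H)).symm.toLinearMap ∘ₗ
    (((D 0).comp (T 1)).toLinearMap.prod (D 1).toLinearMap)
  let β : H →ₗ[ℂ] Sq H := (WithLp.linearEquiv 2 ℂ (H × H)).symm.toLinearMap ∘ₗ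
    (((D 1).comp (T 0)).toLinearMap.prod (D 0).toLinearMap)
  have hαβ : ∀ x, ‖α x‖ = ‖β x‖ := fun x => by
    refine (sq_eq_sq₀ (norm_nonneg _) (norm_nonneg _)).1 ?_
    have e1 : ‖α x‖ ^ 2 = ‖D 0 (T 1 x)‖ ^ 2 + ‖D 1 x‖ ^ 2 := norm_sq_sq _
    have e2 : ‖β x‖ ^ 2 = ‖D 1 (T 0 x)‖ ^ 2 + ‖D 0 x‖ ^ 2 := norm_sq_sq _
    have hTx : T 0 (T 1 x) = T 1 (T 0 x) := congrArg (fun S => S x) hT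
    have f1 := hD 0 (T 1 x)
    have f2 := hD 1 x
    have f3 := hD 1 (T 0 x)
    have f4 := hD 0 x
    rw [hTx] at f1
    rw [e1, e2]; linarith
  obtain ⟨u, hu1, -, hu2, hu⟩ := exists_partialIsometry α β hαβ
  let V : Fin 2 → Module.End ℂ (Space H) :=
    ![blockUnitary u * shiftDilation (T 0) (D 0),
      shiftDilation (T 1) (D 1) * blockUnitary (ContinuousLinearMap.adjoint u)]
  have hV : V 0 * V 1 = V 1 * V 0 :=
    dilations_comm hT hu hu1 fun x => by exact hu2 x
  have hiso : ∀ i L M (x : Space H), L < M → SuppLE L x →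
      normSq M (V i x) = normSq M x ∧ SuppLE (L + 1) (V i x) := by
    intro i L M x hLM hx
    fin_cases i
    · have := shiftDilation_isometric (hD 0) hLM hx
      exact ⟨(blockUnitary_isometric hu _ _).trans this.1, this.2.blockUnitary⟩
    · have := shiftDilation_isometric (hD 1) hLM
        (hx.blockUnitary (u := ContinuousLinearMap.adjoint u))
      refine ⟨this.1.trans (blockUnitary_isometric (fun y => ?_) _ _), this.2⟩
      rw [ContinuousLinearMap.adjoint_adjoint, adjoint_partialIsometry hu]
  have hpow : ∀ i (k L M : ℕ) (x : Space H), L + k ≤ M → SuppLE L x →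
      normSq M ((V i ^ k) x) = normSq M x ∧ SuppLE (L + k) ((V i ^ k) x) := by
    intro i k
    induction k with
    | zero => intro L M x _ hx; exact ⟨rfl, hx⟩
    | succ k ih =>
      intro L M x hM hx
      have h1 := ih L M x (by omega) hx
      have h2 := hiso i (L + k) M _ (by omega) h1.2
      rw [pow_succ', Module.End.mul_apply]
      exact ⟨h2.1.trans h1.1, h2.2⟩
  have hgrid : ∀ (i j L M : ℕ) (x : Space H), L + i + j ≤ M → SuppLE L x →
      normSq M ((V 0 ^ i * V 1 ^ j) x) = normSq M x ∧ SuppLE (L + i + j) ((V 0 ^ i * V 1 ^ j) x) := by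
    intro i j L M x hM hx
    have h1 := hpow 1 j L M x (by omega) hx
    have h2 := hpow 0 i (L + j) M _ (by omega) h1.2
    rw [Module.End.mul_apply]
    exact ⟨h2.1.trans h1.1, h2.2.mono (by omega)⟩
  let x : Space H := (h, 0, 0)
  let y : Space H := polyEval V s c x
  have hx : SuppLE 0 x := fun n _ => ⟨rfl, rfl⟩
  obtain ⟨L, hy⟩ : ∃ L, SuppLE L y := by
    refine ⟨s.sup fun p => p.1 + p.2, fun n hn => ?_⟩
    have hz : ∀ p ∈ s, ((V 0 ^ p.1 * V 1 ^ p.2) x).2.1 n = 0 ∧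
        ((V 0 ^ p.1 * V 1 ^ p.2) x).2.2 n = 0 := fun p hp =>
      (hgrid p.1 p.2 0 _ x le_rfl hx).2 n (by
        have := Finset.le_sup (f := fun p : ℕ × ℕ => p.1 + p.2) hp
        omega)
    have hy' : y = ∑ p ∈ s, c p • (V 0 ^ p.1 * V 1 ^ p.2) x := by
      simp [y, polyEval, LinearMap.sum_apply]
    rw [hy']
    simp only [Prod.snd_sum, Prod.fst_sum, Finset.sum_apply, Prod.smul_snd, Prod.smul_fst,
      Pi.smul_apply]
    exact ⟨Finset.sum_eq_zero fun p hp => by rw [(hz p hp).1, smul_zero],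
      Finset.sum_eq_zero fun p hp => by rw [(hz p hp).2, smul_zero]⟩
  have hfst : ∀ i (w : Space H), (V i w).1 = T i w.1 := by
    intro i w
    fin_cases i <;> rfl
  have hfstpow : ∀ i (k : ℕ) (w : Space H), ((V i ^ k) w).1 = (T i ^ k) w.1 := by
    intro i k
    induction k with
    | zero => intro w; rfl
    | succ k ih =>
      intro w
      rw [pow_succ, pow_succ, Module.End.mul_apply, ih, hfst]; rfl
  have hyfst : y.1 = polyEval T s c h := by
    have hy' : y = ∑ p ∈ s, c p • (V 0 ^ p.1 * V 1 ^ p.2) x := by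
      simp [y, polyEval, LinearMap.sum_apply]
    rw [hy', Prod.fst_sum, polyEval, sum_apply]
    refine Finset.sum_congr rfl fun p _ => ?_
    rw [Prod.smul_fst, Module.End.mul_apply, hfstpow, hfstpow]; rfl
  have hnx : ∀ M, normSq M x = ‖h‖ ^ 2 := fun M => by simp [normSq, x]
  -- A vector supported below `L`, moved by exponents smaller than `R`, stays below `L + 2 * R`; the
  -- truncated norm is then exact.
  have key := norm_polyEval_le_of_isometric hV s c hB (fun R => trunc (H := H) (L + 2 * R)) x
    (a := ‖h‖) (b := √(normSq L y)) (norm_nonneg _)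
    (fun R i j hi hj => by
      rw [← sq_eq_sq₀ (norm_nonneg _) (norm_nonneg _), norm_sq_trunc,
        (hgrid i j 0 _ x (by omega) hx).1, hnx])
    (fun R i j hi hj => by
      have e := norm_sq_trunc (L + 2 * R) ((V 0 ^ i * V 1 ^ j) (polyEval V s c x))
      rw [(hgrid i j L _ y (by omega) hy).1, hy.normSq_eq (by omega)] at e
      rw [← e, Real.sqrt_sq (norm_nonneg _)])
  -- Dropping all but the first component compresses the isometries back to the contractions.
  refine le_trans (Real.le_sqrt_of_sq_le ?_) key
  rw [← hyfst, normSq]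
  exact le_add_of_nonneg_right (Finset.sum_nonneg fun n _ => by positivity)

/-! ### From peak functions to interpolation, and uniform interpolation of signs. -/

/-- The sign of a Boolean. -/
noncomputable def boolSign (b : Bool) : ℂ := if b then 1 else -1

lemma norm_boolSign (b : Bool) : ‖boolSign b‖ = 1 := by cases b <;> simp [boolSign]

lemma boolSign_mul_self (b : Bool) : boolSign b * boolSign b = 1 := by
  cases b <;> simp [boolSign]

lemma conj_boolSign (b : Bool) : (starRingEnd ℂ) (boolSign b) = boolSign b := by
  cases b <;> simp [boolSign]

section Interpolation

variable {s : ℕ → ℕ} {A : (n : ℕ) → Fin 2 → Matrix (Fin (s n)) (Fin (s n)) ℂ}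

/-- Functions as in the theorem of Varopoulos give a bounded linear operator of interpolation. -/
lemma isInterpolating_of_peak (hA : ∀ n, IsBidiscPair (A n)) {f : ℕ → bidisc → ℂ}
    (hf : ∀ n, IsHolo (f n))
    (hfA : ∀ n j, evalMat (f n) (A j) = if n = j then (1 : Matrix (Fin (s j)) (Fin (s j)) ℂ) else 0)
    {B : ℝ} (hB : ∀ z, Summable (fun n => ‖f n z‖) ∧ ∑' n, ‖f n z‖ ≤ B) : IsInterpolating A := by
  rintro φ ⟨hφ, B', hB'⟩
  let F : ℕ → bidisc → ℂ := fun N z => ∑ n ∈ Finset.range N, φ n z * f n z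
  have hF : ∀ N, IsHolo (F N) := fun N => IsHolo.sum fun n _ => (hφ n).mul (hf n)
  have hB'0 : ∀ z : bidisc, 0 ≤ B' := fun z => (norm_nonneg _).trans (hB' 0 z)
  have hterm : ∀ n z, ‖φ n z * f n z‖ ≤ B' * ‖f n z‖ := fun n z => by
    rw [norm_mul]; exact mul_le_mul_of_nonneg_right (hB' n z) (norm_nonneg _)
  have hFB : ∀ N z, ‖F N z‖ ≤ B' * B := fun N z => by
    refine (norm_sum_le _ _).trans ((Finset.sum_le_sum fun n _ => hterm n z).trans ?_)
    rw [← Finset.mul_sum]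
    refine mul_le_mul_of_nonneg_left (le_trans ?_ (hB z).2) (hB'0 z)
    exact (hB z).1.sum_le_tsum _ fun _ _ => norm_nonneg _
  have hlim : ∀ z, Tendsto (fun N => F N z) atTop (𝓝 (∑' n, φ n z * f n z)) := fun z =>
    (Summable.of_norm_bounded ((hB z).1.mul_left B') fun n => hterm n z).hasSum.tendsto_sum_nat
  have hψ := isHolo_of_tendsto hF _ hFB hlim
  refine ⟨fun z => ∑' n, φ n z * f n z, ⟨hψ, B' * B, fun z =>
    le_of_tendsto' (hlim z).norm fun N => hFB N z⟩, fun j => ?_⟩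
  refine tendsto_nhds_unique ((hA j).tendsto_evalMat _ hF hψ hFB hlim)
    (tendsto_const_nhds.congr' ?_)
  filter_upwards [eventually_gt_atTop j] with N hN
  have h := (hA j).evalMat_sum (Finset.range N) (F := fun n z => φ n z * f n z)
    (fun n _ => (hφ n).mul (hf n)) fun _ => 1
  simp only [one_mul, one_smul] at h
  simp only [F]
  rw [h, Finset.sum_eq_single j]
  · rw [(hA j).evalMat_mul (hφ j) (hf j), hfA, if_pos rfl, mul_one]
  · intro n _ hn
    rw [(hA j).evalMat_mul (hφ n) (hf n), hfA, if_neg hn, mul_zero]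
  · exact fun h => absurd (Finset.mem_range.2 hN) h

lemma exists_scalar_interpolation (hA : ∀ n, IsBidiscPair (A n)) (h : IsInterpolating A)
    (w : ℕ → ℂ) (hw : ∃ B : ℝ, ∀ n, ‖w n‖ ≤ B) :
    ∃ φ ∈ HInfty, ∀ n, evalMat φ (A n) = w n • (1 : Matrix (Fin (s n)) (Fin (s n)) ℂ) := by
  obtain ⟨B, hB⟩ := hw
  obtain ⟨ψ, hψ, he⟩ := h (fun n _ => w n) ⟨fun n => isHolo_const _, B, fun n _ => hB n⟩
  exact ⟨ψ, hψ, fun n => (he n).trans ((hA n).evalMat_const _)⟩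

/-- The open mapping theorem for sign sequences. -/
lemma exists_uniform_sign_interpolation (hA : ∀ n, IsBidiscPair (A n))
    (h : ∀ w : ℕ → ℂ, (∃ B : ℝ, ∀ n, ‖w n‖ ≤ B) →
      ∃ φ ∈ HInfty, ∀ n, evalMat φ (A n) = w n • (1 : Matrix (Fin (s n)) (Fin (s n)) ℂ)) :
    ∃ B : ℝ, 0 < B ∧ ∀ w : ℕ → Bool, ∃ φ : bidisc → ℂ, IsHolo φ ∧ (∀ z, ‖φ z‖ ≤ B) ∧
      ∀ n, evalMat φ (A n) = boolSign (w n) • (1 : Matrix (Fin (s n)) (Fin (s n)) ℂ) := by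
  -- Sign sequences interpolated with bound `N`: closed by Montel's theorem, and together they cover
  -- the Cantor space, so Baire's theorem applies.
  let Kset : ℕ → Set (ℕ → Bool) := fun N => {w | ∃ φ : bidisc → ℂ, IsHolo φ ∧
    (∀ z, ‖φ z‖ ≤ N) ∧
    ∀ n, evalMat φ (A n) = boolSign (w n) • (1 : Matrix (Fin (s n)) (Fin (s n)) ℂ)}
  have hclosed : ∀ N, IsClosed (Kset N) := by
    intro N
    refine IsSeqClosed.isClosed fun w w0 hw hlim => ?_
    choose φ h1 h2 h3 using hw
    obtain ⟨σ, hσ, G, hG, hGlim⟩ := montel (fun k (_ : Unit) => φ k) (fun k _ => h1 k) N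
      fun k _ => h2 k
    refine ⟨G (), hG (), fun z => le_of_tendsto' (hGlim () z).norm fun k => h2 _ z, fun n => ?_⟩
    refine tendsto_nhds_unique ((hA n).tendsto_evalMat N (fun k => h1 (σ k)) (hG ())
      (fun k => h2 (σ k)) (hGlim ())) (tendsto_const_nhds.congr' ?_)
    have hn : ∀ᶠ k in atTop, w (σ k) n = w0 n := by
      have := (tendsto_pi_nhds.1 hlim n).comp hσ.tendsto_atTop
      rw [nhds_discrete, tendsto_pure] at this
      exact this
    filter_upwards [hn] with k hk
    rw [h3, hk]
  have hcover : ⋃ N, Kset N = Set.univ := by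
    refine Set.eq_univ_of_forall fun w => ?_
    obtain ⟨φ, ⟨hφ, B, hB⟩, he⟩ := h (fun n => boolSign (w n)) ⟨1, fun n => (norm_boolSign _).le⟩
    obtain ⟨N, hN⟩ := exists_nat_ge B
    exact Set.mem_iUnion.2 ⟨N, φ, hφ, fun z => (hB z).trans hN, he⟩
  obtain ⟨N, w0, hw0⟩ := nonempty_interior_of_iUnion_of_closed hclosed hcover
  rw [mem_interior_iff_mem_nhds, nhds_pi, Filter.mem_pi] at hw0
  obtain ⟨I, hI, t, ht, hsub⟩ := hw0
  -- An open subset of the Cantor space prescribes only the finitely many coordinates in `I`. A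
  -- given `w` is altered there, and the error is removed by multiples of `g k` with coefficients of
  -- modulus at most two.
  choose g hgH hgA using fun n => h (fun k => if k = n then 1 else 0)
    ⟨1, fun k => by split_ifs <;> simp⟩
  choose D hD using fun n => (hgH n).2
  have hD0 : ∀ n, 0 ≤ D n := fun n =>
    (norm_nonneg _).trans (hD n ⟨fun _ => 0, fun _ => by simp⟩)
  refine ⟨N + ∑ k ∈ hI.toFinset, 2 * D k + 1, ?_, fun w => ?_⟩
  · have : 0 ≤ ∑ k ∈ hI.toFinset, 2 * D k := Finset.sum_nonneg fun k _ => by have := hD0 k; positivity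
    positivity
  classical
  let w' : ℕ → Bool := fun n => if n ∈ I then w0 n else w n
  obtain ⟨φ, h1, h2, h3⟩ : w' ∈ Kset N := hsub fun n hn => by
    have : w' n = w0 n := if_pos hn
    rw [this]; exact mem_of_mem_nhds (ht n)
  let c : ℕ → ℂ := fun k => boolSign (w k) - boolSign (w' k)
  have hc : ∀ k, ‖c k‖ ≤ 2 := fun k => (norm_sub_le _ _).trans (by
    rw [norm_boolSign, norm_boolSign]; norm_num)
  have hsum : IsHolo fun z => ∑ k ∈ hI.toFinset, c k * g k z :=
    IsHolo.sum fun k _ => (isHolo_const (c k)).mul (hgH k).1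
  refine ⟨fun z => φ z + ∑ k ∈ hI.toFinset, c k * g k z, h1.add hsum, fun z => ?_, fun n => ?_⟩
  · have : ‖∑ k ∈ hI.toFinset, c k * g k z‖ ≤ ∑ k ∈ hI.toFinset, 2 * D k := by
      refine (norm_sum_le _ _).trans (Finset.sum_le_sum fun k _ => ?_)
      rw [norm_mul]
      exact mul_le_mul (hc k) (hD k z) (norm_nonneg _) (by norm_num)
    linarith [norm_add_le (φ z) (∑ k ∈ hI.toFinset, c k * g k z), h2 z]
  · rw [(hA n).evalMat_add h1 hsum, (hA n).evalMat_sum _ (fun k _ => (hgH k).1), h3]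
    simp only [hgA]
    by_cases hn : n ∈ I
    · rw [Finset.sum_eq_single n]
      · simp [c, ← add_smul]
      · intro k _ hk; simp [hk.symm]
      · intro h'; exact absurd (hI.mem_toFinset.2 hn) h'
    · rw [Finset.sum_eq_zero]
      · have : w' n = w n := if_neg hn
        rw [this, add_zero]
      · intro k hk
        have : n ≠ k := by rintro rfl; exact hn (hI.mem_toFinset.1 hk)
        simp [this]

end Interpolation

/-- Bounded holomorphic functions are limits of polynomials with almost the same bound. -/
lemma IsHolo.exists_polyFun_bounded {φ : bidisc → ℂ} (hφ : IsHolo φ) {B : ℝ}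
    (hB : ∀ z, ‖φ z‖ ≤ B) : ∃ (s : ℕ → Finset (ℕ × ℕ)) (c : ℕ → ℕ × ℕ → ℂ),
      (∀ (k : ℕ) (z : Fin 2 → ℂ), (∀ i, ‖z i‖ ≤ 1) →
        ‖polyEval z (s k) (c k)‖ ≤ B + 1 / ((k : ℝ) + 1)) ∧
      ∀ z : bidisc, Tendsto (fun k => polyFun (s k) (c k) z) atTop (𝓝 (φ z)) := by
  let r : ℕ → ℝ := fun k => 1 - 1 / ((k : ℝ) + 1)
  have hr1 : ∀ k, r k < 1 := fun k => by
    have : (0 : ℝ) < 1 / ((k : ℝ) + 1) := by positivity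
    simp only [r]; linarith
  have hr0 : ∀ k, 0 ≤ r k := fun k => by
    have : (1 : ℝ) / ((k : ℝ) + 1) ≤ 1 := by
      rw [div_le_one (by positivity)]; linarith [Nat.cast_nonneg (α := ℝ) k]
    simp only [r]; linarith
  have hrlim : Tendsto r atTop (𝓝 1) := by
    have := (tendsto_one_div_add_atTop_nhds_zero_nat (𝕜 := ℝ)).const_sub 1
    simpa only [sub_zero] using this
  choose s c h using fun k : ℕ => hφ.exists_polynomial (hr1 k)
    (ε := 1 / ((k : ℝ) + 1)) (by positivity)
  -- The polynomials approximate `φ(r z)` with `r < 1` absorbed into their coefficients, so that the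
  -- bound holds up to the boundary of the bidisc.
  have hscale : ∀ k (z : Fin 2 → ℂ), polyEval z (s k)
      (fun m => c k m * ((r k : ℂ) ^ m.1 * (r k : ℂ) ^ m.2)) =
      ∑ m ∈ s k, c k m * mono2 m ((r k : ℂ) • z) := by
    intro k z
    refine Finset.sum_congr rfl fun m _ => ?_
    simp only [smul_eq_mul, mono2, Pi.smul_apply, mul_pow]; ring
  have hle : ∀ k (z : Fin 2 → ℂ), (∀ i, ‖z i‖ ≤ 1) → ∀ i, ‖((r k : ℂ) • z) i‖ ≤ r k := by
    intro k z hz i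
    simp only [Pi.smul_apply, smul_eq_mul, norm_mul, Complex.norm_real, Real.norm_eq_abs,
      abs_of_nonneg (hr0 k)]
    exact mul_le_of_le_one_right (hr0 k) (hz i)
  refine ⟨s, fun k m => c k m * ((r k : ℂ) ^ m.1 * (r k : ℂ) ^ m.2), fun k z hz => ?_,
    fun z => ?_⟩
  · rw [hscale]
    have h1 := h k _ (hle k z hz)
    have hmem : (r k : ℂ) • z ∈ bidisc := fun i => (hle k z hz i).trans_lt (hr1 k)
    have h2 : ‖zeroExt φ ((r k : ℂ) • z)‖ ≤ B := by rw [zeroExt_of_mem _ hmem]; exact hB _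
    have h3 := norm_sub_norm_le (∑ m ∈ s k, c k m * mono2 m ((r k : ℂ) • z))
      (zeroExt φ ((r k : ℂ) • z))
    rw [norm_sub_rev] at h3
    linarith
  · have hcont : ContinuousAt (zeroExt φ) z.1 :=
      (DifferentiableOn.continuousOn hφ).continuousAt (isOpen_bidisc.mem_nhds z.2)
    have hz1 : Tendsto (fun k => (r k : ℂ) • z.1) atTop (𝓝 z.1) := by
      have : Tendsto (fun k => (r k : ℂ)) atTop (𝓝 ((1 : ℝ) : ℂ)) :=
        (Complex.continuous_ofReal.tendsto 1).comp hrlim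
      simpa using this.smul_const z.1
    have h1 : Tendsto (fun k => zeroExt φ ((r k : ℂ) • z.1)) atTop (𝓝 (φ z)) := by
      rw [← zeroExt_apply φ]; exact hcont.tendsto.comp hz1
    have h2 : Tendsto (fun k => zeroExt φ ((r k : ℂ) • z.1) - polyFun (s k)
        (fun m => c k m * ((r k : ℂ) ^ m.1 * (r k : ℂ) ^ m.2)) z) atTop (𝓝 0) := by
      refine squeeze_zero_norm (fun k => ?_) tendsto_one_div_add_atTop_nhds_zero_nat
      rw [polyFun, hscale]
      exact (h k _ (hle k _ fun i => (z.2 i).le)).le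
    simpa using h1.sub h2

/-! ### Sign changes and Riesz systems. -/

section RieszSigns

variable {H : Type} [NormedAddCommGroup H] [InnerProductSpace ℂ H]

lemma norm_sq_add_add_norm_sq_sub (x y : H) :
    ‖x + y‖ ^ 2 + ‖x - y‖ ^ 2 = 2 * (‖x‖ ^ 2 + ‖y‖ ^ 2) := by
  have := parallelogram_law_with_norm ℂ x y
  nlinarith

/-- Signs are chosen one at a time: by the parallelogram law the two squared norms `‖y ± x‖²` have
mean `‖y‖² + ‖x‖²`, so one of them does not exceed it. -/
lemma exists_signs_norm_sq_le (S : Finset ℕ) (x : ℕ → H) :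
    ∃ w : ℕ → Bool, ‖∑ n ∈ S, boolSign (w n) • x n‖ ^ 2 ≤ ∑ n ∈ S, ‖x n‖ ^ 2 := by
  classical
  induction S using Finset.induction_on with
  | empty => exact ⟨fun _ => true, by simp⟩
  | insert a S ha ih =>
    obtain ⟨w, hw⟩ := ih
    have key : ∃ b : Bool, ‖boolSign b • x a + ∑ n ∈ S, boolSign (w n) • x n‖ ^ 2 ≤
        ‖x a‖ ^ 2 + ‖∑ n ∈ S, boolSign (w n) • x n‖ ^ 2 := by
      have h := norm_sq_add_add_norm_sq_sub (∑ n ∈ S, boolSign (w n) • x n) (x a)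
      by_contra! hcon
      have h1 := hcon true
      have h2 := hcon false
      simp only [boolSign, if_true, one_smul, Bool.false_eq_true, if_false, neg_smul] at h1 h2
      rw [add_comm (x a)] at h1
      rw [neg_add_eq_sub] at h2
      simp only [boolSign] at h
      linarith
    obtain ⟨b, hb⟩ := key
    refine ⟨Function.update w a b, ?_⟩
    rw [Finset.sum_insert ha, Finset.sum_insert ha, Function.update_self]
    have e : ∑ n ∈ S, boolSign (Function.update w a b n) • x n =
        ∑ n ∈ S, boolSign (w n) • x n := Finset.sum_congr rfl fun n hn => by
      rw [Function.update_of_ne (by rintro rfl; exact ha hn)]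
    rw [e]; linarith

lemma exists_signs_le_norm_sq (S : Finset ℕ) (x : ℕ → H) :
    ∃ w : ℕ → Bool, ∑ n ∈ S, ‖x n‖ ^ 2 ≤ ‖∑ n ∈ S, boolSign (w n) • x n‖ ^ 2 := by
  classical
  induction S using Finset.induction_on with
  | empty => exact ⟨fun _ => true, by simp⟩
  | insert a S ha ih =>
    obtain ⟨w, hw⟩ := ih
    have key : ∃ b : Bool, ‖x a‖ ^ 2 + ‖∑ n ∈ S, boolSign (w n) • x n‖ ^ 2 ≤
        ‖boolSign b • x a + ∑ n ∈ S, boolSign (w n) • x n‖ ^ 2 := by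
      have h := norm_sq_add_add_norm_sq_sub (∑ n ∈ S, boolSign (w n) • x n) (x a)
      by_contra! hcon
      have h1 := hcon true
      have h2 := hcon false
      simp only [boolSign, if_true, one_smul, Bool.false_eq_true, if_false, neg_smul] at h1 h2
      rw [add_comm (x a)] at h1
      rw [neg_add_eq_sub] at h2
      simp only [boolSign] at h
      linarith
    obtain ⟨b, hb⟩ := key
    refine ⟨Function.update w a b, ?_⟩
    rw [Finset.sum_insert ha, Finset.sum_insert ha, Function.update_self]
    have e : ∑ n ∈ S, boolSign (Function.update w a b n) • x n =
        ∑ n ∈ S, boolSign (w n) • x n := Finset.sum_congr rfl fun n hn => by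
      rw [Function.update_of_ne (by rintro rfl; exact ha hn)]
    rw [e]; linarith

/-- Uniformly bounded sign changes make a Riesz system. -/
lemma isRieszSystem_of_signs [CompleteSpace H] {V : ℕ → Submodule ℂ H} {B : ℝ} (hB : 0 < B)
    (h : ∀ (S : Finset ℕ) (x : ℕ → H), (∀ n, x n ∈ V n) → ∀ w : ℕ → Bool,
      ‖∑ n ∈ S, boolSign (w n) • x n‖ ≤ B * ‖∑ n ∈ S, x n‖) : IsRieszSystem V B := by
  intro x hx hsum
  have hup : ∀ S : Finset ℕ, ‖∑ n ∈ S, x n‖ ^ 2 ≤ B ^ 2 * ∑ n ∈ S, ‖x n‖ ^ 2 := by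
    intro S
    obtain ⟨w, hw⟩ := exists_signs_norm_sq_le S x
    -- Applied to the signed vectors, the hypothesis undoes the signs.
    have h1 := h S (fun n => boolSign (w n) • x n) (fun n => (V n).smul_mem _ (hx n)) w
    simp only [smul_smul, boolSign_mul_self, one_smul] at h1
    calc _ ≤ (B * ‖∑ n ∈ S, boolSign (w n) • x n‖) ^ 2 := by gcongr
      _ = B ^ 2 * ‖∑ n ∈ S, boolSign (w n) • x n‖ ^ 2 := by ring
      _ ≤ _ := by gcongr
  have hlow : ∀ S : Finset ℕ, ∑ n ∈ S, ‖x n‖ ^ 2 ≤ B ^ 2 * ‖∑ n ∈ S, x n‖ ^ 2 := by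
    intro S
    obtain ⟨w, hw⟩ := exists_signs_le_norm_sq S x
    refine hw.trans ?_
    rw [← mul_pow]
    gcongr
    exact h S x hx w
  have hS : Summable x := by
    rw [summable_iff_vanishing_norm]
    intro ε hε
    obtain ⟨S, hS⟩ := (summable_iff_vanishing_norm.1 hsum) ((ε / B) ^ 2) (by positivity)
    refine ⟨S, fun t ht => ?_⟩
    have h1 := hS t ht
    rw [Real.norm_of_nonneg (Finset.sum_nonneg fun n _ => by positivity)] at h1
    have h2 : ‖∑ n ∈ t, x n‖ ^ 2 < ε ^ 2 := by
      refine (hup t).trans_lt ?_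
      calc _ < B ^ 2 * (ε / B) ^ 2 := by gcongr
        _ = ε ^ 2 := by field_simp
    exact lt_of_pow_lt_pow_left₀ 2 hε.le h2
  refine ⟨hS, ?_, ?_⟩
  · have : ∑' n, ‖x n‖ ^ 2 ≤ B ^ 2 * ‖∑' n, x n‖ ^ 2 :=
      le_of_tendsto_of_tendsto' hsum.hasSum ((hS.hasSum.norm.pow 2).const_mul (B ^ 2)) hlow
    rw [one_div, inv_mul_le_iff₀ (by positivity)]
    exact this
  · exact le_of_tendsto_of_tendsto' (hS.hasSum.norm.pow 2) (hsum.hasSum.const_mul _) hup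

end RieszSigns

/-! ### Sign changes on the model spaces. -/

section SchurTest

variable {H : Type} [NormedAddCommGroup H] [InnerProductSpace ℂ H] [RKHS ℂ H bidisc ℂ]

/-- Evaluation at a pair of matrices as a linear map. -/
noncomputable def evalLinear (hH : ∀ f : H, IsHolo ⇑f) {m : ℕ} {M : Fin 2 → Matrix (Fin m) (Fin m) ℂ}
    (hM : IsBidiscPair M) : H →ₗ[ℂ] Matrix (Fin m) (Fin m) ℂ where
  toFun f := evalMat (⇑f) M
  map_add' f g := by rw [RKHS.coe_add]; exact hM.evalMat_add (hH f) (hH g)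
  map_smul' c f := by rw [RKHS.coe_smul]; exact hM.evalMat_const_mul (hH f) c

lemma IsAdmissible.exists_coordMul (hH : IsAdmissible H) : ∃ T : Fin 2 → H →L[ℂ] H,
    (∀ i f z, T i f z = z.1 i * f z) ∧ ∀ i f, ‖T i f‖ ≤ ‖f‖ := by
  choose T hT hn using hH.2
  refine ⟨fun i => LinearMap.mkContinuous
    { toFun := T i
      map_add' := fun f g => RKHS.ext fun z => ?_
      map_smul' := fun c f => RKHS.ext fun z => ?_ } 1 fun f => ?_, fun i f z => hT i f z,
    fun i f => hn i f⟩
  · simp [hT, mul_add]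
  · simp [hT]; ring
  · simpa using hn i f

lemma polyEval_coordMul_apply {T : Fin 2 → H →L[ℂ] H} (hT : ∀ i f z, T i f z = z.1 i * f z)
    (s : Finset (ℕ × ℕ)) (c : ℕ × ℕ → ℂ) (f : H) (z : bidisc) :
    polyEval T s c f z = polyFun s c z * f z := by
  have hpow : ∀ i n (g : H), (T i ^ n) g z = z.1 i ^ n * g z := by
    intro i n
    induction n with
    | zero => simp
    | succ n ih => intro g; rw [pow_succ, mul_apply_eq_comp, ih, hT]; ring
  have hsum : ∀ (s : Finset (ℕ × ℕ)) (g : ℕ × ℕ → H), (∑ p ∈ s, g p) z = ∑ p ∈ s, g p z := by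
    intro s g
    exact map_sum (((ContinuousLinearMap.proj z : (bidisc → ℂ) →L[ℂ] ℂ) ∘L
      (RKHS.coeCLM ℂ : H →L[ℂ] bidisc → ℂ))) g s
  simp only [polyEval, polyFun, _root_.sum_apply, hsum,
    Finset.sum_mul, _root_.smul_apply, mul_apply_eq_comp,
    RKHS.coe_smul, Pi.smul_apply, smul_eq_mul, hpow]
  exact Finset.sum_congr rfl fun p _ => by ring

/-- The elements of the model space act through evaluation at `M`. -/
lemma exists_functional_of_mem_modelSpace (hH : ∀ f : H, IsHolo ⇑f) {m : ℕ}
    {M : Fin 2 → Matrix (Fin m) (Fin m) ℂ} (hM : IsBidiscPair M) {x : H}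
    (hx : x ∈ modelSpace H M) : ∃ l : Matrix (Fin m) (Fin m) ℂ →ₗ[ℂ] ℂ,
      ∀ f : H, inner ℂ x f = l (evalMat (⇑f) M) := by
  -- A functional vanishing on the kernel of evaluation factors through evaluation; this is pure
  -- algebra and needs no closedness.
  have hmem : (innerSL ℂ x).toLinearMap ∈ (LinearMap.ker (evalLinear hH hM)).dualAnnihilator := by
    rw [Submodule.mem_dualAnnihilator]
    intro f hf
    exact Submodule.inner_left_of_mem_orthogonal
      (Submodule.subset_span (show evalMat (⇑f) M = 0 from hf)) hx
  rw [← LinearMap.range_dualMap_eq_dualAnnihilator_ker] at hmem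
  obtain ⟨l, hl⟩ := hmem
  exact ⟨l, fun f => (LinearMap.congr_fun hl f).symm⟩

/-- Scalar interpolation gives uniformly bounded sign changes on the model spaces. -/
lemma norm_sum_boolSign_le [CompleteSpace H] (hH : IsAdmissible H) {s : ℕ → ℕ}
    {A : (n : ℕ) → Fin 2 → Matrix (Fin (s n)) (Fin (s n)) ℂ} (hA : ∀ n, IsBidiscPair (A n)) {B : ℝ}
    (w : ℕ → Bool) {φ : bidisc → ℂ} (hφ : IsHolo φ) (hB : ∀ z, ‖φ z‖ ≤ B)
    (hφA : ∀ n, evalMat φ (A n) = boolSign (w n) • 1) (S : Finset ℕ) (x : ℕ → H)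
    (hx : ∀ n, x n ∈ modelSpace H (A n)) :
    ‖∑ n ∈ S, boolSign (w n) • x n‖ ≤ B * ‖∑ n ∈ S, x n‖ := by
  obtain ⟨T, hT, hTc⟩ := hH.exists_coordMul
  obtain ⟨s', c, hsc, hlim⟩ := hφ.exists_polyFun_bounded hB
  have hcomm : T 0 * T 1 = T 1 * T 0 := by
    ext f : 1
    refine RKHS.ext fun z => ?_
    simp only [mul_apply_eq_comp, hT]; ring
  set f := ∑ n ∈ S, boolSign (w n) • x n with hf
  have hando : ∀ k, ‖polyEval T (s' k) (c k) f‖ ≤ (B + 1 / ((k : ℝ) + 1)) * ‖f‖ := fun k =>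
    norm_polyEval_le_of_contractions hcomm hTc (s' k) (c k)
      (fun z hz => hsc k z fun i => (hz i).le) f
  -- This is the eigenvalue equation for the adjoint of multiplication by `φ`, in weak form and
  -- through polynomials: multiplication by `φ` itself is not yet known to preserve `H`.
  have hterm : ∀ n, Tendsto (fun k => inner ℂ (x n) (polyEval T (s' k) (c k) f)) atTop
      (𝓝 (boolSign (w n) * inner ℂ (x n) f)) := by
    intro n
    obtain ⟨l, hl⟩ := exists_functional_of_mem_modelSpace hH.1 (hA n) (hx n)
    have hcoe : ∀ k, ⇑(polyEval T (s' k) (c k) f) =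
        fun z => polyFun (s' k) (c k) z * f z := fun k =>
      funext fun z => polyEval_coordMul_apply hT _ _ f z
    have he : Tendsto (fun k => evalMat (polyFun (s' k) (c k)) (A n)) atTop
        (𝓝 (evalMat φ (A n))) :=
      (hA n).tendsto_evalMat (B + 1) (fun k => isHolo_polyFun _ _) hφ
        (fun k z => (hsc k z.1 fun i => (z.2 i).le).trans (by
          have : (1 : ℝ) / ((k : ℝ) + 1) ≤ 1 := by
            rw [div_le_one (by positivity)]; linarith [Nat.cast_nonneg (α := ℝ) k]
          linarith)) hlim
    have hlc : Continuous l := l.continuous_of_finiteDimensional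
    have h1 := (hlc.tendsto _).comp (he.mul_const (evalMat (⇑f) (A n)))
    rw [hφA, smul_mul_assoc, one_mul, map_smul, ← hl, smul_eq_mul] at h1
    refine h1.congr fun k => ?_
    rw [hl, hcoe, (hA n).evalMat_mul (isHolo_polyFun _ _) (hH.1 f)]
    rfl
  have hsum : Tendsto (fun k => inner ℂ (∑ n ∈ S, x n) (polyEval T (s' k) (c k) f)) atTop
      (𝓝 (inner ℂ f f)) := by
    have := tendsto_finsetSum S fun n _ => hterm n
    simp only [sum_inner]
    convert this using 2
    conv_lhs => rw [hf, sum_inner, ← hf]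
    exact Finset.sum_congr rfl fun n _ => by rw [inner_smul_left, conj_boolSign]
  -- Since the signs are real, they move across the inner product and assemble `f` itself; Andô's
  -- inequality bounds the other side.
  have hle : ‖inner ℂ f f‖ ≤ ‖∑ n ∈ S, x n‖ * ((B + 0) * ‖f‖) := by
    refine le_of_tendsto_of_tendsto hsum.norm
      (((tendsto_one_div_add_atTop_nhds_zero_nat.const_add B).mul_const ‖f‖).const_mul _)
      (Eventually.of_forall fun k => ?_)
    exact (norm_inner_le_norm _ _).trans (mul_le_mul_of_nonneg_left (hando k) (norm_nonneg _))
  rw [inner_self_eq_norm_sq_to_K, add_zero] at hle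
  rcases eq_or_ne ‖f‖ 0 with h0 | h0
  · rw [h0]
    have hB0 : 0 ≤ B := (norm_nonneg _).trans (hB ⟨0, fun i => by simp⟩)
    positivity
  · have hpos : 0 < ‖f‖ := lt_of_le_of_ne (norm_nonneg _) h0.symm
    have e : ‖((‖f‖ : ℝ) : ℂ) ^ 2‖ = ‖f‖ * ‖f‖ := by
      rw [norm_pow, Complex.norm_real, norm_norm, sq]
    have hle' : ‖f‖ * ‖f‖ ≤ (B * ‖∑ n ∈ S, x n‖) * ‖f‖ := by
      rw [← e]; refine hle.trans (le_of_eq ?_); ring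
    exact le_of_mul_le_mul_right hle' hpos

end SchurTest

/-- Scalar interpolation makes the model spaces of every admissible kernel a Riesz system, with
a common bound. -/
theorem exists_isRieszSystem {s : ℕ → ℕ}
    {A : (n : ℕ) → Fin 2 → Matrix (Fin (s n)) (Fin (s n)) ℂ} (hA : ∀ n, IsBidiscPair (A n))
    (h : ∀ w : ℕ → ℂ, (∃ B : ℝ, ∀ n, ‖w n‖ ≤ B) →
        ∃ φ ∈ HInfty, ∀ n, evalMat φ (A n) = w n • (1 : Matrix (Fin (s n)) (Fin (s n)) ℂ)) :
    ∃ C : ℝ, 0 < C ∧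
      ∀ (H : Type) [NormedAddCommGroup H] [InnerProductSpace ℂ H] [CompleteSpace H]
        [RKHS ℂ H bidisc ℂ], IsAdmissible H → IsRieszSystem (fun n => modelSpace H (A n)) C := by
  obtain ⟨B, hB, hsign⟩ := exists_uniform_sign_interpolation hA h
  refine ⟨B, hB, fun H _ _ _ _ hH => isRieszSystem_of_signs hB fun S x hx w => ?_⟩
  obtain ⟨φ, h1, h2, h3⟩ := hsign w
  exact norm_sum_boolSign_le hH hA w h1 h2 h3 S x hx

/-! ### Transfer functions of contractions. -/

section Realization

open Matrix

variable {ι ν : Type*} [Fintype ι] [Fintype ν]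

/-- Multiplication by coordinates of modulus less than one strictly shrinks any nonzero entry, and
`D` cannot restore the norm. This makes `1 - D Z` invertible on the whole bidisc. -/
lemma eq_zero_of_contraction_fixed {D : Matrix ι ι ℂ} (hD : ∀ y, ∑ l, ‖(D *ᵥ y) l‖ ^ 2 ≤ ∑ l, ‖y l‖ ^ 2)
    (idx : ι → Fin 2) (z : bidisc) {y : ι → ℂ} (hy : y = D *ᵥ fun k => z.1 (idx k) * y k) : y = 0 := by
  have h1 := hD fun k => z.1 (idx k) * y k
  rw [← hy] at h1
  have h2 : ∀ k, 0 ≤ ‖y k‖ ^ 2 - ‖z.1 (idx k) * y k‖ ^ 2 := fun k => by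
    rw [norm_mul, mul_pow]
    nlinarith [sq_nonneg ‖y k‖, pow_le_one₀ (n := 2) (norm_nonneg _) (z.2 (idx k)).le]
  have h3 : ∑ k, (‖y k‖ ^ 2 - ‖z.1 (idx k) * y k‖ ^ 2) = 0 :=
    le_antisymm (by rw [Finset.sum_sub_distrib]; linarith) (Finset.sum_nonneg fun k _ => h2 k)
  funext k
  have h4 := (Finset.sum_eq_zero_iff_of_nonneg fun k _ => h2 k).1 h3 k (Finset.mem_univ k)
  rw [norm_mul, mul_pow] at h4
  by_contra hk
  have : 0 < ‖y k‖ ^ 2 := by have := norm_pos_iff.2 hk; positivity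
  nlinarith [pow_lt_one₀ (norm_nonneg _) (z.2 (idx k)) two_ne_zero]

/-- The transfer function of a contraction, and its values at pairs of matrices. -/
theorem exists_transferFunction [DecidableEq ι] (U : Matrix (ν ⊕ ι) (Unit ⊕ ι) ℂ)
    (hU : ∀ y, ∑ b, ‖(U *ᵥ y) b‖ ^ 2 ≤ ∑ a, ‖y a‖ ^ 2) (ω : ℂ) (idx : ι → Fin 2) :
    ∃ φ : ν → bidisc → ℂ, (∀ n, IsHolo (φ n)) ∧ (∀ z, ∑ n, ‖φ n z‖ ^ 2 ≤ ‖ω‖ ^ 2) ∧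
      ∀ (m : ℕ) (M : Fin 2 → Matrix (Fin m) (Fin m) ℂ), IsBidiscPair M →
        ∀ (X : ν ⊕ ι → Matrix (Fin m) (Fin m) ℂ),
          (∀ b, X b = (U b (Sum.inl ()) * ω) • 1 +
            ∑ k, U b (Sum.inr k) • (M (idx k) * X (Sum.inr k))) →
          ∀ n, evalMat (φ n) M = X (Sum.inl n) := by
  let D : Matrix ι ι ℂ := fun l k => U (Sum.inr l) (Sum.inr k)
  have hD : ∀ y, ∑ l, ‖(D *ᵥ y) l‖ ^ 2 ≤ ∑ l, ‖y l‖ ^ 2 := by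
    intro y
    have h := hU (Sum.elim 0 y)
    simp only [Fintype.sum_sum_type, Matrix.mulVec, dotProduct, Sum.elim_inl, Sum.elim_inr,
      Pi.zero_apply, mul_zero, Finset.sum_const_zero, zero_add, norm_zero] at h
    have h0 : 0 ≤ ∑ n, ‖∑ k, U (Sum.inl n) (Sum.inr k) * y k‖ ^ 2 := by positivity
    simp only [Matrix.mulVec, dotProduct, D]
    norm_num at h
    linarith
  let K : bidisc → Matrix ι ι ℂ := fun z l k => (1 : Matrix ι ι ℂ) l k + -D l k * z.1 (idx k)
  have hKmul : ∀ z (y : ι → ℂ), K z *ᵥ y = y - D *ᵥ fun k => z.1 (idx k) * y k := by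
    intro z y
    have : K z = 1 - (Matrix.of fun l k => D l k * z.1 (idx k)) := by
      funext l k; simp [K, sub_eq_add_neg]
    rw [this, Matrix.sub_mulVec, Matrix.one_mulVec]
    congr 1
    funext l
    simp only [Matrix.mulVec, dotProduct, Matrix.of_apply, mul_assoc]
  have hK0 : ∀ z, (K z).det ≠ 0 := by
    intro z h0
    obtain ⟨y, hy, hKy⟩ := Matrix.exists_mulVec_eq_zero_iff.2 h0
    rw [hKmul, sub_eq_zero] at hKy
    exact hy (eq_zero_of_contraction_fixed hD idx z hKy)
  have hKH : ∀ l k, IsHolo fun z => K z l k := fun l k =>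
    (isHolo_const _).add ((isHolo_const _).mul (isHolo_coord _))
  have hNH : ∀ l k, IsHolo fun z => (K z)⁻¹ l k := IsHolo.matrix_inv hKH hK0
  -- The state `g = (1 - D Z)⁻¹ C ω` satisfies `U (ω, Z g) = (φ, g)`. Contractivity of `U` and `‖Z
  -- g‖ ≤ ‖g‖` then give `∑ |φ n|² ≤ |ω|²`.
  let g : ι → bidisc → ℂ := fun l z => ∑ k, (K z)⁻¹ l k * (U (Sum.inr k) (Sum.inl ()) * ω)
  have hg : ∀ l, IsHolo (g l) := fun l => IsHolo.sum fun k _ => (hNH l k).mul (isHolo_const _)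
  have hgeq : ∀ l z, g l z = U (Sum.inr l) (Sum.inl ()) * ω +
      ∑ k, U (Sum.inr l) (Sum.inr k) * (z.1 (idx k) * g k z) := by
    intro l z
    have h1 : (fun l => g l z) = (K z)⁻¹ *ᵥ fun k => U (Sum.inr k) (Sum.inl ()) * ω := rfl
    have h2 : K z *ᵥ (fun l => g l z) = fun k => U (Sum.inr k) (Sum.inl ()) * ω := by
      rw [h1, Matrix.mulVec_mulVec, Matrix.mul_nonsing_inv _ (isUnit_iff_ne_zero.2 (hK0 z)),
        Matrix.one_mulVec]
    rw [hKmul, sub_eq_iff_eq_add] at h2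
    exact congrFun h2 l
  let φ : ν → bidisc → ℂ := fun n z => U (Sum.inl n) (Sum.inl ()) * ω +
    ∑ k, U (Sum.inl n) (Sum.inr k) * (z.1 (idx k) * g k z)
  have hφ : ∀ n, IsHolo (φ n) := fun n => (isHolo_const _).add
    (IsHolo.sum fun k _ => (isHolo_const _).mul ((isHolo_coord _).mul (hg k)))
  refine ⟨φ, hφ, fun z => ?_, fun m M hM X hX n => ?_⟩
  · have h := hU (Sum.elim (fun _ => ω) fun k => z.1 (idx k) * g k z)
    simp only [Fintype.sum_sum_type, Matrix.mulVec, dotProduct, Sum.elim_inl, Sum.elim_inr,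
      Finset.univ_unique, Finset.sum_singleton] at h
    have e1 : ∑ l, ‖U (Sum.inr l) (Sum.inl ()) * ω +
        ∑ k, U (Sum.inr l) (Sum.inr k) * (z.1 (idx k) * g k z)‖ ^ 2 = ∑ l, ‖g l z‖ ^ 2 :=
      Finset.sum_congr rfl fun l _ => by rw [← hgeq]
    have e2 : ∑ k, ‖z.1 (idx k) * g k z‖ ^ 2 ≤ ∑ k, ‖g k z‖ ^ 2 := by
      refine Finset.sum_le_sum fun k _ => ?_
      rw [norm_mul]
      exact pow_le_pow_left₀ (by positivity)
        (mul_le_of_le_one_left (norm_nonneg _) (z.2 _).le) 2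
    change ∑ n, ‖φ n z‖ ^ 2 + ∑ l, ‖U (Sum.inr l) (Sum.inl ()) * ω +
        ∑ k, U (Sum.inr l) (Sum.inr k) * (z.1 (idx k) * g k z)‖ ^ 2 ≤ _ at h
    rw [e1] at h
    linarith
  · have hev : ∀ b, evalMat (fun z => U b (Sum.inl ()) * ω +
        ∑ k, U b (Sum.inr k) * (z.1 (idx k) * g k z)) M = (U b (Sum.inl ()) * ω) • 1 +
          ∑ k, U b (Sum.inr k) • (M (idx k) * evalMat (g k) M) := by
      intro b
      rw [hM.evalMat_add (isHolo_const _) (IsHolo.sum fun k _ => (isHolo_const _).mul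
        ((isHolo_coord _).mul (hg k))), hM.evalMat_const,
        hM.evalMat_sum _ (fun k _ => (isHolo_coord _).mul (hg k))]
      congr 1
      refine Finset.sum_congr rfl fun k _ => ?_
      rw [hM.evalMat_mul (isHolo_coord _) (hg k), hM.evalMat_coord]
    -- Applying the functional calculus entrywise to `K⁻¹ K = 1` gives a left inverse of the linear
    -- system at `M`. Its solution is therefore unique, and `X` must be the value of the
    -- realization.
    have hN : ∀ p k, ∑ l, evalMat (fun z => (K z)⁻¹ p l) M *
        ((1 : Matrix ι ι ℂ) l k • 1 + (-D l k) • M (idx k)) =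
          (1 : Matrix ι ι ℂ) p k • (1 : Matrix (Fin m) (Fin m) ℂ) := by
      intro p k
      have h1 : (fun z => ∑ l, 1 * ((K z)⁻¹ p l * K z l k)) =
          fun _ : bidisc => (1 : Matrix ι ι ℂ) p k := by
        funext z
        have := congrFun (congrFun (Matrix.nonsing_inv_mul (K z)
          (isUnit_iff_ne_zero.2 (hK0 z))) p) k
        simpa only [one_mul, Matrix.mul_apply] using this
      have h2 := hM.evalMat_sum Finset.univ (F := fun l z => (K z)⁻¹ p l * K z l k)
        (fun l _ => (hNH p l).mul (hKH l k)) fun _ => 1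
      rw [h1, hM.evalMat_const] at h2
      rw [h2]
      refine Finset.sum_congr rfl fun l _ => ?_
      rw [hM.evalMat_mul (hNH p l) (hKH l k), one_smul]
      congr 1
      rw [hM.evalMat_add (isHolo_const _) ((isHolo_const _).mul (isHolo_coord _)),
        hM.evalMat_const, hM.evalMat_const_mul (isHolo_coord _), hM.evalMat_coord]
    have hgM : ∀ l, evalMat (g l) M = (U (Sum.inr l) (Sum.inl ()) * ω) • 1 +
        ∑ k, U (Sum.inr l) (Sum.inr k) • (M (idx k) * evalMat (g k) M) := fun l => by
      rw [← hev, ← funext (hgeq l)]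
    let Y : ι → Matrix (Fin m) (Fin m) ℂ := fun l => evalMat (g l) M - X (Sum.inr l)
    have hY : ∀ l, ∑ k, ((1 : Matrix ι ι ℂ) l k • (1 : Matrix (Fin m) (Fin m) ℂ) +
        (-D l k) • M (idx k)) * Y k = 0 := by
      intro l
      have h1 : ∀ k, ((1 : Matrix ι ι ℂ) l k • (1 : Matrix (Fin m) (Fin m) ℂ) +
          (-D l k) • M (idx k)) * Y k =
          (if l = k then Y k else 0) - D l k • (M (idx k) * Y k) := by
        intro k
        rw [add_mul, smul_mul_assoc, smul_mul_assoc, one_mul, Matrix.one_apply, ite_smul, one_smul,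
          zero_smul, neg_smul, sub_eq_add_neg]
      rw [Finset.sum_congr rfl fun k _ => h1 k, Finset.sum_sub_distrib, Finset.sum_ite_eq,
        if_pos (Finset.mem_univ l), sub_eq_zero]
      simp only [Y, mul_sub, smul_sub, Finset.sum_sub_distrib]
      conv_lhs => rw [hgM l, hX (Sum.inr l)]
      simp only [add_sub_add_left_eq_sub, D]
    have hY0 : ∀ p, Y p = 0 := by
      intro p
      have h1 : Y p = ∑ k, ((1 : Matrix ι ι ℂ) p k • (1 : Matrix (Fin m) (Fin m) ℂ)) * Y k := by
        simp [Matrix.one_apply]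
      rw [h1]
      rw [Finset.sum_congr rfl fun k _ => by rw [← hN p k, Finset.sum_mul], Finset.sum_comm]
      refine Finset.sum_eq_zero fun l _ => ?_
      simp only [mul_assoc]
      rw [← Finset.mul_sum, hY, mul_zero]
    rw [show evalMat (φ n) M = _ from hev (Sum.inl n), hX (Sum.inl n)]
    simp only [sub_eq_zero.1 (hY0 _)]

end Realization

/-! ### The cone of Agler decompositions. -/

section AglerCone

open Matrix
open scoped ComplexOrder

/-- The square of the Euclidean norm. -/
noncomputable def euclSq {κ : Type*} [Fintype κ] (v : κ → ℂ) : ℝ := ∑ a, ‖v a‖ ^ 2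

/-- The square of the Frobenius norm. -/
noncomputable def frobSq {κ κ' : Type*} [Fintype κ] [Fintype κ'] (X : Matrix κ κ' ℂ) : ℝ :=
  ∑ a, ∑ b, ‖X a b‖ ^ 2

lemma euclSq_pos {κ : Type*} [Fintype κ] {v : κ → ℂ} (hv : v ≠ 0) : 0 < euclSq v := by
  obtain ⟨a, ha⟩ := Function.ne_iff.1 hv
  exact Finset.sum_pos' (fun _ _ => by positivity)
    ⟨a, Finset.mem_univ a, by have := norm_pos_iff.2 ha; positivity⟩

lemma frobSq_nonneg {κ κ' : Type*} [Fintype κ] [Fintype κ'] (X : Matrix κ κ' ℂ) : 0 ≤ frobSq X := by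
  unfold frobSq; positivity

variable {κ : Type*} [Fintype κ]

lemma trace_mul_conjTranspose_re (X : Matrix κ κ ℂ) : (X * Xᴴ).trace.re = frobSq X := by
  simp only [Matrix.trace, Matrix.diag_apply, Matrix.mul_apply, Matrix.conjTranspose_apply,
    Complex.re_sum, frobSq]
  refine Finset.sum_congr rfl fun a _ => Finset.sum_congr rfl fun b _ => ?_
  rw [Complex.star_def, Complex.mul_conj, Complex.ofReal_re, Complex.normSq_eq_norm_sq]

lemma frobSq_mul_le (X Y : Matrix κ κ ℂ) : frobSq (X * Y) ≤ frobSq X * frobSq Y := by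
  have h : ∀ a b, ‖(X * Y) a b‖ ^ 2 ≤ (∑ c, ‖X a c‖ ^ 2) * ∑ c, ‖Y c b‖ ^ 2 := fun a b => by
    rw [Matrix.mul_apply]
    refine le_trans (pow_le_pow_left₀ (norm_nonneg _) (norm_sum_le _ _) 2) ?_
    simp only [norm_mul]
    exact Finset.sum_mul_sq_le_sq_mul_sq _ _ _
  calc frobSq (X * Y) ≤ ∑ a, ∑ b, (∑ c, ‖X a c‖ ^ 2) * ∑ c, ‖Y c b‖ ^ 2 :=
        Finset.sum_le_sum fun a _ => Finset.sum_le_sum fun b _ => h a b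
    _ = frobSq X * ∑ b, ∑ c, ‖Y c b‖ ^ 2 := by
        rw [frobSq, Finset.sum_mul]
        exact Finset.sum_congr rfl fun a _ => (Finset.mul_sum _ _ _).symm
    _ = _ := by rw [Finset.sum_comm]; rfl

lemma continuous_frobSq : Continuous (frobSq : Matrix κ κ ℂ → ℝ) := by
  unfold frobSq; fun_prop

/-- Positive semidefinite matrices are of the form `G * Gᴴ`. -/
lemma Matrix.PosSemidef.exists_eq_mul_conjTranspose [DecidableEq κ] {Q : Matrix κ κ ℂ}
    (hQ : Q.PosSemidef) : ∃ G : Matrix κ κ ℂ, Q = G * Gᴴ := by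
  obtain ⟨B, hB⟩ : ∃ B : Matrix κ κ ℂ, Q = star B * B := by
    open scoped MatrixOrder Matrix.Norms.L2Operator in
    exact CStarAlgebra.nonneg_iff_eq_star_mul_self.mp hQ.nonneg
  exact ⟨Bᴴ, by rw [hB, Matrix.conjTranspose_conjTranspose, Matrix.star_eq_conjTranspose]⟩

/-- The defect `Γ - L Γ Lᴴ`, summed over two positive semidefinite matrices. -/
noncomputable def aglerDefect (L : Fin 2 → Matrix κ κ ℂ) (G : Fin 2 → Matrix κ κ ℂ) :
    Matrix κ κ ℂ := ∑ i, (G i * (G i)ᴴ - L i * G i * (L i * G i)ᴴ)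

lemma continuous_aglerDefect (L : Fin 2 → Matrix κ κ ℂ) : Continuous (aglerDefect L) := by
  unfold aglerDefect; fun_prop

variable {L : Fin 2 → Matrix κ κ ℂ}

lemma aglerDefect_smul (t : ℝ) (G : Fin 2 → Matrix κ κ ℂ) :
    aglerDefect L ((t : ℂ) • G) = (t ^ 2 : ℝ) • aglerDefect L G := by
  simp only [aglerDefect, Finset.smul_sum, Pi.smul_apply, Matrix.conjTranspose_smul,
    Matrix.mul_smul, Matrix.smul_mul, smul_smul, smul_sub]
  refine Finset.sum_congr rfl fun i _ => ?_
  have h : star (t : ℂ) * (t : ℂ) = ((t ^ 2 : ℝ) : ℂ) := by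
    rw [Complex.star_def, Complex.conj_ofReal]; push_cast; ring
  rw [h, Complex.coe_smul, Complex.coe_smul]

/-- The base of the cone of the matrices `aglerDefect L G`. -/
def aglerBase (L : Fin 2 → Matrix κ κ ℂ) : Set (Matrix κ κ ℂ) :=
  aglerDefect L '' {G | ∑ i, frobSq (G i) = 1}

lemma isCompact_aglerBase : IsCompact (aglerBase L) := by
  refine IsCompact.image ?_ (continuous_aglerDefect L)
  have hc : IsCompact (Set.univ.pi fun _ : Fin 2 => (Set.univ.pi fun _ : κ => Set.univ.pi fun _ : κ =>
      Metric.closedBall (0 : ℂ) 1 : Set (Matrix κ κ ℂ))) :=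
    isCompact_univ_pi fun _ => isCompact_univ_pi fun _ => isCompact_univ_pi fun _ =>
      isCompact_closedBall 0 1
  refine hc.of_isClosed_subset (isClosed_eq ?_ continuous_const) fun G hG i _ a _ b _ => ?_
  · exact continuous_finsetSum _ fun i _ => continuous_frobSq.comp (continuous_apply i)
  · rw [mem_closedBall_zero_iff]
    have h1 : ‖G i a b‖ ^ 2 ≤ 1 := by
      rw [← show ∑ i, frobSq (G i) = 1 from hG]
      refine le_trans ?_ (Finset.single_le_sum (f := fun i => frobSq (G i))
        (fun i _ => frobSq_nonneg _) (Finset.mem_univ i))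
      refine le_trans ?_ (Finset.single_le_sum (f := fun a => ∑ b, ‖G i a b‖ ^ 2)
        (fun a _ => by positivity) (Finset.mem_univ a))
      exact Finset.single_le_sum (f := fun b => ‖G i a b‖ ^ 2)
        (fun a _ => by positivity) (Finset.mem_univ b)
    exact (sq_le_one_iff₀ (norm_nonneg _)).1 h1

/-- Defect and normalization depend only on the positive matrices `G i * (G i)ᴴ`, linearly; a convex
combination of these factors again. -/
lemma convex_aglerBase [DecidableEq κ] : Convex ℝ (aglerBase L) := by
  rintro _ ⟨G, hG, rfl⟩ _ ⟨G', hG', rfl⟩ a b ha hb hab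
  have hpsd : ∀ i, ((a : ℂ) • (G i * (G i)ᴴ) + (b : ℂ) • (G' i * (G' i)ᴴ)).PosSemidef := fun i =>
    ((Matrix.posSemidef_self_mul_conjTranspose _).smul (by exact_mod_cast ha)).add
      ((Matrix.posSemidef_self_mul_conjTranspose _).smul (by exact_mod_cast hb))
  choose H hH using fun i => (hpsd i).exists_eq_mul_conjTranspose
  refine ⟨H, ?_, ?_⟩
  · have h : ∀ i, frobSq (H i) = a * frobSq (G i) + b * frobSq (G' i) := fun i => by
      simp only [← trace_mul_conjTranspose_re]
      rw [← hH, Matrix.trace_add, Matrix.trace_smul, Matrix.trace_smul]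
      simp
    simp only [Set.mem_ofPred_eq, h, Finset.sum_add_distrib, ← Finset.mul_sum] at hG hG' ⊢
    rw [hG, hG', mul_one, mul_one, hab]
  · have hc : ∀ i (X : Matrix κ κ ℂ), L i * X * (L i * X)ᴴ = L i * (X * Xᴴ) * (L i)ᴴ := fun i X => by
      rw [Matrix.conjTranspose_mul]; simp only [Matrix.mul_assoc]
    simp only [aglerDefect, hc, ← hH, Finset.smul_sum, ← Finset.sum_add_distrib]
    refine Finset.sum_congr rfl fun i _ => ?_
    simp only [← Complex.coe_smul, Matrix.mul_add, Matrix.add_mul, Matrix.mul_smul,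
      Matrix.smul_mul, smul_sub]
    abel

/-- A vanishing defect is a conservation law on the grid of powers of `L 0` and `L 1`; as these
powers tend to zero, the total mass would have to vanish. -/
lemma zero_notMem_aglerBase [DecidableEq κ] (hcomm : L 0 * L 1 = L 1 * L 0)
    (hL : ∀ i, Tendsto (fun n => L i ^ n) atTop (𝓝 0)) : (0 : Matrix κ κ ℂ) ∉ aglerBase L := by
  rintro ⟨G, hG, h0⟩
  -- The trace of `P * aglerDefect L G * Pᴴ`, expressed by Frobenius norms.
  have hP : ∀ P : Matrix κ κ ℂ, ∑ i, (frobSq (P * G i) - frobSq (P * (L i * G i))) = 0 := by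
    intro P
    have h1 : ((P * aglerDefect L G * Pᴴ).trace).re = 0 := by rw [h0]; simp
    rw [← h1, aglerDefect, Finset.mul_sum, Finset.sum_mul, Matrix.trace_sum, Complex.re_sum]
    refine Finset.sum_congr rfl fun i _ => ?_
    rw [← trace_mul_conjTranspose_re, ← trace_mul_conjTranspose_re, ← Complex.sub_re,
      ← Matrix.trace_sub, Matrix.mul_sub, Matrix.sub_mul, Matrix.conjTranspose_mul P,
      Matrix.conjTranspose_mul P]
    simp only [Matrix.mul_assoc]
  obtain ⟨J, hJ0, hJ⟩ : ∃ J, 0 < J ∧ ∀ i, frobSq (L i ^ J) ≤ 1 / 2 := by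
    have h1 : ∀ i, Tendsto (fun n => frobSq (L i ^ n)) atTop (𝓝 0) := fun i => by
      have := (continuous_frobSq.tendsto (0 : Matrix κ κ ℂ)).comp (hL i)
      rwa [show frobSq (0 : Matrix κ κ ℂ) = 0 by simp [frobSq]] at this
    have h2 : ∀ᶠ n in atTop, ∀ i, frobSq (L i ^ n) ≤ 1 / 2 := eventually_all.2 fun i =>
      (h1 i).eventually_le_const (by norm_num)
    obtain ⟨J, h3, h4⟩ := (h2.and (eventually_gt_atTop 0)).exists
    exact ⟨J, h4, h3⟩
  have hcommp : ∀ j k, L 1 ^ k * L 0 ^ j = L 0 ^ j * L 1 ^ k := fun j k =>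
    ((show Commute (L 0) (L 1) from hcomm).pow_pow j k).symm.eq
  let S : Fin 2 → ℕ → ℕ → ℝ := fun i j k => frobSq (L 0 ^ j * (L 1 ^ k * G i))
  have hrec : ∀ j k, S 0 j k + S 1 j k = S 0 (j + 1) k + S 1 j (k + 1) := by
    intro j k
    have h1 := hP (L 0 ^ j * L 1 ^ k)
    have e0 : L 0 ^ j * L 1 ^ k * (L 0 * G 0) = L 0 ^ (j + 1) * (L 1 ^ k * G 0) := by
      have h2 := hcommp 1 k
      rw [pow_one] at h2
      calc _ = L 0 ^ j * (L 1 ^ k * L 0) * G 0 := by simp only [Matrix.mul_assoc]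
        _ = _ := by rw [h2, pow_succ]; simp only [Matrix.mul_assoc]
    have e1 : L 0 ^ j * L 1 ^ k * (L 1 * G 1) = L 0 ^ j * (L 1 ^ (k + 1) * G 1) := by
      rw [pow_succ]; simp only [Matrix.mul_assoc]
    rw [Fin.sum_univ_two, e0, e1, Matrix.mul_assoc, Matrix.mul_assoc] at h1
    simp only [S]
    linarith
  have hS : ∀ i j k, 0 ≤ S i j k := fun i j k => frobSq_nonneg _
  have hS0 : ∀ k, S 0 J k ≤ 1 / 2 * S 0 0 k := fun k => by
    simp only [S, pow_zero, Matrix.one_mul]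
    exact (frobSq_mul_le _ _).trans (mul_le_mul_of_nonneg_right (hJ 0) (frobSq_nonneg _))
  have hS1 : ∀ j, S 1 j J ≤ 1 / 2 * S 1 j 0 := fun j => by
    simp only [S, pow_zero, Matrix.one_mul]
    rw [← Matrix.mul_assoc, ← hcommp, Matrix.mul_assoc]
    exact (frobSq_mul_le _ _).trans (mul_le_mul_of_nonneg_right (hJ 1) (frobSq_nonneg _))
  -- Over a `J × J` square, `S 0` telescopes in `j` and `S 1` in `k`. The choice of `J` makes every
  -- boundary difference at least half of its first term, so those at the origin must be zero.
  have hsum : ∑ k ∈ Finset.range J, (S 0 0 k - S 0 J k) +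
      ∑ j ∈ Finset.range J, (S 1 j 0 - S 1 j J) = 0 := by
    have h1 : ∀ k, ∑ j ∈ Finset.range J, (S 0 j k - S 0 (j + 1) k) = S 0 0 k - S 0 J k := fun k =>
      Finset.sum_range_sub' (fun j => S 0 j k) J
    have h2 : ∀ j, ∑ k ∈ Finset.range J, (S 1 j k - S 1 j (k + 1)) = S 1 j 0 - S 1 j J := fun j =>
      Finset.sum_range_sub' (fun k => S 1 j k) J
    simp only [← h1, ← h2]
    rw [Finset.sum_comm, ← Finset.sum_add_distrib]
    refine Finset.sum_eq_zero fun j _ => ?_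
    rw [← Finset.sum_add_distrib]
    exact Finset.sum_eq_zero fun k _ => by linarith [hrec j k]
  have hz : ∀ u : ℕ → ℝ, ∀ v : ℕ → ℝ, (∀ k, 0 ≤ u k) → (∀ k, v k ≤ 1 / 2 * u k) →
      1 / 2 * u 0 ≤ ∑ k ∈ Finset.range J, (u k - v k) := by
    intro u v hu hv
    refine le_trans ?_ (Finset.single_le_sum (f := fun k => u k - v k) (fun k _ => ?_)
      (Finset.mem_range.2 hJ0))
    · linarith [hv 0]
    · linarith [hv k, hu k]
  have h3 := hz _ _ (hS 0 0) hS0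
  have h4 := hz (fun j => S 1 j 0) _ (fun j => hS 1 j 0) hS1
  have h5 : ∑ i, frobSq (G i) = S 0 0 0 + S 1 0 0 := by
    simp [S, Fin.sum_univ_two]
  have h6 : ∑ i, frobSq (G i) = 1 := hG
  linarith

end AglerCone

/-! ### Existence of Agler decompositions by duality. -/

section AglerDecomposition

open Matrix
open scoped ComplexOrder

variable {κ : Type*}

/-- The rank one matrix `v vᴴ`. -/
def rankOneMat (v : κ → ℂ) : Matrix κ κ ℂ := Matrix.vecMulVec v (star v)

lemma mul_rankOneMat_mul [Fintype κ] (P : Matrix κ κ ℂ) (v : κ → ℂ) :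
    P * rankOneMat v * Pᴴ = rankOneMat (P *ᵥ v) := by
  rw [rankOneMat, rankOneMat, Matrix.mul_vecMulVec, Matrix.vecMulVec_mul, Matrix.star_mulVec]

lemma continuous_rankOneMat : Continuous (rankOneMat : (κ → ℂ) → Matrix κ κ ℂ) := by
  refine continuous_matrix fun a b => ?_
  simp only [rankOneMat, Matrix.vecMulVec_apply, Pi.star_apply]
  fun_prop

variable [Fintype κ]

/-- A complex linear functional on matrices gives a Hermitian form. -/
lemma exists_isHermitian_of_functional [DecidableEq κ] (f : Matrix κ κ ℂ →ₗ[ℂ] ℂ) :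
    ∃ Q : Matrix κ κ ℂ, Q.IsHermitian ∧
      ∀ v : κ → ℂ, star v ⬝ᵥ Q *ᵥ v = ((f (rankOneMat v)).re : ℂ) := by
  let Q₀ : Matrix κ κ ℂ := Matrix.of fun b a => f (Matrix.single a b 1)
  have h0 : ∀ v, star v ⬝ᵥ Q₀ *ᵥ v = f (rankOneMat v) := by
    intro v
    conv_rhs => rw [Matrix.matrix_eq_sum_single (rankOneMat v), map_sum]
    simp only [map_sum, dotProduct, Matrix.mulVec, Finset.mul_sum]
    rw [Finset.sum_comm]
    refine Finset.sum_congr rfl fun a _ => Finset.sum_congr rfl fun b _ => ?_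
    have : Matrix.single a b (rankOneMat v a b) = (rankOneMat v a b) • Matrix.single a b 1 := by
      rw [Matrix.smul_single, smul_eq_mul, mul_one]
    rw [this, map_smul, rankOneMat, Matrix.vecMulVec_apply, smul_eq_mul]
    simp only [Q₀, Matrix.of_apply]; ring
  have h1 : ∀ v, star v ⬝ᵥ Q₀ᴴ *ᵥ v = star (f (rankOneMat v)) := by
    intro v
    rw [← h0, Matrix.star_dotProduct, Matrix.star_mulVec, Matrix.conjTranspose_conjTranspose,
      ← Matrix.dotProduct_mulVec]
  refine ⟨(1 / 2 : ℂ) • (Q₀ + Q₀ᴴ), ?_, fun v => ?_⟩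
  · rw [Matrix.IsHermitian, Matrix.conjTranspose_smul, Matrix.conjTranspose_add,
      Matrix.conjTranspose_conjTranspose, add_comm]
    simp
  · rw [Matrix.smul_mulVec, Matrix.add_mulVec, dotProduct_smul, dotProduct_add, h0, h1,
      Complex.star_def, Complex.add_conj]
    simp

lemma euclSq_mulVec (S : Matrix κ κ ℂ) (v : κ → ℂ) :
    star v ⬝ᵥ (Sᴴ * S) *ᵥ v = (euclSq (S *ᵥ v) : ℂ) := by
  rw [← Matrix.mulVec_mulVec, Matrix.dotProduct_mulVec, ← Matrix.star_mulVec]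
  simp only [dotProduct, euclSq, Pi.star_apply]
  push_cast
  exact Finset.sum_congr rfl fun a _ => by rw [Complex.star_def, Complex.conj_mul']

variable {L : Fin 2 → Matrix κ κ ℂ}

/-- The multiples of `v vᴴ - (L v) (L v)ᴴ` in the cone. -/
lemma smul_rankOneMat_sub_mem_aglerBase [DecidableEq κ] (i : Fin 2) {v : κ → ℂ} (hv : v ≠ 0) :
    (euclSq v)⁻¹ • (rankOneMat v - rankOneMat (L i *ᵥ v)) ∈ aglerBase L := by
  obtain ⟨a₀, -⟩ := Function.ne_iff.1 hv
  have hpos := euclSq_pos hv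
  let t : ℝ := (√(euclSq v))⁻¹
  have ht : t ^ 2 = (euclSq v)⁻¹ := by simp only [t, inv_pow, Real.sq_sqrt hpos.le]
  -- The cone uses square factors, so `v vᴴ` is realized by placing `v` in a single column.
  let G : Matrix κ κ ℂ := Matrix.vecMulVec v (Pi.single a₀ 1)
  have hG : G * Gᴴ = rankOneMat v := by
    simp only [G, rankOneMat, Matrix.conjTranspose_vecMulVec]
    rw [Matrix.vecMulVec_mul_vecMulVec]
    simp
  have hLG : ∀ P : Matrix κ κ ℂ, P * G * (P * G)ᴴ = rankOneMat (P *ᵥ v) := fun P => by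
    rw [← mul_rankOneMat_mul, ← hG, Matrix.conjTranspose_mul]; simp only [Matrix.mul_assoc]
  refine ⟨(t : ℂ) • Pi.single i G, ?_, ?_⟩
  · have h1 : ∀ j, frobSq (((t : ℂ) • (Pi.single i G : Fin 2 → Matrix κ κ ℂ)) j) =
        if j = i then 1 else 0 := by
      intro j
      rcases eq_or_ne j i with rfl | hj
      · rw [if_pos rfl, ← trace_mul_conjTranspose_re, Pi.smul_apply, Pi.single_eq_same,
          Matrix.conjTranspose_smul, Matrix.smul_mul, Matrix.mul_smul, hG, smul_smul,
          Matrix.trace_smul]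
        have h2 : (rankOneMat v).trace = (euclSq v : ℂ) := by
          simp only [Matrix.trace, Matrix.diag_apply, rankOneMat, Matrix.vecMulVec_apply,
            Pi.star_apply, euclSq, Complex.star_def, Complex.mul_conj']
          push_cast; rfl
        rw [h2, Complex.star_def, Complex.conj_ofReal, smul_eq_mul, ← Complex.ofReal_mul,
          ← Complex.ofReal_mul, Complex.ofReal_re, ← sq, ht, inv_mul_cancel₀ hpos.ne']
      · rw [if_neg hj, Pi.smul_apply, Pi.single_eq_of_ne hj, smul_zero]
        simp [frobSq]
    exact (Finset.sum_congr rfl fun j _ => h1 j).trans (by simp)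
  · rw [aglerDefect_smul, ht, aglerDefect, Finset.sum_eq_single i]
    · rw [Pi.single_eq_same, hG, hLG]
    · intro j _ hj; rw [Pi.single_eq_of_ne hj]; simp
    · simp

/-- The dual form of the cone condition. -/
theorem exists_agler_decomposition [DecidableEq κ] {ν : Type*} [Fintype ν]
    (hcomm : L 0 * L 1 = L 1 * L 0) (hL : ∀ i, Tendsto (fun n => L i ^ n) atTop (𝓝 0))
    {e : κ → ℂ} (he : e ≠ 0) (p : ν → κ → ℂ) {c₀ c : ℝ} (hc : c₀ < c)
    (h : ∀ S : Matrix κ κ ℂ, (∀ i v, euclSq (S *ᵥ (L i *ᵥ v)) ≤ euclSq (S *ᵥ v)) →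
      ∑ n, euclSq (S *ᵥ p n) ≤ c₀ * euclSq (S *ᵥ e)) :
    ∃ G : Fin 2 → Matrix κ κ ℂ,
      c • rankOneMat e - ∑ n, rankOneMat (p n) = aglerDefect L G := by
  set R : Matrix κ κ ℂ := c • rankOneMat e - ∑ n, rankOneMat (p n) with hR
  by_contra hcon
  -- Separating the compact base from the ray through `R` avoids proving that the cone itself is
  -- closed. Since `0` is not in the base, a common point has `t > 0`, and division by `t` would put
  -- `R` in the cone.
  have hdisj : Disjoint (aglerBase L) ((fun t : ℝ => t • R) '' Set.Ici 0) := by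
    rw [Set.disjoint_left]
    rintro _ ⟨G, hG, rfl⟩ ⟨t, ht, htG⟩
    have ht0 : t ≠ 0 := by
      rintro rfl
      exact zero_notMem_aglerBase hcomm hL ⟨G, hG, by rw [← htG]; simp⟩
    have htpos : 0 < t := lt_of_le_of_ne ht ht0.symm
    refine hcon ⟨((√t)⁻¹ : ℝ) • G, ?_⟩
    have h1 := aglerDefect_smul (L := L) (√t)⁻¹ G
    rw [inv_pow, Real.sq_sqrt htpos.le, ← htG] at h1
    simp only at h1
    rw [smul_smul, inv_mul_cancel₀ ht0, one_smul] at h1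
    rw [← h1, Complex.coe_smul]
  have : LocallyConvexSpace ℝ (Matrix κ κ ℂ) :=
    inferInstanceAs (LocallyConvexSpace ℝ (κ → κ → ℂ))
  obtain ⟨f, u, w, hfu, huw, hfw⟩ := RCLike.geometric_hahn_banach_compact_closed (𝕜 := ℂ)
    convex_aglerBase isCompact_aglerBase
    (show Convex ℝ ((fun t : ℝ => t • R) '' Set.Ici 0) from
      (convex_Ici 0).linear_image (LinearMap.toSpanSingleton ℝ _ R))
    (isClosedMap_smul_left (𝕜 := ℝ) R _ isClosed_Ici) hdisj
  simp only [RCLike.re_to_complex] at hfu hfw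
  have hw0 : w < 0 := by simpa using hfw _ ⟨0, Set.mem_Ici.2 le_rfl, rfl⟩
  -- The real part of `f` is bounded below on the whole ray.
  have hRf : 0 ≤ (f R).re := by
    by_contra! hneg
    have h1 := hfw _ ⟨w / (f R).re, Set.mem_Ici.2 (div_nonneg_of_nonpos hw0.le hneg.le), rfl⟩
    simp only [← Complex.coe_smul, map_smul, smul_eq_mul, Complex.re_ofReal_mul] at h1
    rw [div_mul_cancel₀ _ hneg.ne] at h1
    exact lt_irrefl _ h1
  obtain ⟨Q, hQH, hQ⟩ := exists_isHermitian_of_functional (-f : Matrix κ κ ℂ →L[ℂ] ℂ).toLinearMap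
  let q : (κ → ℂ) → ℝ := fun v => -(f (rankOneMat v)).re
  have hQ' : ∀ v, star v ⬝ᵥ Q *ᵥ v = (q v : ℂ) := fun v => by rw [hQ]; simp [q]
  have hq0 : q 0 = 0 := by
    have : rankOneMat (0 : κ → ℂ) = 0 := by simp [rankOneMat]
    simp [q, this]
  have hdec : ∀ i v, v ≠ 0 → q (L i *ᵥ v) < q v := by
    intro i v hv
    have h1 := hfu _ (smul_rankOneMat_sub_mem_aglerBase (L := L) i hv)
    rw [← Complex.coe_smul, map_smul, map_sub, smul_eq_mul, Complex.re_ofReal_mul,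
      Complex.sub_re] at h1
    have h2 : (euclSq v)⁻¹ * ((f (rankOneMat v)).re - (f (rankOneMat (L i *ᵥ v))).re) < 0 :=
      h1.trans (huw.trans hw0)
    have h3 := inv_pos.2 (euclSq_pos hv)
    simp only [q]
    nlinarith
  have hdec' : ∀ i v, q (L i *ᵥ v) ≤ q v := by
    intro i v
    rcases eq_or_ne v 0 with rfl | hv
    · rw [Matrix.mulVec_zero]
    · exact (hdec i v hv).le
  have hqc : Continuous q :=
    (Complex.continuous_re.comp (f.continuous.comp continuous_rankOneMat)).neg
  -- The form decreases along `L 0 ^ n` applied to `v`, which tends to zero.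
  have hqnn : ∀ v, 0 ≤ q v := by
    intro v
    have h1 : ∀ n, q ((L 0 ^ n) *ᵥ v) ≤ q v := by
      intro n
      induction n with
      | zero => simp
      | succ n ih =>
        rw [pow_succ', ← Matrix.mulVec_mulVec]
        exact (hdec' 0 _).trans ih
    have h2 : Tendsto (fun n => (L 0 ^ n) *ᵥ v) atTop (𝓝 0) := by
      have h3 : Continuous fun P : Matrix κ κ ℂ => P *ᵥ v := by fun_prop
      simpa [Function.comp_def] using (h3.tendsto 0).comp (hL 0)
    have h3 := (hqc.tendsto 0).comp h2
    rw [hq0] at h3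
    exact le_of_tendsto' h3 h1
  have hqe : 0 < q e := (hqnn _).trans_lt (hdec 0 e he)
  have hpsd : Q.PosSemidef := Matrix.PosSemidef.of_dotProduct_mulVec_nonneg hQH fun v => by
    rw [hQ']; exact_mod_cast hqnn v
  obtain ⟨S, hS⟩ := hpsd.exists_eq_mul_conjTranspose
  have hSq : ∀ v, euclSq (Sᴴ *ᵥ v) = q v := fun v => by
    have h1 := euclSq_mulVec Sᴴ v
    rw [Matrix.conjTranspose_conjTranspose, ← hS, hQ'] at h1
    exact_mod_cast h1.symm
  have h1 := h Sᴴ fun i v => by rw [hSq, hSq]; exact hdec' i v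
  simp only [hSq] at h1
  -- With `q e > 0` and `c₀ < c`, the hypothesis makes this negative, against `hRf`.
  have h2 : (f R).re = ∑ n, q (p n) - c * q e := by
    rw [hR, map_sub, map_sum, ← Complex.coe_smul, map_smul, smul_eq_mul, Complex.sub_re,
      Complex.re_ofReal_mul, Complex.re_sum]
    simp only [q, Finset.sum_neg_distrib]; ring
  nlinarith

end AglerDecomposition

/-! ### The lurking isometry. -/

section LurkingIsometry

open Matrix

/-- The coefficients `star (Z a) ⬝ᵥ x` of a vector. -/
noncomputable def analysisMap {κ δ : Type*} [Fintype κ] [Fintype δ] (Z : δ → κ → ℂ) :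
    EuclideanSpace ℂ κ →ₗ[ℂ] EuclideanSpace ℂ δ where
  toFun x := WithLp.toLp 2 fun a => star (Z a) ⬝ᵥ x.ofLp
  map_add' x y := by ext a; simp [dotProduct_add]
  map_smul' c x := by ext a; simp [dotProduct_smul]

lemma norm_sq_analysisMap {κ δ : Type*} [Fintype κ] [Fintype δ] (Z : δ → κ → ℂ)
    (x : EuclideanSpace ℂ κ) : ((‖analysisMap Z x‖ ^ 2 : ℝ) : ℂ) =
      star x.ofLp ⬝ᵥ (∑ a, rankOneMat (Z a)) *ᵥ x.ofLp := by
  rw [EuclideanSpace.norm_sq_eq, Matrix.sum_mulVec, dotProduct_sum]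
  push_cast
  refine Finset.sum_congr rfl fun a _ => ?_
  rw [rankOneMat, Matrix.vecMulVec_mulVec, dotProduct_smul]
  change ((‖star (Z a) ⬝ᵥ x.ofLp‖ : ℂ)) ^ 2 = _
  rw [← Complex.conj_mul', ← Complex.star_def, Matrix.star_dotProduct, star_star]
  simp

/-- Families of vectors with the same sum `∑ X Xᴴ` are related by a contraction. -/
lemma exists_contraction_of_sum_rankOneMat_eq {κ α β : Type*} [Fintype κ] [Fintype α] [Fintype β]
    (X : α → κ → ℂ) (Y : β → κ → ℂ) (h : ∑ a, rankOneMat (X a) = ∑ b, rankOneMat (Y b)) :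
    ∃ U : Matrix β α ℂ, (∀ y, ∑ b, ‖(U *ᵥ y) b‖ ^ 2 ≤ ∑ a, ‖y a‖ ^ 2) ∧
      ∀ b, Y b = ∑ a, U b a • X a := by
  classical
  have hn : ∀ x, ‖analysisMap X x‖ = ‖analysisMap Y x‖ := by
    intro x
    have h1 : ‖analysisMap X x‖ ^ 2 = ‖analysisMap Y x‖ ^ 2 := by
      have := (norm_sq_analysisMap X x).trans (h ▸ (norm_sq_analysisMap Y x).symm)
      exact_mod_cast this
    exact (sq_eq_sq₀ (norm_nonneg _) (norm_nonneg _)).1 h1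
  obtain ⟨u, hu, hc, -, -⟩ := exists_partialIsometry (analysisMap X) (analysisMap Y) hn
  have hu' : ∀ (y : EuclideanSpace ℂ α) b,
      u y b = ∑ a, y a * u (EuclideanSpace.single a 1) b := by
    intro y b
    conv_lhs => rw [← (EuclideanSpace.basisFun α ℂ).sum_repr y]
    simp
  -- The analysis maps pair with the conjugated vectors, so the vectors themselves are related by
  -- the conjugated matrix; conjugation preserves contractivity.
  refine ⟨Matrix.of fun b a => star (u (EuclideanSpace.single a 1) b), fun y => ?_, fun b => ?_⟩
  · have h1 := pow_le_pow_left₀ (norm_nonneg _) (hc (WithLp.toLp 2 (star y))) 2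
    rw [EuclideanSpace.norm_sq_eq, EuclideanSpace.norm_sq_eq] at h1
    simp only [Pi.star_apply, norm_star] at h1
    refine le_trans (le_of_eq (Finset.sum_congr rfl fun b _ => ?_)) h1
    rw [hu', ← norm_star]
    simp only [Matrix.mulVec, dotProduct, Matrix.of_apply, star_sum, star_mul', star_star,
      Pi.star_apply]
    simp only [mul_comm]
  · funext k
    have h1 : ∀ a, analysisMap X (EuclideanSpace.single k 1) a = star (X a k) := fun a => by
      change star (X a) ⬝ᵥ (Pi.single k 1 : κ → ℂ) = _
      simp
    have h2 : analysisMap Y (EuclideanSpace.single k 1) b = star (Y b k) := by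
      change star (Y b) ⬝ᵥ (Pi.single k 1 : κ → ℂ) = _
      simp
    rw [← star_star (Y b k), ← h2, ← hu, hu', star_sum, Finset.sum_apply]
    refine Finset.sum_congr rfl fun a _ => ?_
    rw [h1, star_mul', star_star, Pi.smul_apply, smul_eq_mul, mul_comm, Matrix.of_apply]

lemma sum_rankOneMat_col {κ : Type*} [Fintype κ] (G : Matrix κ κ ℂ) :
    ∑ b, rankOneMat (fun a => G a b) = G * Gᴴ := by
  ext a a'
  simp [Matrix.sum_apply, rankOneMat, Matrix.vecMulVec_apply, Matrix.mul_apply]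

end LurkingIsometry

/-! ### Interpolation at finitely many pairs of matrices. -/

section FiniteInterpolation

open Matrix

variable {N : ℕ} {s : Fin N → ℕ}

/-- The entries of a finite family of square matrices as one vector. -/
def blockVec (X : (n : Fin N) → Matrix (Fin (s n)) (Fin (s n)) ℂ) :
    (Σ n : Fin N, Fin (s n) × Fin (s n)) → ℂ := fun k => X k.1 k.2.1 k.2.2

/-- The family of square matrices with the given entries. -/
def blockOf (v : (Σ n : Fin N, Fin (s n) × Fin (s n)) → ℂ) (n : Fin N) :
    Matrix (Fin (s n)) (Fin (s n)) ℂ := Matrix.of fun a b => v ⟨n, a, b⟩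

lemma blockOf_blockVec (X : (n : Fin N) → Matrix (Fin (s n)) (Fin (s n)) ℂ) (n : Fin N) :
    blockOf (blockVec X) n = X n := rfl

lemma blockVec_blockOf (v : (Σ n : Fin N, Fin (s n) × Fin (s n)) → ℂ) :
    blockVec (blockOf v) = v := rfl

/-- Left multiplication by a finite family of square matrices, as one matrix. -/
def blockMul (A : (n : Fin N) → Matrix (Fin (s n)) (Fin (s n)) ℂ) :
    Matrix (Σ n : Fin N, Fin (s n) × Fin (s n)) (Σ n : Fin N, Fin (s n) × Fin (s n)) ℂ :=
  LinearMap.toMatrix'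
    { toFun := fun v => blockVec fun n => A n * blockOf v n
      map_add' := fun v w => funext fun k => by
        simp [blockVec, blockOf, Matrix.mul_apply, mul_add, Finset.sum_add_distrib]
      map_smul' := fun c v => funext fun k => by
        simp [blockVec, blockOf, Matrix.mul_apply, Finset.mul_sum, mul_left_comm] }

lemma blockMul_mulVec (A : (n : Fin N) → Matrix (Fin (s n)) (Fin (s n)) ℂ)
    (v : (Σ n : Fin N, Fin (s n) × Fin (s n)) → ℂ) :
    blockMul A *ᵥ v = blockVec fun n => A n * blockOf v n := by
  rw [blockMul, LinearMap.toMatrix'_mulVec]; rfl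

lemma blockMul_mul (A B : (n : Fin N) → Matrix (Fin (s n)) (Fin (s n)) ℂ) :
    blockMul A * blockMul B = blockMul fun n => A n * B n := by
  refine Matrix.ext_of_mulVec_single fun k => ?_
  rw [← Matrix.mulVec_mulVec, blockMul_mulVec, blockMul_mulVec, blockMul_mulVec]
  simp only [blockOf_blockVec, Matrix.mul_assoc]

lemma blockMul_pow (A : (n : Fin N) → Matrix (Fin (s n)) (Fin (s n)) ℂ) (k : ℕ) :
    blockMul A ^ k = blockMul fun n => A n ^ k := by
  induction k with
  | zero =>
    refine Matrix.ext_of_mulVec_single fun k => ?_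
    rw [blockMul_mulVec]
    simp only [pow_zero, one_mul, blockVec_blockOf, Matrix.one_mulVec]
  | succ k ih => rw [pow_succ, ih, blockMul_mul]; simp only [pow_succ]

lemma tendsto_blockMul_pow {A : (n : Fin N) → Fin 2 → Matrix (Fin (s n)) (Fin (s n)) ℂ}
    (hA : ∀ n, IsBidiscPair (A n)) (i : Fin 2) :
    Tendsto (fun k => blockMul (fun n => A n i) ^ k) atTop (𝓝 0) := by
  refine tendsto_pi_nhds.2 fun p => tendsto_pi_nhds.2 fun q => ?_
  have hentry : ∀ n a b, Tendsto (fun k => (A n i ^ k) a b) atTop (𝓝 0) := by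
    intro n a b
    obtain ⟨r, C, hr0, hr1, hC, h⟩ := (hA n).exists_norm_pow_apply_le
    refine squeeze_zero_norm (fun k => h i k a b) ?_
    simpa using (tendsto_pow_atTop_nhds_zero_of_lt_one hr0.le hr1).const_mul C
  have h1 : ∀ k, (blockMul (fun n => A n i) ^ k) p q =
      ∑ c, (A p.1 i ^ k) p.2.1 c * blockOf (Pi.single q 1) p.1 c p.2.2 := by
    intro k
    rw [blockMul_pow, ← Matrix.mul_apply]
    have h2 := congrFun (blockMul_mulVec (fun n => A n i ^ k) (Pi.single q 1)) p
    rw [Matrix.mulVec_single_one] at h2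
    exact h2
  simp only [h1]
  have h3 := tendsto_finsetSum Finset.univ fun c (_ : c ∈ Finset.univ) =>
    (hentry p.1 p.2.1 c).mul_const (blockOf (Pi.single q 1) p.1 c p.2.2)
  simpa using h3

/-- If the dual inequality holds for all forms contracted by the coordinates, then there are
functions separating finitely many pairs of matrices with a square sum bound. -/
theorem exists_finite_interpolation
    {A : (n : Fin N) → Fin 2 → Matrix (Fin (s n)) (Fin (s n)) ℂ} (hA : ∀ n, IsBidiscPair (A n))
    {c₀ c : ℝ} (hc : c₀ < c) (hc0 : 0 ≤ c)
    (h : ∀ S : Matrix (Σ n : Fin N, Fin (s n) × Fin (s n)) (Σ n : Fin N, Fin (s n) × Fin (s n)) ℂ,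
      (∀ i v, euclSq (S *ᵥ blockVec fun n => A n i * blockOf v n) ≤ euclSq (S *ᵥ v)) →
      ∑ n, euclSq (S *ᵥ blockVec (Pi.single n 1)) ≤ c₀ * euclSq (S *ᵥ blockVec 1)) :
    ∃ φ : Fin N → bidisc → ℂ, (∀ n, IsHolo (φ n)) ∧ (∀ z, ∑ n, ‖φ n z‖ ^ 2 ≤ c) ∧
      ∀ n j, evalMat (φ n) (A j) = if n = j then 1 else 0 := by
  let L : Fin 2 → Matrix (Σ n : Fin N, Fin (s n) × Fin (s n)) (Σ n : Fin N, Fin (s n) × Fin (s n)) ℂ :=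
    fun i => blockMul fun n => A n i
  let e : (Σ n : Fin N, Fin (s n) × Fin (s n)) → ℂ := blockVec 1
  -- This happens only when every matrix in the family is empty, and then zero functions suffice.
  by_cases he : e = 0
  · have h1 : ∀ n (X : Matrix (Fin (s n)) (Fin (s n)) ℂ), X = 0 := fun n X => by
      have h2 : (1 : Matrix (Fin (s n)) (Fin (s n)) ℂ) = 0 := by
        ext a b; exact congrFun he ⟨n, a, b⟩
      rw [← Matrix.mul_one X, h2, Matrix.mul_zero]
    exact ⟨fun _ _ => 0, fun _ => isHolo_const 0, fun z => by simpa using hc0,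
      fun n j => (h1 j _).trans (h1 j _).symm⟩
  have hcomm : L 0 * L 1 = L 1 * L 0 := by
    simp only [L, blockMul_mul, (hA _).comm]
  have hL : ∀ i v, L i *ᵥ v = blockVec fun n => A n i * blockOf v n := fun i v =>
    blockMul_mulVec _ v
  obtain ⟨G, hG⟩ := exists_agler_decomposition hcomm (tendsto_blockMul_pow hA) he
    (fun n : Fin N => blockVec (Pi.single n 1)) hc fun S hS => h S fun i v => by
      rw [← hL]; exact hS i v
  let ι := Fin 2 × (Σ n : Fin N, Fin (s n) × Fin (s n))
  let V : ι → (Σ n : Fin N, Fin (s n) × Fin (s n)) → ℂ := fun k a => G k.1 a k.2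
  -- Moving the negative terms of the decomposition across gives equal sums of rank one matrices:
  -- `√c • e` and the columns of `L i * G i` on one side, the `p n` and the columns of `G i` on the
  -- other. Read blockwise at `A j`, `hUX` is the linear system of the transfer function with `ω =
  -- √c`.
  obtain ⟨U, hU, hUX⟩ := exists_contraction_of_sum_rankOneMat_eq
    (Sum.elim (fun _ : Unit => ((√c : ℝ) : ℂ) • e) fun k : ι => L k.1 *ᵥ V k)
    (Sum.elim (fun n : Fin N => blockVec (Pi.single n 1)) V) (by
      have h1 : ∀ i, ∑ b, rankOneMat (V (i, b)) = G i * (G i)ᴴ := fun i => sum_rankOneMat_col _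
      have h2 : ∀ i, ∑ b, rankOneMat (L i *ᵥ V (i, b)) = L i * G i * (L i * G i)ᴴ := fun i =>
        sum_rankOneMat_col (L i * G i)
      have h3 : rankOneMat (((√c : ℝ) : ℂ) • e) = c • rankOneMat e := by
        rw [rankOneMat, rankOneMat, star_smul, Matrix.smul_vecMulVec, Matrix.vecMulVec_smul,
          smul_smul, Complex.star_def, Complex.conj_ofReal, ← Complex.ofReal_mul,
          Real.mul_self_sqrt hc0, Complex.coe_smul]
      have h4 : ∀ F : ι → Matrix (Σ n : Fin N, Fin (s n) × Fin (s n))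
          (Σ n : Fin N, Fin (s n) × Fin (s n)) ℂ, ∑ k, F k = ∑ i, ∑ b, F (i, b) :=
        Fintype.sum_prod_type
      simp only [Fintype.sum_sum_type, Sum.elim_inl, Sum.elim_inr, h4,
        Finset.univ_unique, Finset.sum_singleton, h1, h2, h3]
      rw [sub_eq_iff_eq_add, aglerDefect, Finset.sum_sub_distrib] at hG
      rw [hG]; abel)
  obtain ⟨φ, h1, h2, h3⟩ := exists_transferFunction U hU ((√c : ℝ) : ℂ) Prod.fst
  refine ⟨φ, h1, fun z => (h2 z).trans (le_of_eq ?_), fun n j => ?_⟩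
  · rw [Complex.norm_real, Real.norm_eq_abs, sq_abs, Real.sq_sqrt hc0]
  · rw [h3 (s j) (A j) (hA j) (fun b => blockOf (Sum.elim
      (fun n : Fin N => blockVec (Pi.single n 1)) V b) j) (fun b => ?_) n]
    · simp only [Sum.elim_inl, blockOf_blockVec]
      rcases eq_or_ne n j with rfl | hnj
      · rw [if_pos rfl, Pi.single_eq_same]
      · rw [if_neg hnj, Pi.single_eq_of_ne hnj.symm]
    · rw [hUX b]
      ext x y
      simp only [Fintype.sum_sum_type, Sum.elim_inl, Sum.elim_inr, Finset.univ_unique,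
        Finset.sum_singleton, hL, blockOf, Matrix.of_apply, Finset.sum_apply,
        Pi.smul_apply, Matrix.add_apply, Matrix.sum_apply, Matrix.smul_apply, smul_smul]
      rfl

end FiniteInterpolation

/-! ### Biorthogonal families for Riesz systems. -/

/-- Functionals dominated by a linear map into a Hilbert space are given by a vector. -/
lemma exists_inner_eq_of_norm_le {X H : Type*} [AddCommGroup X] [Module ℂ X] [NormedAddCommGroup H]
    [InnerProductSpace ℂ H] [CompleteSpace H] (T : X →ₗ[ℂ] H) (α : X →ₗ[ℂ] ℂ) {c : ℝ} (hc : 0 ≤ c)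
    (h : ∀ x, ‖α x‖ ≤ c * ‖T x‖) : ∃ g : H, ‖g‖ ≤ c ∧ ∀ x, inner ℂ g (T x) = α x := by
  have hker : LinearMap.ker T ≤ LinearMap.ker α := fun x hx => by
    rw [LinearMap.mem_ker] at hx ⊢
    simpa [hx] using h x
  obtain ⟨f, hf⟩ : ∃ f : LinearMap.range T →ₗ[ℂ] ℂ, ∀ x, f ⟨T x, x, rfl⟩ = α x := by
    refine ⟨(Submodule.liftQ _ α hker).comp (T.quotKerEquivRange.symm : _ →ₗ[ℂ] _), fun x => ?_⟩
    have : T.quotKerEquivRange.symm ⟨T x, x, rfl⟩ = Submodule.Quotient.mk x := by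
      rw [LinearEquiv.symm_apply_eq]; rfl
    simp [this]
  obtain ⟨F, hF, hFn⟩ := exists_extension_norm_eq (LinearMap.range T)
    (f.mkContinuous c (by rintro ⟨_, x, rfl⟩; rw [hf]; exact h x))
  refine ⟨(InnerProductSpace.toDual ℂ H).symm F, ?_, fun x => ?_⟩
  · rw [LinearIsometryEquiv.norm_map, hFn]
    exact LinearMap.mkContinuous_norm_le _ hc _
  · rw [InnerProductSpace.toDual_symm_apply]
    exact (hF ⟨T x, x, rfl⟩).trans (hf x)

section RieszDual

variable {H : Type} [NormedAddCommGroup H] [InnerProductSpace ℂ H]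

/-- Extension by zero is allowed, since `0` lies in every subspace. -/
lemma IsRieszSystem.finite {V : ℕ → Submodule ℂ H} {C : ℝ} (hV : IsRieszSystem V C)
    (N : ℕ) (x : ℕ → H) (hx : ∀ n, x n ∈ V n) :
    1 / C ^ 2 * ∑ n ∈ Finset.range N, ‖x n‖ ^ 2 ≤ ‖∑ n ∈ Finset.range N, x n‖ ^ 2 ∧
      ‖∑ n ∈ Finset.range N, x n‖ ^ 2 ≤ C ^ 2 * ∑ n ∈ Finset.range N, ‖x n‖ ^ 2 := by
  let y : ℕ → H := fun n => if n < N then x n else 0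
  have h0 : ∀ n ∉ Finset.range N, y n = 0 := fun n hn =>
    if_neg fun h => hn (Finset.mem_range.2 h)
  have h1 : ∀ n ∈ Finset.range N, y n = x n := fun n hn => if_pos (Finset.mem_range.1 hn)
  have h2 : ∀ n ∉ Finset.range N, ‖y n‖ ^ 2 = 0 := fun n hn => by rw [h0 n hn]; simp
  obtain ⟨-, h3, h4⟩ := hV y (fun n => by
    by_cases hn : n < N
    · simp only [y, if_pos hn]; exact hx n
    · simp only [y, if_neg hn]; exact (V n).zero_mem) (summable_of_ne_finset_zero h2)
  have h5 : ∑ n ∈ Finset.range N, ‖y n‖ ^ 2 = ∑ n ∈ Finset.range N, ‖x n‖ ^ 2 :=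
    Finset.sum_congr rfl fun n hn => by rw [h1 n hn]
  rw [tsum_eq_sum h0, tsum_eq_sum h2, Finset.sum_congr rfl h1, h5] at h3 h4
  exact ⟨h3, h4⟩

variable [CompleteSpace H]

/-- A Riesz system has a bounded biorthogonal family for the projections of a vector. -/
lemma IsRieszSystem.exists_dual {V : ℕ → Submodule ℂ H} {C : ℝ} (hC : 0 < C)
    (hV : IsRieszSystem V C) (N : ℕ) (v : H) (u : ℕ → H) (hu : ∀ n, u n ∈ V n)
    (huv : ∀ n, ∀ x ∈ V n, inner ℂ (u n) x = inner ℂ v x) :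
    ∃ g : ℕ → H, (∀ n < N, ∀ j < N, ∀ x ∈ V j,
      inner ℂ (g n) x = if n = j then inner ℂ v x else 0) ∧
      ∑ n ∈ Finset.range N, ‖g n‖ ^ 2 ≤ C ^ 4 * ‖v‖ ^ 2 := by
  -- The `u n` are the projections of `v`. Their square sum equals `⟨v, ∑ u n⟩`, to which
  -- Cauchy–Schwarz and the upper Riesz bound apply; the lower bound then costs the second factor `C
  -- ^ 2`.
  have hupper : ∑ n ∈ Finset.range N, ‖u n‖ ^ 2 ≤ C ^ 2 * ‖v‖ ^ 2 := by
    set σ := ∑ n ∈ Finset.range N, ‖u n‖ ^ 2 with hσ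
    have hσ0 : 0 ≤ σ := by positivity
    have h1 : (σ : ℂ) = inner ℂ v (∑ n ∈ Finset.range N, u n) := by
      rw [inner_sum, hσ]
      push_cast
      refine Finset.sum_congr rfl fun n _ => ?_
      rw [← huv n _ (hu n), inner_self_eq_norm_sq_to_K]; rfl
    have h2 : σ ≤ ‖v‖ * ‖∑ n ∈ Finset.range N, u n‖ := by
      have := norm_inner_le_norm (𝕜 := ℂ) v (∑ n ∈ Finset.range N, u n)
      rwa [← h1, Complex.norm_real, Real.norm_of_nonneg hσ0] at this
    have h3 := (hV.finite N u hu).2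
    have h4 : σ * σ ≤ (C ^ 2 * ‖v‖ ^ 2) * σ := by
      calc σ * σ = σ ^ 2 := (sq σ).symm
        _ ≤ (‖v‖ * ‖∑ n ∈ Finset.range N, u n‖) ^ 2 := pow_le_pow_left₀ hσ0 h2 2
        _ = ‖v‖ ^ 2 * ‖∑ n ∈ Finset.range N, u n‖ ^ 2 := mul_pow _ _ _
        _ ≤ ‖v‖ ^ 2 * (C ^ 2 * σ) := by gcongr
        _ = _ := by ring
    rcases hσ0.eq_or_lt with h5 | h5
    · rw [← h5]; positivity
    · exact le_of_mul_le_mul_right h4 h5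
  have hex : ∀ n, ∃ g : H, ‖g‖ ≤ C * ‖u n‖ ∧ (n < N → ∀ j < N, ∀ x ∈ V j,
      inner ℂ g x = if n = j then inner ℂ v x else 0) := by
    intro n
    by_cases hn : n < N
    swap
    · exact ⟨0, by simpa using by positivity, fun h => absurd h hn⟩
    -- By the lower Riesz bound the `n`-th component is controlled by the sum, so pairing it with `u
    -- n` gives a bounded functional of the sum, represented by `g`.
    let T : ((k : ℕ) → V k) →ₗ[ℂ] H :=
      ∑ k ∈ Finset.range N, (V k).subtype ∘ₗ LinearMap.proj k
    have hT : ∀ x, T x = ∑ k ∈ Finset.range N, (x k : H) := fun x => by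
      simp [T, LinearMap.sum_apply]
    let α : ((k : ℕ) → V k) →ₗ[ℂ] ℂ :=
      (innerSL ℂ (u n)).toLinearMap ∘ₗ (V n).subtype ∘ₗ LinearMap.proj n
    have hα : ∀ x, α x = inner ℂ (u n) (x n : H) := fun x => rfl
    obtain ⟨g, hg, hgT⟩ := exists_inner_eq_of_norm_le T α (c := C * ‖u n‖) (by positivity)
      fun x => by
        rw [hα, hT]
        have h1 := (hV.finite N (fun k => (x k : H)) fun k => (x k).2).1
        have h2 : ‖(x n : H)‖ ^ 2 ≤ (C * ‖∑ k ∈ Finset.range N, (x k : H)‖) ^ 2 := by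
          refine (Finset.single_le_sum (f := fun k => ‖(x k : H)‖ ^ 2)
            (fun _ _ => by positivity) (Finset.mem_range.2 hn)).trans ?_
          rw [one_div, inv_mul_le_iff₀ (by positivity)] at h1
          rw [mul_pow]; exact h1
        have h3 := (pow_le_pow_iff_left₀ (norm_nonneg _) (by positivity) two_ne_zero).1 h2
        calc _ ≤ ‖u n‖ * ‖(x n : H)‖ := norm_inner_le_norm _ _
          _ ≤ ‖u n‖ * (C * ‖∑ k ∈ Finset.range N, (x k : H)‖) := by gcongr
          _ = _ := by ring
    refine ⟨g, hg, fun _ j hj x hx => ?_⟩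
    have h1 := hgT (Pi.single j ⟨x, hx⟩)
    rw [hT, hα, Finset.sum_eq_single j] at h1
    · rw [Pi.single_eq_same] at h1
      rw [h1]
      rcases eq_or_ne n j with rfl | hnj
      · rw [if_pos rfl, Pi.single_eq_same]; exact huv n x hx
      · rw [if_neg hnj, Pi.single_eq_of_ne hnj]; simp
    · intro k _ hk; rw [Pi.single_eq_of_ne hk]; rfl
    · exact fun h => absurd (Finset.mem_range.2 hj) h
  choose g hg hgV using hex
  refine ⟨g, fun n hn => hgV n hn, ?_⟩
  calc ∑ n ∈ Finset.range N, ‖g n‖ ^ 2 ≤ ∑ n ∈ Finset.range N, C ^ 2 * ‖u n‖ ^ 2 :=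
        Finset.sum_le_sum fun n _ => by
          rw [← mul_pow]; exact pow_le_pow_left₀ (norm_nonneg _) (hg n) 2
    _ ≤ C ^ 2 * (C ^ 2 * ‖v‖ ^ 2) := by rw [← Finset.mul_sum]; gcongr
    _ = _ := by ring

/-- If the model spaces are a Riesz system then there are elements of `H` separating the pairs of
matrices, with a square sum bound. -/
lemma exists_separating_of_isRieszSystem [RKHS ℂ H bidisc ℂ] (hH : ∀ f : H, IsHolo ⇑f) {s : ℕ → ℕ}
    {A : (n : ℕ) → Fin 2 → Matrix (Fin (s n)) (Fin (s n)) ℂ} (hA : ∀ n, IsBidiscPair (A n))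
    (hcl : ∀ n, IsClosed {f : H | evalMat (⇑f) (A n) = 0}) {C : ℝ} (hC : 0 < C)
    (hV : IsRieszSystem (fun n => modelSpace H (A n)) C) {v : H} (hv : ⇑v = fun _ => 1) (N : ℕ) :
    ∃ g : ℕ → H, (∀ n < N, ∀ j < N, evalMat (⇑(g n)) (A j) = if n = j then 1 else 0) ∧
      ∑ n ∈ Finset.range N, ‖g n‖ ^ 2 ≤ C ^ 4 * ‖v‖ ^ 2 := by
  let K : (n : ℕ) → Submodule ℂ H := fun n => LinearMap.ker (evalLinear hH (hA n))
  have hK : ∀ n f, f ∈ K n ↔ evalMat (⇑f) (A n) = 0 := fun n f => Iff.rfl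
  have hmodel : ∀ n, modelSpace H (A n) = (K n)ᗮ := fun n => by
    rw [modelSpace, show {f : H | evalMat (⇑f) (A n) = 0} = K n from rfl, Submodule.span_eq]
  have hcomplete : ∀ n, CompleteSpace (K n) := fun n => (hcl n).completeSpace_coe
  have hperp : ∀ n f, (∀ x ∈ modelSpace H (A n), inner ℂ f x = 0) → f ∈ K n := by
    intro n f hf
    rw [← Submodule.orthogonal_orthogonal (K n), Submodule.mem_orthogonal']
    exact fun x hx => hf x (by rw [hmodel]; exact hx)
  have hv1 : ∀ n, evalMat (⇑v) (A n) = 1 := fun n => by rw [hv, (hA n).evalMat_one]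
  obtain ⟨g, hg, hgn⟩ := hV.exists_dual hC N v (fun n => v - (K n).starProjection v)
    (fun n => by rw [hmodel]; exact Submodule.sub_starProjection_mem_orthogonal _)
    (fun n x hx => by
      rw [inner_sub_left, sub_eq_self]
      rw [hmodel] at hx
      exact hx _ (Submodule.starProjection_apply_mem _ _))
  refine ⟨g, fun n hn j hj => ?_, hgn⟩
  rcases eq_or_ne n j with rfl | hnj
  -- Biorthogonality determines `g n` modulo the double orthogonal complement of the kernel, which
  -- is the kernel itself because it is closed.
  · have h1 : g n - v ∈ K n := hperp n _ fun x hx => by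
      rw [inner_sub_left, hg n hn n hj x hx, if_pos rfl, sub_self]
    have h2 : evalLinear hH (hA n) (g n) = evalLinear hH (hA n) v := by
      rw [← sub_eq_zero, ← map_sub]; exact h1
    rw [if_pos rfl]
    exact h2.trans (hv1 n)
  · rw [if_neg hnj, ← hK]
    exact hperp j _ fun x hx => by rw [hg n hn j hj x hx, if_neg hnj]

end RieszDual

/-! ### The Hardy space of the bidisc. -/

/-- The Hardy space of the bidisc, as a space of coefficients. -/
abbrev Hardy : Type := lp (fun _ : ℕ × ℕ => ℂ) 2

namespace Hardy

lemma hasSum_norm_sq (a : Hardy) : HasSum (fun m => ‖a m‖ ^ 2) (‖a‖ ^ 2) := by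
  have := lp.hasSum_norm (p := 2) (by norm_num) a
  simpa using this

lemma norm_coeff_le (a : Hardy) (m : ℕ × ℕ) : ‖a m‖ ≤ ‖a‖ :=
  lp.norm_apply_le_norm (by norm_num) a m

lemma summable (a : Hardy) (z : bidisc) : Summable fun m => a m * mono2 m z.1 :=
  summable_coeff_mul_mono2 (R := 1) (B := ‖a‖) one_pos (by simpa using a.norm_coeff_le) z.2

lemma isHolo (a : Hardy) : IsHolo (seriesFun a) := isHolo_seriesFun a.norm_coeff_le

lemma norm_seriesFun_le (a : Hardy) {r : ℝ} (hr0 : 0 ≤ r) (hr1 : r < 1) {z : bidisc}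
    (hz : ∀ i, ‖z.1 i‖ ≤ r) : ‖seriesFun a z‖ ≤ ‖a‖ * ∑' m : ℕ × ℕ, r ^ m.1 * r ^ m.2 := by
  rw [← tsum_mul_left]
  refine tsum_of_norm_bounded ((summable_pow_mul_pow hr0 hr1).mul_left ‖a‖).hasSum fun m => ?_
  simpa using norm_coeff_mul_mono2_le (R := 1) (B := ‖a‖) one_pos (by simpa using a.norm_coeff_le)
    hz m

lemma seriesFun_add (a b : Hardy) (z : bidisc) :
    seriesFun (⇑(a + b)) z = seriesFun a z + seriesFun b z := by
  rw [seriesFun, seriesFun, seriesFun, ← (a.summable z).tsum_add (b.summable z)]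
  simp only [lp.coeFn_add, Pi.add_apply, add_mul]

lemma seriesFun_smul (c : ℂ) (a : Hardy) (z : bidisc) :
    seriesFun (⇑(c • a)) z = c * seriesFun a z := by
  rw [seriesFun, seriesFun, ← tsum_mul_left]
  simp only [lp.coeFn_smul, Pi.smul_apply, smul_eq_mul, mul_assoc]

/-- The functions defined by the elements of the Hardy space. -/
noncomputable def toFun : Hardy →L[ℂ] bidisc → ℂ :=
  ContinuousLinearMap.pi fun z => LinearMap.mkContinuous
    { toFun := fun a => seriesFun a z
      map_add' := fun a b => seriesFun_add a b z
      map_smul' := fun c a => seriesFun_smul c a z }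
    (∑' m : ℕ × ℕ, max ‖z.1 0‖ ‖z.1 1‖ ^ m.1 * max ‖z.1 0‖ ‖z.1 1‖ ^ m.2) fun a => by
      rw [mul_comm]
      refine norm_seriesFun_le a ((norm_nonneg _).trans (le_max_left _ _))
        (max_lt (z.2 0) (z.2 1)) fun i => ?_
      fin_cases i
      exacts [le_max_left _ _, le_max_right _ _]

lemma toFun_apply (a : Hardy) : toFun a = seriesFun a := rfl

lemma toFun_injective : Function.Injective toFun := by
  intro a b h
  ext m
  have h1 := torusCoeff_seriesFun a.norm_coeff_le (r := 1 / 2) (by norm_num) (by norm_num) m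
  have h2 := torusCoeff_seriesFun b.norm_coeff_le (r := 1 / 2) (by norm_num) (by norm_num) m
  rw [← h1, ← h2, ← toFun_apply, ← toFun_apply, h]

/-- Evaluation at a pair of matrices, entry by entry. -/
lemma exists_evalMat_entry {m : ℕ} {M : Fin 2 → Matrix (Fin m) (Fin m) ℂ} (hM : IsBidiscPair M)
    (i j : Fin m) : ∃ l : Hardy →L[ℂ] ℂ, ∀ a, l a = evalMat (seriesFun a) M i j := by
  obtain ⟨K, r, hK, hr0, hr1, h⟩ := hM.exists_evalMat_bound
  refine ⟨LinearMap.mkContinuous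
    { toFun := fun a => evalMat (seriesFun a) M i j
      map_add' := fun a b => ?_
      map_smul' := fun c a => ?_ } (K * ∑' m : ℕ × ℕ, r ^ m.1 * r ^ m.2) fun a => ?_, fun a => rfl⟩
  · rw [funext (seriesFun_add a b), hM.evalMat_add a.isHolo b.isHolo, Matrix.add_apply]
  · rw [funext (seriesFun_smul c a), hM.evalMat_const_mul a.isHolo]; rfl
  · refine (h _ _ a.isHolo (fun z hz => norm_seriesFun_le a hr0.le hr1 fun i => (hz i).le)
      i j).trans (le_of_eq ?_)
    ring

/-- Shift of a pair of exponents. -/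
def expShift (i : Fin 2) (m : ℕ × ℕ) : ℕ × ℕ := if i = 0 then (m.1 + 1, m.2) else (m.1, m.2 + 1)

lemma expShift_injective (i : Fin 2) : Function.Injective (expShift i) := by
  rintro ⟨a, b⟩ ⟨c, d⟩ h
  fin_cases i <;> simpa [expShift] using h

lemma mono2_expShift (i : Fin 2) (m : ℕ × ℕ) (z : Fin 2 → ℂ) :
    mono2 (expShift i m) z = z i * mono2 m z := by
  fin_cases i <;> simp [expShift, mono2, pow_succ] <;> ring

/-- Multiplication by a coordinate is isometric on the Hardy space. -/
lemma exists_shift (i : Fin 2) (a : Hardy) : ∃ b : Hardy,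
    (∀ z, seriesFun b z = z.1 i * seriesFun a z) ∧ ‖b‖ = ‖a‖ := by
  have hext : ∀ (g : ℂ → ℝ), g 0 = 0 → (fun m => g (Function.extend (expShift i) a 0 m)) =
      Function.extend (expShift i) (fun m => g (a m)) 0 := fun g hg => by
    funext m
    by_cases hm : ∃ k, expShift i k = m
    · obtain ⟨k, rfl⟩ := hm
      rw [(expShift_injective i).extend_apply, (expShift_injective i).extend_apply]
    · rw [Function.extend_apply' _ _ _ hm, Function.extend_apply' _ _ _ hm]; simpa using hg
  have hsum : HasSum (fun m => ‖Function.extend (expShift i) a 0 m‖ ^ 2) (‖a‖ ^ 2) := by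
    rw [hext (fun w => ‖w‖ ^ 2) (by simp), hasSum_extend_zero (expShift_injective i)]
    exact a.hasSum_norm_sq
  let b : Hardy := ⟨Function.extend (expShift i) a 0, memℓp_gen (by simpa using hsum.summable)⟩
  refine ⟨b, fun z => ?_, ?_⟩
  · have h1 : (fun m => b m * mono2 m z.1) =
        Function.extend (expShift i) (fun m => z.1 i * (a m * mono2 m z.1)) 0 := by
      funext m
      by_cases hm : ∃ k, expShift i k = m
      · obtain ⟨k, rfl⟩ := hm
        change Function.extend (expShift i) a 0 _ * _ = _
        rw [(expShift_injective i).extend_apply, (expShift_injective i).extend_apply,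
          mono2_expShift]
        ring
      · change Function.extend (expShift i) a 0 _ * _ = _
        rw [Function.extend_apply' _ _ _ hm, Function.extend_apply' _ _ _ hm]; simp
    rw [seriesFun, h1]
    exact ((hasSum_extend_zero (expShift_injective i)).2
      ((a.summable z).hasSum.mul_left (z.1 i))).tsum_eq
  · have h1 : ‖b‖ ^ 2 = ‖a‖ ^ 2 := b.hasSum_norm_sq.unique hsum
    exact (sq_eq_sq₀ (norm_nonneg _) (norm_nonneg _)).1 h1

/-- The constant function one. -/
lemma exists_one : ∃ a : Hardy, (seriesFun a = fun _ => 1) ∧ ‖a‖ = 1 := by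
  refine ⟨lp.single 2 (0, 0) 1, ?_, by rw [lp.norm_single (by norm_num)]; simp⟩
  funext z
  rw [seriesFun, tsum_eq_single (0, 0)]
  · simp [mono2]
  · intro m hm
    simp [lp.single_apply, Pi.single_eq_of_ne hm]

end Hardy

/-! ### Admissible renormings of the Hardy space. -/

section GraphSpace

variable {E : Type} [NormedAddCommGroup E] [InnerProductSpace ℂ E]

/-- The graph of an operator on the Hardy space, a Hilbert space of functions with a larger norm. -/
noncomputable def graphSpace (Φ : Hardy →L[ℂ] E) : Submodule ℂ (WithLp 2 (Hardy × E)) :=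
  (WithLp.sndL 2 ℂ Hardy E - Φ ∘L WithLp.fstL 2 ℂ Hardy E).ker

variable (Φ : Hardy →L[ℂ] E)

lemma mem_graphSpace (x : WithLp 2 (Hardy × E)) : x ∈ graphSpace Φ ↔ x.snd = Φ x.fst := by
  rw [graphSpace, LinearMap.mem_ker]
  exact sub_eq_zero

instance [CompleteSpace E] : CompleteSpace (graphSpace Φ) :=
  (WithLp.sndL 2 ℂ Hardy E - Φ ∘L WithLp.fstL 2 ℂ Hardy E).isClosed_ker.completeSpace_coe

/-- A graph element is determined by its Hardy component, hence by its function; evaluations remain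
continuous under the larger norm. -/
noncomputable instance : RKHS ℂ (graphSpace Φ) bidisc ℂ where
  coeCLM := Hardy.toFun ∘L WithLp.fstL 2 ℂ Hardy E ∘L (graphSpace Φ).subtypeL
  coeCLM_injective := by
    intro x y h
    have h1 : x.1.fst = y.1.fst := Hardy.toFun_injective h
    refine Subtype.ext (WithLp.ofLp_injective 2 (Prod.ext h1 ?_))
    exact ((mem_graphSpace Φ _).1 x.2).trans ((congrArg Φ h1).trans ((mem_graphSpace Φ _).1 y.2).symm)

lemma graphSpace_norm_sq (x : graphSpace Φ) : ‖x‖ ^ 2 = ‖x.1.fst‖ ^ 2 + ‖Φ x.1.fst‖ ^ 2 := by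
  rw [← (mem_graphSpace Φ _).1 x.2]
  exact WithLp.prod_norm_sq_eq_of_L2 x.1

/-- The element of the graph space over an element of the Hardy space. -/
noncomputable def graphMk (a : Hardy) : graphSpace Φ := ⟨WithLp.toLp 2 (a, Φ a), (mem_graphSpace Φ _).2 rfl⟩

/-- The Hardy part of the norm is preserved by the coordinates and the part from `Φ` is contracted.
-/
lemma isAdmissible_graphSpace (h : ∀ i (a b : Hardy), (∀ z, seriesFun b z = z.1 i * seriesFun a z) →
    ‖Φ b‖ ≤ ‖Φ a‖) : IsAdmissible (graphSpace Φ) := by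
  refine ⟨fun f => Hardy.isHolo _, fun i f => ?_⟩
  obtain ⟨b, hb, hbn⟩ := Hardy.exists_shift i f.1.fst
  refine ⟨graphMk Φ b, hb, (pow_le_pow_iff_left₀ (norm_nonneg _) (norm_nonneg _) two_ne_zero).1 ?_⟩
  rw [graphSpace_norm_sq, graphSpace_norm_sq]
  exact add_le_add (le_of_eq (by rw [← hbn]; rfl))
    (pow_le_pow_left₀ (norm_nonneg _) (h i _ _ hb) 2)

lemma isClosed_evalMat_eq_zero {m : ℕ} {M : Fin 2 → Matrix (Fin m) (Fin m) ℂ}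
    (hM : IsBidiscPair M) : IsClosed {f : graphSpace Φ | evalMat (⇑f) M = 0} := by
  choose l hl using Hardy.exists_evalMat_entry hM
  have : {f : graphSpace Φ | evalMat (⇑f) M = 0} =
      ⋂ i, ⋂ j, {f : graphSpace Φ | l i j f.1.fst = 0} := by
    ext f
    simp only [Set.mem_iInter]
    exact ⟨fun h i j => (hl i j _).trans (congrFun (congrFun h i) j),
      fun h => Matrix.ext fun i j => (hl i j _).symm.trans (h i j)⟩
  rw [this]
  refine isClosed_iInter fun i => isClosed_iInter fun j => isClosed_eq ?_ continuous_const
  exact (l i j ∘L WithLp.fstL 2 ℂ Hardy E ∘L (graphSpace Φ).subtypeL).continuous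

end GraphSpace

/-! ### The dual inequality and the construction of peak functions. -/

section DualInequality

open Matrix

variable {N : ℕ} {s : Fin N → ℕ}

/-- The values at finitely many pairs of matrices, transformed by a matrix, as an operator. -/
lemma exists_evaluationOperator
    {A : (n : Fin N) → Fin 2 → Matrix (Fin (s n)) (Fin (s n)) ℂ} (hA : ∀ n, IsBidiscPair (A n))
    (S : Matrix (Σ n : Fin N, Fin (s n) × Fin (s n)) (Σ n : Fin N, Fin (s n) × Fin (s n)) ℂ)
    (t : ℝ) : ∃ Φ : Hardy →L[ℂ] EuclideanSpace ℂ (Σ n : Fin N, Fin (s n) × Fin (s n)),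
      ∀ a, ‖Φ a‖ ^ 2 =
        t ^ 2 * euclSq (S *ᵥ blockVec fun n => evalMat (seriesFun a) (A n)) := by
  choose l hl using fun n => Hardy.exists_evalMat_entry (hA n)
  refine ⟨(t : ℂ) • ((EuclideanSpace.equiv (Σ n : Fin N, Fin (s n) × Fin (s n)) ℂ).symm
    : _ →L[ℂ] _) ∘L ContinuousLinearMap.pi fun k => ∑ k', S k k' • l k'.1 k'.2.1 k'.2.2,
    fun a => ?_⟩
  rw [_root_.smul_apply, norm_smul, mul_pow, Complex.norm_real, Real.norm_eq_abs, sq_abs,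
    EuclideanSpace.norm_sq_eq, euclSq]
  congr 1
  refine Finset.sum_congr rfl fun k _ => ?_
  congr 2
  change (∑ k', S k k' • l k'.1 k'.2.1 k'.2.2) a = _
  simp only [_root_.sum_apply, _root_.smul_apply, hl, smul_eq_mul]
  rfl

end DualInequality

section MainImplication

open Matrix

variable {s : ℕ → ℕ} {A : (n : ℕ) → Fin 2 → Matrix (Fin (s n)) (Fin (s n)) ℂ}

/-- The inequality dual to interpolation, from the Riesz bounds of all admissible spaces. -/
lemma sum_euclSq_le_of_isRieszSystem (hA : ∀ n, IsBidiscPair (A n)) {C : ℝ} (hC : 0 < C)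
    (h : ∀ (H : Type) [NormedAddCommGroup H] [InnerProductSpace ℂ H] [CompleteSpace H]
      [RKHS ℂ H bidisc ℂ], IsAdmissible H → IsRieszSystem (fun n => modelSpace H (A n)) C)
    (N : ℕ) (S : Matrix (Σ n : Fin N, Fin (s n) × Fin (s n)) (Σ n : Fin N, Fin (s n) × Fin (s n)) ℂ)
    (hS : ∀ i v, euclSq (S *ᵥ blockVec fun n => A n i * blockOf v n) ≤ euclSq (S *ᵥ v)) :
    ∑ n, euclSq (S *ᵥ blockVec (Pi.single n 1)) ≤ C ^ 4 * euclSq (S *ᵥ blockVec 1) := by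
  have hC4 : 0 < C ^ 4 := by positivity
  -- In the graph norm with weight `t` the function one has squared norm `1 + t² |S e|²`, while any
  -- function with the values `p n` has at least `t² |S (p n)|²`. Uniformity of `C` over all spaces
  -- lets `t` grow.
  have key : ∀ t : ℝ, t ^ 2 * ∑ n, euclSq (S *ᵥ blockVec (Pi.single n 1)) ≤
      C ^ 4 * (1 + t ^ 2 * euclSq (S *ᵥ blockVec 1)) := by
    intro t
    obtain ⟨Φ, hΦ⟩ := exists_evaluationOperator (A := fun n : Fin N => A n) (fun n => hA n) S t
    have hadm : IsAdmissible (graphSpace Φ) := isAdmissible_graphSpace Φ fun i a b hab => by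
      refine (pow_le_pow_iff_left₀ (norm_nonneg _) (norm_nonneg _) two_ne_zero).1 ?_
      rw [hΦ, hΦ]
      refine mul_le_mul_of_nonneg_left ?_ (sq_nonneg t)
      have hev : (fun n : Fin N => evalMat (seriesFun b) (A n)) =
          fun n : Fin N => A n i * evalMat (seriesFun a) (A n) := funext fun n => by
        rw [funext hab, (hA n).evalMat_mul (isHolo_coord i) a.isHolo, (hA n).evalMat_coord]
      rw [hev]
      exact hS i (blockVec fun n => evalMat (seriesFun a) (A n))
    obtain ⟨e, he, hen⟩ := Hardy.exists_one
    obtain ⟨g, hg, hgn⟩ := exists_separating_of_isRieszSystem hadm.1 hA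
      (fun n => isClosed_evalMat_eq_zero Φ (hA n)) hC (h _ hadm) (v := graphMk Φ e) he N
    have hv : ‖graphMk Φ e‖ ^ 2 = 1 + t ^ 2 * euclSq (S *ᵥ blockVec 1) := by
      rw [graphSpace_norm_sq]
      change ‖e‖ ^ 2 + ‖Φ e‖ ^ 2 = _
      have h1 : (fun n : Fin N => evalMat (seriesFun e) (A n)) = 1 := funext fun n => by
        rw [he]; exact (hA n).evalMat_one
      rw [hen, hΦ, h1, one_pow]
    rw [← hv]
    refine le_trans ?_ hgn
    rw [Finset.sum_range, Finset.mul_sum]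
    refine Finset.sum_le_sum fun n _ => ?_
    rw [graphSpace_norm_sq, hΦ]
    have hev : (fun j : Fin N => evalMat (seriesFun (g n).1.fst) (A j)) = Pi.single n 1 := by
      funext j
      refine (hg n n.2 j j.2).trans ?_
      rcases eq_or_ne n j with rfl | hnj
      · rw [if_pos rfl, Pi.single_eq_same]
      · rw [if_neg fun h => hnj (Fin.ext h), Pi.single_eq_of_ne hnj.symm]
    rw [hev]
    exact le_add_of_nonneg_left (sq_nonneg _)
  refine le_of_forall_pos_le_add fun ε hε => ?_
  -- With this weight the Hardy norm of the constant contributes exactly `ε` after division by `t²`.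
  have h1 := key √(C ^ 4 / ε)
  rw [Real.sq_sqrt (by positivity)] at h1
  have h2 : C ^ 4 * (1 + C ^ 4 / ε * euclSq (S *ᵥ blockVec 1)) =
      C ^ 4 / ε * (C ^ 4 * euclSq (S *ᵥ blockVec 1) + ε) := by
    field_simp
    ring
  rw [h2] at h1
  exact le_of_mul_le_mul_left h1 (by positivity)

/-- Riesz systems with a common bound give functions as in the theorem of Varopoulos. -/
theorem exists_peak_of_isRieszSystem (hA : ∀ n, IsBidiscPair (A n)) {C : ℝ} (hC : 0 < C)
    (h : ∀ (H : Type) [NormedAddCommGroup H] [InnerProductSpace ℂ H] [CompleteSpace H]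
      [RKHS ℂ H bidisc ℂ], IsAdmissible H → IsRieszSystem (fun n => modelSpace H (A n)) C) :
    ∃ f : ℕ → bidisc → ℂ, (∀ n, f n ∈ HInfty) ∧
      (∀ n j, evalMat (f n) (A j) =
        if n = j then (1 : Matrix (Fin (s j)) (Fin (s j)) ℂ) else 0) ∧
      ∃ B : ℝ, ∀ z, Summable (fun n => ‖f n z‖) ∧ ∑' n, ‖f n z‖ ≤ B := by
  -- Any constant above `C ^ 4` serves: the separation argument needs a strict gap.
  set c : ℝ := C ^ 4 + 1 with hc
  have hc0 : 0 ≤ c := by positivity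
  choose φ hφ hφc hφA using fun N => exists_finite_interpolation (A := fun n : Fin N => A n)
    (fun n => hA n) (show C ^ 4 < c by linarith) hc0
    (fun S hS => sum_euclSq_le_of_isRieszSystem hA hC h N S hS)
  let F : ℕ → ℕ → bidisc → ℂ := fun N n => if hn : n < N then φ N ⟨n, hn⟩ else fun _ => 0
  have hF : ∀ N n, IsHolo (F N n) := fun N n => by
    by_cases hn : n < N
    · simp only [F, dif_pos hn]; exact hφ N _
    · simp only [F, dif_neg hn]; exact isHolo_const 0
  have hFsum : ∀ N (T : Finset ℕ) z, ∑ n ∈ T, ‖F N n z‖ ^ 2 ≤ c := by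
    intro N T z
    have h1 : ∑ n ∈ Finset.range N, ‖F N n z‖ ^ 2 ≤ c := by
      rw [Finset.sum_range]
      refine le_trans (le_of_eq (Finset.sum_congr rfl fun n _ => ?_)) (hφc N z)
      simp only [F, dif_pos n.2]
    refine le_trans ?_ h1
    rw [← Finset.sum_filter_add_sum_filter_not T fun n => n < N,
      Finset.sum_eq_zero (s := T.filter fun n => ¬ n < N), add_zero]
    · exact Finset.sum_le_sum_of_subset_of_nonneg
        (fun n hn => Finset.mem_range.2 (Finset.mem_filter.1 hn).2) fun _ _ _ => by positivity
    · intro n hn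
      simp [F, dif_neg (Finset.mem_filter.1 hn).2]
  have hbound : ∀ x : ℂ, ‖x‖ ^ 2 ≤ c → ‖x‖ ≤ c + 1 := fun x hx => by
    nlinarith [sq_nonneg (‖x‖ - 1), norm_nonneg x]
  have hFB : ∀ N n z, ‖F N n z‖ ≤ c + 1 := fun N n z =>
    hbound _ (by simpa using hFsum N {n} z)
  obtain ⟨σ, hσ, G, hG, hlim⟩ := montel F hF (c + 1) hFB
  have hGsum : ∀ (T : Finset ℕ) z, ∑ n ∈ T, ‖G n z‖ ^ 2 ≤ c := fun T z =>
    le_of_tendsto' (tendsto_finsetSum T fun n _ => ((hlim n z).norm.pow 2))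
      fun k => hFsum (σ k) T z
  have hGA : ∀ n j, evalMat (G n) (A j) = if n = j then 1 else 0 := by
    intro n j
    refine tendsto_nhds_unique ((hA j).tendsto_evalMat (c + 1) (fun k => hF (σ k) n) (hG n)
      (fun k z => hFB (σ k) n z) (hlim n)) (tendsto_const_nhds.congr' ?_)
    filter_upwards [hσ.tendsto_atTop.eventually_gt_atTop n,
      hσ.tendsto_atTop.eventually_gt_atTop j] with k hn hj
    simp only [F, dif_pos hn]
    have := hφA (σ k) ⟨n, hn⟩ ⟨j, hj⟩
    simp only [Fin.mk.injEq] at this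
    exact this.symm
  -- Squaring preserves the values `0` and `1` at the matrices and turns the square sum bound into
  -- an absolute one.
  refine ⟨fun n z => G n z * G n z, fun n => ⟨(hG n).mul (hG n), c, fun z => ?_⟩, fun n j => ?_, c,
    fun z => ?_⟩
  · rw [norm_mul, ← sq]
    simpa using hGsum {n} z
  · rw [(hA j).evalMat_mul (hG n) (hG n), hGA]
    split_ifs <;> simp
  · simp only [← sq, norm_pow]
    have hs : Summable fun n => ‖G n z‖ ^ 2 :=
      summable_of_sum_le (fun n => by positivity) fun T => hGsum T z
    exact ⟨hs, hs.tsum_le_of_sum_le fun T => hGsum T z⟩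

end MainImplication

theorem theorem2p5 (s : ℕ → ℕ) (A : (n : ℕ) → Fin 2 → Matrix (Fin (s n)) (Fin (s n)) ℂ)
    (hcomm : ∀ n, A n 0 * A n 1 = A n 1 * A n 0)
    (hspec : ∀ n, jointSpectrum (A n) ⊆ bidisc) :
    List.TFAE [
      IsInterpolating A,
      ∀ w : ℕ → ℂ, (∃ B : ℝ, ∀ n, ‖w n‖ ≤ B) →
        ∃ φ ∈ HInfty, ∀ n, evalMat φ (A n) = w n • (1 : Matrix (Fin (s n)) (Fin (s n)) ℂ),
      ∃ C : ℝ, 0 < C ∧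
        ∀ (H : Type) [NormedAddCommGroup H] [InnerProductSpace ℂ H] [CompleteSpace H]
          [RKHS ℂ H bidisc ℂ], IsAdmissible H →
            IsRieszSystem (fun n => modelSpace H (A n)) C,
      ∃ f : ℕ → bidisc → ℂ, (∀ n, f n ∈ HInfty) ∧
        (∀ n j, evalMat (f n) (A j) =
          if n = j then (1 : Matrix (Fin (s j)) (Fin (s j)) ℂ) else 0) ∧
        ∃ B : ℝ, ∀ z, Summable (fun n => ‖f n z‖) ∧ ∑' n, ‖f n z‖ ≤ B] := by
  have hA : ∀ n, IsBidiscPair (A n) := fun n => ⟨hcomm n, hspec n⟩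
  tfae_have 1 → 2 := fun h w hw => exists_scalar_interpolation hA h w hw
  tfae_have 2 → 3 := fun h => exists_isRieszSystem hA h
  tfae_have 3 → 4 := fun ⟨C, hC, h⟩ => exists_peak_of_isRieszSystem hA hC h
  tfae_have 4 → 1 := fun ⟨f, hf, hfA, B, hB⟩ =>
    isInterpolating_of_peak hA (fun n => (hf n).1) hfA hB
  tfae_finish
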